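/- **Setting.** Let $r\ge 2$ and $J=\{1<2<\cdots<r<0<\overline r<\cdots<\overline 2<\overline 1\}$, $|l|=|\overline l|=l$. Let $V$ be the complex vector space with basis $(v_j)_{j\in J}$, the vector representation of the Lie algebra of type $B_r$: for $i<r$, $e_iv_{i+1}=v_i$, $e_iv_{\overline i}=v_{\overline{i+1}}$, $f_iv_i=v_{i+1}$, $f_iv_{\overline{i+1}}=v_{\overline i}$; $e_rv_{\overline r}=v_0$, $e_rv_0=2v_r$, $f_rv_r=v_0$, $f_rv_0=2v_{\overline r}$; all other actions of $e_i,f_i$ on basis vectors are $0$; $h_i=[e_i,f_i]$, which is diagonal in the basis $(v_j)$. Let $G=SO_{2r+1}(\mathbb C)\subset SL(V)$ be the special orthogonal group of the symmetric bilinear form on $V$ invariant under this action, and let $H$, $N$, $N_-$ be its subgroups of diagonal, upper unitriangular and lower unitriangular matrices (basis ordered as $J$), $G_0=N_-HN$. Put $x_i(t)=\exp(te_i)$, $y_i(t)=\exp(tf_i)$, $\alpha_i^\vee(t)=t^{h_i}$, $x_{-i}(t)=y_i(t)\alpha_i^\vee(t^{-1})$, and $\overline{s_i}=x_i(-1)y_i(1)x_i(-1)$.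 For $w=s_{i_1}\cdots s_{i_p}$ in the Weyl group (reduced expression) put $\overline w=\overline{s_{i_1}}\cdots\overline{s_{i_p}}$. For $d<r$ the generalized minor $\Delta_{w\Lambda_d,\Lambda_d}$ is the regular function on $G$ given on $\overline wG_0$ by $\Delta_{w\Lambda_d,\Lambda_d}(x)=h^{\Lambda_d}$ where $\overline w^{-1}x=n_-hn$ with $n_-\in N_-$, $h\in H$, $n\in N$; here $\Lambda_d$ is the $d$-th fundamental weight. Let $1\le m\le r$, $1\le d<r$, let $\mathbf i=(i_1,\dots,i_n)=(1,\dots,r,\ 1,\dots,r,\ \dots,\ 1,\dots,r,\ 1,\dots,d)$ consist of $m-1$ full cycles $1,\dots,r$ followed by $1,\dots,d$ (a reduced word of $u=(s_1\cdots s_r)^{m-1}s_1\cdots s_d$; $n=(m-1)r+d$). Let $1\le k\le n$ with $i_k=i_n=d$, and let position $k$ lie in the $m'$-th cycle, i.e. $(m'-1)r<k\le m'r$. For $\mathbf Y=(Y_{1,1},\dots,Y_{1,r},\dots,Y_{m-1,1},\dots,Y_{m-1,r},Y_{m,1},\dots,Y_{m,d})\in(\mathbb C^\times)^n$ let $x^L_{\mathbf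 i}(\mathbf Y)$ be the product $x_{-i_1}(\cdot)\cdots x_{-i_n}(\cdot)$ evaluated at the successive entries of $\mathbf Y$ (it parametrizes a Zariski open subset of the reduced double Bruhat cell $L^{u,e}$), and let $$\Delta^L(k;\mathbf i)(\mathbf Y)=\Delta_{u_{\le k}\Lambda_d,\Lambda_d}\bigl(x^L_{\mathbf i}(\mathbf Y)\bigr),\qquad u_{\le k}=s_{i_1}\cdots s_{i_k}.$$ With the convention $Y_{l,0}=1$ put, for $\kappa\in J$, $$B(l,\kappa)=\begin{cases}Y_{l,\kappa-1}/Y_{l,\kappa}&1\le\kappa\le r-1,\\ Y_{l,r-1}/Y_{l,r}^2&\kappa=r,\\ Y_{l,r}/Y_{l+1,r}&\kappa=0,\\ Y_{l,r}^2/Y_{l+1,r-1}&\kappa=\overline r,\\ Y_{l,|\kappa|}/Y_{l+1,|\kappa|-1}&\overline{r-1}\le\kappa\le\overline1.\end{cases}$$ **Theorem.** For all such $r,m,d,k,m'$ and all $\mathbf Y\in(\mathbb C^\times)^n$, $$\Delta^L(k;\mathbf i)(\mathbf Y)=\sum_{(*)}2^{C[\{k_i^{(s)}\}]}\prod_{i=1}^d\prod_{s=1}^{m-m'}B\bigl(m-l_i^{(s)},k_i^{(s)}\bigr),$$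 where $l_i^{(s)}=k_i^{(s)}+s-i-1$ if $k_i^{(s)}\in\{1,\dots,r\}$ and $l_i^{(s)}=s-i+r$ if $k_i^{(s)}\in\{0,\overline r,\dots,\overline1\}$. The sum is over all arrays $(k_i^{(s)})_{1\le i\le d,\,1\le s\le m-m'}$ of elements of $J$ satisfying $(*)$: 1. $k^{(s)}_1\le k^{(s)}_2\le\cdots\le k^{(s)}_d$, and $k_i^{(s)}=k_{i+1}^{(s)}$ if and only if $k_i^{(s)}=k_{i+1}^{(s)}=0$; 2. $k_i^{(1)}\le\cdots\le k_i^{(m-m')}$ for $1\le i\le d$, and moreover $k_i^{(m-m')}\le m'+i$ if $i\le r-m'$; 3. $k_i^{(s)}<k_{i+1}^{(s+1)}$. The exponent $C[\{k_i^{(s)}\}]$ is the number of $j\in[1,d-1]$ such that, for some $t\in[1,m-m']$, $k_{j+1}^{(t)}=0$, $k_{j+1}^{(t+1)}\ne0$ and $k_j^{(t)}\ne0$; for $t=m-m'$ the condition $k_{j+1}^{(t+1)}\neq 0$ is regarded as satisfied. If $m=m'$ the only array is the empty one and the sum equals $1$. -/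

import Mathlib

namespace TypeB

/-- The index set `J = {1 < 2 < ⋯ < r < 0 < r̄ < ⋯ < 2̄ < 1̄}`, listed in increasing order:
the letter `i` has value `i - 1`, the letter `0` has value `r`, and the letter `ī` has value
`2r + 1 - i`. -/
abbrev J (r : ℕ) : Type := Fin (2 * r + 1)

/-- `b` is the unbarred letter `i`, where `1 ≤ i ≤ r`. -/
abbrev IsPlain (r i : ℕ) (b : J r) : Prop := b.val + 1 = i

/-- `b` is the letter `0`. -/
abbrev IsZero (r : ℕ) (b : J r) : Prop := b.val = r

/-- `b` is the barred letter `ī`, where `1 ≤ i ≤ r`. -/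
abbrev IsBar (r i : ℕ) (b : J r) : Prop := b.val + i = 2 * r + 1

/-- The Chevalley generator `e_i` (`1 ≤ i ≤ r`) acting on the vector representation with basis
`(v_b)`, `b ∈ J`: `e_i v_{i+1} = v_i`, `e_i v_ī = v_{(i+1)‾}` for `i < r`, and
`e_r v_r̄ = v_0`, `e_r v_0 = 2 v_r`. -/
def eMat (r i : ℕ) : Matrix (J r) (J r) ℂ := Matrix.of fun a b =>
  if i < r then
    if (IsPlain r (i + 1) b ∧ IsPlain r i a) ∨ (IsBar r i b ∧ IsBar r (i + 1) a) then 1 else 0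
  else if IsBar r r b ∧ IsZero r a then 1
  else if IsZero r b ∧ IsPlain r r a then 2
  else 0

/-- The Chevalley generator `f_i` (`1 ≤ i ≤ r`): `f_i v_i = v_{i+1}`,
`f_i v_{(i+1)‾} = v_ī` for `i < r`, and `f_r v_r = v_0`, `f_r v_0 = 2 v_r̄`. -/
def fMat (r i : ℕ) : Matrix (J r) (J r) ℂ := Matrix.of fun a b =>
  if i < r then
    if (IsPlain r i b ∧ IsPlain r (i + 1) a) ∨ (IsBar r (i + 1) b ∧ IsBar r i a) then 1 else 0
  else if IsPlain r r b ∧ IsZero r a then 1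
  else if IsZero r b ∧ IsBar r r a then 2
  else 0

/-- The integer `⟨h_i, wt(v_b)⟩`, where `wt(v_j) = Λ_j - Λ_{j-1}` for `j < r`,
`wt(v_r) = 2Λ_r - Λ_{r-1}`, `wt(v_0) = 0` and `wt(v_j̄) = -wt(v_j)`. -/
def hPair (r i : ℕ) (b : J r) : ℤ :=
  if i < r then
    if IsPlain r i b then 1
    else if IsPlain r (i + 1) b then -1
    else if IsBar r i b then -1
    else if IsBar r (i + 1) b then 1
    else 0
  else if IsPlain r r b then 2
  else if IsBar r r b then -2
  else 0

/-- The symmetric bilinear form invariant under all `e_i`, `f_i`, `h_i`: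
`(v_i, v_ī) = (v_ī, v_i) = (-1)^(r-i)` for `1 ≤ i ≤ r`, `(v_0, v_0) = -2`, all other pairings
of basis vectors being `0`. -/
def form (r : ℕ) : Matrix (J r) (J r) ℂ := Matrix.of fun a b =>
  if IsZero r a ∧ IsZero r b then -2
  else if a.val + b.val = 2 * r then (-1) ^ (r + min (a.val + 1) (b.val + 1))
  else 0

/-- `G = SO_{2r+1}(ℂ)`, the special orthogonal group of the form `form r`. -/
def SO (r : ℕ) : Set (Matrix (J r) (J r) ℂ) :=
  {g | g.transpose * form r * g = form r ∧ g.det = 1}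

/-- The maximal torus `H`: the diagonal elements of `G`. -/
def torus (r : ℕ) : Set (Matrix (J r) (J r) ℂ) :=
  {g | g ∈ SO r ∧ ∀ a b, a ≠ b → g a b = 0}

/-- The maximal unipotent subgroup `N` (generated by the `x_i(t)`): upper unitriangular elements. -/
def unipUpper (r : ℕ) : Set (Matrix (J r) (J r) ℂ) :=
  {g | g ∈ SO r ∧ (∀ a, g a a = 1) ∧ ∀ a b, b < a → g a b = 0}

/-- The maximal unipotent subgroup `N₋` (generated by the `y_i(t)`): lower unitriangular
elements. -/
def unipLower (r : ℕ) : Set (Matrix (J r) (J r) ℂ) :=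
  {g | g ∈ SO r ∧ (∀ a, g a a = 1) ∧ ∀ a b, a < b → g a b = 0}

/-- `x_i(t) = exp(t e_i)`. -/
noncomputable def xOne (r i : ℕ) (t : ℂ) : Matrix (J r) (J r) ℂ :=
  NormedSpace.exp (t • eMat r i)

/-- `y_i(t) = exp(t f_i)`. -/
noncomputable def yOne (r i : ℕ) (t : ℂ) : Matrix (J r) (J r) ℂ :=
  NormedSpace.exp (t • fMat r i)

/-- The cocharacter `α_i^∨(t) = t^{h_i}`. -/
noncomputable def coroot (r i : ℕ) (t : ℂˣ) : Matrix (J r) (J r) ℂ :=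
  Matrix.diagonal fun b => (t : ℂ) ^ hPair r i b

/-- `x_{-i}(t) = y_i(t) α_i^∨(t⁻¹)`. -/
noncomputable def xMinus (r i : ℕ) (t : ℂˣ) : Matrix (J r) (J r) ℂ :=
  yOne r i t * coroot r i t⁻¹

/-- The representative `s̄_i = x_i(-1) y_i(1) x_i(-1)` of the simple reflection `s_i`. -/
noncomputable def sBar (r i : ℕ) : Matrix (J r) (J r) ℂ :=
  xOne r i (-1) * yOne r i 1 * xOne r i (-1)

/-- The representative `w̄ = s̄_{i_1} ⋯ s̄_{i_p}` of `w = s_{i_1} ⋯ s_{i_p}`, where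
`(i_1, …, i_p)` is a reduced word of `w`. -/
noncomputable def wBar (r : ℕ) (w : List ℕ) : Matrix (J r) (J r) ℂ :=
  (w.map (sBar r)).prod

/-- The value `h^{Λ_d}` at `h ∈ H` of the character of the fundamental weight `Λ_d`, for `d < r`;
here `Λ_d = wt(v_1) + ⋯ + wt(v_d)`. -/
noncomputable def weightChar (r d : ℕ) (h : Matrix (J r) (J r) ℂ) : ℂ :=
  ∏ b : J r, if b.val < d then h b b else 1

/-- `f` restricts to a regular function on the affine variety `G ⊆ Mat_{2r+1}(ℂ)`. -/
def IsRegularOnSO (r : ℕ) (f : Matrix (J r) (J r) ℂ → ℂ) : Prop :=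
  ∃ P : MvPolynomial (J r × J r) ℂ, ∀ g ∈ SO r, f g = MvPolynomial.eval (fun p => g p.1 p.2) P

/-- `f` is the generalized minor `Δ_{wΛ_d, Λ_d}` on `G` (`w` given by a reduced word, `d < r`):
it is regular on `G` and on the open dense set `w̄ G_0`, with `G_0 = N₋ H N`, it is given by
`f(x) = ([w̄⁻¹ x]_0)^{Λ_d}`, where `[n₋ h n]_0 = h`. -/
def IsGeneralizedMinor (r : ℕ) (w : List ℕ) (d : ℕ) (f : Matrix (J r) (J r) ℂ → ℂ) : Prop :=
  IsRegularOnSO r f ∧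
    ∀ n' ∈ unipLower r, ∀ h ∈ torus r, ∀ n ∈ unipUpper r,
      f (wBar r w * (n' * h * n)) = weightChar r d h

theorem isUnit_sBar (r i : ℕ) : IsUnit (sBar r i) :=
  ((Matrix.isUnit_exp _).mul (Matrix.isUnit_exp _)).mul (Matrix.isUnit_exp _)

theorem isUnit_wBar (r : ℕ) (w : List ℕ) : IsUnit (wBar r w) := by
  induction w with
  | nil => simp [wBar]
  | cons i w ih =>
    have h : wBar r (i :: w) = sBar r i * wBar r w := by simp [wBar]
    rw [h]
    exact (isUnit_sBar r i).mul ih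

theorem exists_isGeneralizedMinor (r : ℕ) (w : List ℕ) (d : ℕ) :
    ∃ f, IsGeneralizedMinor r w d f := by
  classical
  set p : J r → Prop := fun b => b.val < d with hp
  refine ⟨fun g => (((wBar r w)⁻¹ * g).toBlock p p).det, ?_, ?_⟩
  · refine ⟨(((((wBar r w)⁻¹).map MvPolynomial.C) *
      Matrix.of fun a b => (MvPolynomial.X (a, b) : MvPolynomial (J r × J r) ℂ)).toBlock
        p p).det, fun g _ => ?_⟩
    dsimp only
    rw [RingHom.map_det]
    refine congrArg Matrix.det (Matrix.ext fun a b => ?_)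
    simp [Matrix.toBlock_apply, Matrix.mul_apply]
  · intro n' hn' h hh n hn
    have hdet : IsUnit (wBar r w).det := (Matrix.isUnit_iff_isUnit_det _).1 (isUnit_wBar r w)
    have hE : (wBar r w)⁻¹ * (wBar r w * (n' * h * n)) = n' * h * n := by
      rw [← Matrix.mul_assoc, Matrix.nonsing_inv_mul _ hdet, Matrix.one_mul]
    have hn0 : n.toBlock (fun b => ¬ p b) p = 0 := by
      ext a b
      have ha : ¬ (a.1.val < d) := a.2
      have hb : b.1.val < d := b.2
      simpa [Matrix.toBlock_apply] using hn.2.2 a.1 b.1 (Fin.lt_def.2 (by omega))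
    have hh0 : h.toBlock (fun b => ¬ p b) p = 0 := by
      ext a b
      have hab : a.1 ≠ b.1 := fun hab => a.2 (by rw [hab]; exact b.2)
      simpa [Matrix.toBlock_apply] using hh.2 a.1 b.1 hab
    have hB : (n' * h * n).toBlock p p = n'.toBlock p p * h.toBlock p p * n.toBlock p p := by
      rw [Matrix.toBlock_mul_eq_add p p p, hn0, Matrix.toBlock_mul_eq_add p p p, hh0]
      simp
    have hdL : (n'.toBlock p p).det = 1 := by
      rw [Matrix.det_of_isLowerTriangular]
      · simp [Matrix.toBlock_apply, hn'.2.1]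
      · intro a b hab
        exact hn'.2.2 a.1 b.1 hab
    have hdU : (n.toBlock p p).det = 1 := by
      rw [Matrix.det_of_isUpperTriangular]
      · simp [Matrix.toBlock_apply, hn.2.1]
      · intro a b hab
        exact hn.2.2 a.1 b.1 hab
    have hdH : (h.toBlock p p).det = weightChar r d h := by
      rw [Matrix.det_of_isUpperTriangular]
      · rw [weightChar, ← Finset.prod_filter,
          ← Finset.prod_subtype_eq_prod_filter (p := p), Finset.subtype_univ]
        rfl
      · intro a b hab
        exact hh.2 a.1 b.1 (fun e => absurd hab (by simp [Subtype.ext e]))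
    show (((wBar r w)⁻¹ * (wBar r w * (n' * h * n))).toBlock p p).det = _
    rw [hE, hB, Matrix.det_mul, Matrix.det_mul, hdL, hdU, hdH, one_mul, mul_one]

/-- The generalized minor `Δ_{wΛ_d, Λ_d}` (`d < r`, `w` given by a reduced word). Its values on `G`
are determined by the defining property since `w̄ G_0` is dense in the irreducible variety `G`;
only these values are meaningful. -/
noncomputable def genMinor (r : ℕ) (w : List ℕ) (d : ℕ) : Matrix (J r) (J r) ℂ → ℂ :=
  Classical.choose (exists_isGeneralizedMinor r w d)

theorem genMinor_spec (r : ℕ) (w : List ℕ) (d : ℕ) :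
    IsGeneralizedMinor r w d (genMinor r w d) :=
  Classical.choose_spec (exists_isGeneralizedMinor r w d)

/-- The word `(1, …, r, 1, …, r, …, 1, …, r, 1, …, d)`: `m - 1` full cycles, followed by
the letters `1, …, d` of the `m`-th cycle. -/
def word (r m d : ℕ) : List ℕ :=
  (List.replicate (m - 1) (List.range' 1 r)).flatten ++ List.range' 1 d

/-- The map `x^L_𝐢(t_1, …, t_n) = x_{-i_1}(t_1) ⋯ x_{-i_n}(t_n)` for the word `w = (i_1, …, i_n)`
(into the reduced double Bruhat cell, if `w` is reduced). -/
noncomputable def xL (r : ℕ) (w : List ℕ) (Y : Fin w.length → ℂˣ) : Matrix (J r) (J r) ℂ :=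
  (List.ofFn fun j : Fin w.length => xMinus r (w.get j) (Y j)).prod

/-- `Δ^L(k; 𝐢) = Δ(k; 𝐢) ∘ x^L_𝐢` where `Δ(k; 𝐢) = Δ_{u_{≤k} Λ_{i_k}, Λ_{i_k}}` and
`u_{≤k} = s_{i_1} ⋯ s_{i_k}`, for `1 ≤ k ≤ n` (the list is indexed from `0`, so `i_k` is its entry
number `k - 1`). -/
noncomputable def DeltaL (r : ℕ) (w : List ℕ) (k : ℕ) (Y : Fin w.length → ℂˣ) : ℂ :=
  genMinor r (w.take k) (w.getD (k - 1) 0) (xL r w Y)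

/-- The coordinate `Y_{s,l}` of `Y = (Y_{1,1}, …, Y_{1,r}, Y_{2,1}, …, Y_{m,d})`, with the
convention `Y_{s,0} = Y_{s,r+1} = 1`. -/
noncomputable def coord (r : ℕ) {n : ℕ} (Y : Fin n → ℂˣ) (s l : ℕ) : ℂ :=
  if l = 0 ∨ l = r + 1 then 1
  else if h : (s - 1) * r + (l - 1) < n then (Y ⟨(s - 1) * r + (l - 1), h⟩ : ℂ)
  else 1

/-- The Laurent monomial `B(l, κ)`, `κ ∈ J`. The five cases are `κ ∈ {1, …, r-1}`, `κ = r`,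
`κ = 0`, `κ = r̄` and `κ ∈ {(r-1)‾, …, 1̄}`; the value of `κ` is `|κ| - 1` in the first case and
`2r + 1 - |κ|` in the last one. -/
noncomputable def B (r : ℕ) {n : ℕ} (Y : Fin n → ℂˣ) (l : ℕ) (κ : J r) : ℂ :=
  if κ.val + 1 < r then coord r Y l κ.val / coord r Y l (κ.val + 1)
  else if IsPlain r r κ then coord r Y l (r - 1) / coord r Y l r ^ 2
  else if IsZero r κ then coord r Y l r / coord r Y (l + 1) r
  else if IsBar r r κ then coord r Y l r ^ 2 / coord r Y (l + 1) (r - 1)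
  else coord r Y l (2 * r + 1 - κ.val) / coord r Y (l + 1) (2 * r + 1 - κ.val - 1)

/-- The number `l_i^{(s)}` attached to the entry `κ = k_i^{(s)}`: `κ + s - i - 1` if `κ` is
unbarred and `s - i + r` if `κ` is `0` or barred. Under the conditions `Admissible` both
subtractions are genuine. -/
def lIndex (r s i : ℕ) (κ : J r) : ℕ :=
  if κ.val < r then (κ.val + 1) + s - i - 1 else s + r - i

/-- The conditions `(*)` on an array `k_i^{(s)} ∈ J`, `1 ≤ s ≤ p`, `1 ≤ i ≤ d`, where
`p = m - m'`. The entry `k_i^{(s)}` is `K ⟨s - 1, _⟩ ⟨i - 1, _⟩`. -/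
structure Admissible (r d m' p : ℕ) (K : Fin p → Fin d → J r) : Prop where
  /-- `k_i^{(s)} ≤ k_{i+1}^{(s)}`. -/
  row_le : ∀ s i i', i'.val = i.val + 1 → K s i ≤ K s i'
  /-- `k_i^{(s)} = k_{i+1}^{(s)}` if and only if both are `0`. -/
  row_eq : ∀ s i i', i'.val = i.val + 1 →
    (K s i = K s i' ↔ IsZero r (K s i) ∧ IsZero r (K s i'))
  /-- `k_i^{(s)} ≤ k_i^{(s+1)}`. -/
  col_le : ∀ s s' i, s'.val = s.val + 1 → K s i ≤ K s' i
  /-- `k_i^{(s)} ≤ m' + i` (an unbarred letter) for `1 ≤ i ≤ r - m'`. -/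
  bound : ∀ s i, (i.val + 1) + m' ≤ r → (K s i).val + 1 ≤ m' + (i.val + 1)
  /-- `k_i^{(s)} < k_{i+1}^{(s+1)}`. -/
  diag_lt : ∀ s s' i i', s'.val = s.val + 1 → i'.val = i.val + 1 → K s i < K s' i'

open Classical in
/-- The exponent `C[{k_i^{(s)}}]`: the number of `j ∈ [1, d-1]` such that, for some `t ∈ [1, p]`,
`k_{j+1}^{(t)} = 0`, `k_{j+1}^{(t+1)} ≠ 0` and `k_j^{(t)} ≠ 0`; for `t = p`, where
`k_{j+1}^{(p+1)}` does not exist, the middle condition is void. -/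
noncomputable def Cexp (r d p : ℕ) (K : Fin p → Fin d → J r) : ℕ :=
  (Finset.univ.filter fun j : Fin d => ∃ j' : Fin d, j'.val = j.val + 1 ∧ ∃ t : Fin p,
    IsZero r (K t j') ∧ (∀ t' : Fin p, t'.val = t.val + 1 → ¬ IsZero r (K t' j')) ∧
      ¬ IsZero r (K t j)).card

/-- The monomial `∏_i ∏_s B(m - l_i^{(s)}, k_i^{(s)})`. -/
noncomputable def arrayMonomial (r d m p : ℕ) {n : ℕ} (Y : Fin n → ℂˣ)
    (K : Fin p → Fin d → J r) : ℂ :=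
  ∏ i : Fin d, ∏ s : Fin p,
    B r Y (m - lIndex r (s.val + 1) (i.val + 1) (K s i)) (K s i)

end TypeB

namespace TypeB

/-! Once the generalized minor is known to be an ordinary minor of a product of explicit matrices,
the formula is a weighted count of non-colliding particles.

The minor. `genMinor` is pinned down only by regularity and by its values on `w̄ G_0`, so its value
at `x^L` has to be recovered by Zariski density. Left multiplication by each `x_i(t)`, `y_i(t)` and
coroot element preserves the Zariski closure of `G_0`. Hence `w̄⁻¹ x^L` lies in that closure, and
`genMinor_eq_det` identifies the minor with the leading `d × d` minor of `w̄⁻¹ x^L`. The relevant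
rows of `w̄` are signed coordinate functionals, and their signs cancel against the permutation
sorting the rows (`DeltaL_eq_det`). What remains is a minor of `x^L` with columns `v_1, …, v_d`.
Filling up the last cycle with parameters `1` does not change these columns, so all cycles may be
taken full.

Particles. Iterated Cauchy–Binet (`det_submatrix_eq_sum_paths`) gives a sum over families of `d`
particles on distinct letters, where time `t` uses cycle `m - t`. By `prod_xMinus_apply`, in one
cycle an unbarred letter before `r` stays or moves to the next one, `r` stays or jumps to `0` or any
barred letter, and the entries on the remaining letters are `V b / U a` up to a factor `2`. This
rank-one shape makes every minor of a cycle factor into individual transition weights and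
nearest-neighbour factors `0`, `1/2`, `1` (`det_layerEntry`).

Rests. Cap positions at `r`. At each time the capped position either advances by one or rests, so
the particle starting at `i` satisfies `t + i = min (p t) r + (number of rests)`. Its trajectory is
therefore equivalent to the sequence of letters at which it rests. In these terms strictness and the
crossing rule become the conditions `Admissible` (`IsPath.isArray`, `IsArray.isPath`).

Weights. Pairing the weight of leaving a letter with the weight of entering it one time step earlier
produces the monomials `B`. The rests beyond row `m - m'` all sit at the final letters, and their
weights telescope over the particles (`prod_endWeight`). Leaving the letter `0` carries a factor
`2`, which is cancelled exactly when the left neighbour arrives at `0` in the same step; the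
surviving factors give `2 ^ C`. -/

/-! ### Entries of the one-parameter subgroups. -/

theorem exp_eq_of_cube_eq_zero {n : Type*} [Fintype n] [DecidableEq n] (A : Matrix n n ℂ)
    (hA : A * A * A = 0) :
    NormedSpace.exp A = 1 + A + (2 : ℂ)⁻¹ • (A * A) := by
  have h3 : ∀ k, 3 ≤ k → A ^ k = 0 := fun k hk => by
    obtain ⟨c, rfl⟩ := Nat.exists_eq_add_of_le hk
    rw [pow_add, pow_succ, pow_two, hA, zero_mul]
  rw [NormedSpace.exp_eq_tsum ℂ]
  dsimp only
  rw [tsum_eq_sum (s := Finset.range 3)]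
  · simp [Finset.sum_range_succ, pow_two]
  · intro k hk
    rw [h3 k (by simpa using hk), smul_zero]

theorem eMat_mul_eMat_of_lt {r i : ℕ} (hi : i < r) : eMat r i * eMat r i = 0 := by
  ext a b
  rw [Matrix.mul_apply]
  refine Finset.sum_eq_zero fun c _ => ?_
  simp only [eMat, Matrix.of_apply, if_pos hi, IsPlain, IsBar]
  split_ifs <;> first | (exfalso; omega) | simp

theorem fMat_mul_fMat_of_lt {r i : ℕ} (hi : i < r) : fMat r i * fMat r i = 0 := by
  ext a b
  rw [Matrix.mul_apply]
  refine Finset.sum_eq_zero fun c _ => ?_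
  simp only [fMat, Matrix.of_apply, if_pos hi, IsPlain, IsBar]
  split_ifs <;> first | (exfalso; omega) | simp

/-- Two nonzero factors can only be linked through the letter `0`. The matrices do not depend on `i`
once `i ≥ r`, so the case `i = r` is treated as `r ≤ i`. -/
theorem eMat_mul_eMat_of_le {r i : ℕ} (hi : r ≤ i) (a b : J r) :
    (eMat r i * eMat r i) a b = if b.val = r + 1 ∧ a.val + 1 = r then 2 else 0 := by
  rw [Matrix.mul_apply, Finset.sum_eq_single (⟨r, by omega⟩ : J r)]
  · simp only [eMat, Matrix.of_apply, if_neg (not_lt.2 hi), IsPlain, IsBar, IsZero, and_true,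
      true_and]
    split_ifs <;> first | (exfalso; omega) | simp
  · intro c _ hc
    have hc' : c.val ≠ r := fun h => hc (Fin.ext h)
    simp only [eMat, Matrix.of_apply, if_neg (not_lt.2 hi), IsPlain, IsBar, IsZero]
    split_ifs <;> first | (exfalso; omega) | simp
  · simp

theorem fMat_mul_fMat_of_le {r i : ℕ} (hi : r ≤ i) (a b : J r) :
    (fMat r i * fMat r i) a b = if a.val = r + 1 ∧ b.val + 1 = r then 2 else 0 := by
  rw [Matrix.mul_apply, Finset.sum_eq_single (⟨r, by omega⟩ : J r)]
  · simp only [fMat, Matrix.of_apply, if_neg (not_lt.2 hi), IsPlain, IsBar, IsZero, and_true,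
      true_and]
    split_ifs <;> first | (exfalso; omega) | simp
  · intro c _ hc
    have hc' : c.val ≠ r := fun h => hc (Fin.ext h)
    simp only [fMat, Matrix.of_apply, if_neg (not_lt.2 hi), IsPlain, IsBar, IsZero]
    split_ifs <;> first | (exfalso; omega) | simp
  · simp

theorem eMat_cube (r i : ℕ) : eMat r i * eMat r i * eMat r i = 0 := by
  rcases lt_or_ge i r with hi | hi
  · rw [eMat_mul_eMat_of_lt hi, zero_mul]
  · ext a b
    rw [Matrix.mul_apply]
    refine Finset.sum_eq_zero fun c _ => ?_
    rw [eMat_mul_eMat_of_le hi]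
    simp only [eMat, Matrix.of_apply, if_neg (not_lt.2 hi), IsPlain, IsBar, IsZero]
    split_ifs <;> first | (exfalso; omega) | simp

theorem fMat_cube (r i : ℕ) : fMat r i * fMat r i * fMat r i = 0 := by
  rcases lt_or_ge i r with hi | hi
  · rw [fMat_mul_fMat_of_lt hi, zero_mul]
  · ext a b
    rw [Matrix.mul_apply]
    refine Finset.sum_eq_zero fun c _ => ?_
    rw [fMat_mul_fMat_of_le hi]
    simp only [fMat, Matrix.of_apply, if_neg (not_lt.2 hi), IsPlain, IsBar, IsZero]
    split_ifs <;> first | (exfalso; omega) | simp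

theorem xOne_eq (r i : ℕ) (t : ℂ) :
    xOne r i t = 1 + t • eMat r i + (2 : ℂ)⁻¹ • (t ^ 2) • (eMat r i * eMat r i) := by
  rw [xOne, exp_eq_of_cube_eq_zero]
  · rw [Matrix.smul_mul, Matrix.mul_smul, smul_smul t t, pow_two]
  · simp [eMat_cube]

theorem yOne_eq (r i : ℕ) (t : ℂ) :
    yOne r i t = 1 + t • fMat r i + (2 : ℂ)⁻¹ • (t ^ 2) • (fMat r i * fMat r i) := by
  rw [yOne, exp_eq_of_cube_eq_zero]
  · rw [Matrix.smul_mul, Matrix.mul_smul, smul_smul t t, pow_two]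
  · simp [fMat_cube]

theorem xOne_apply_of_lt {r i : ℕ} (hi : i < r) (t : ℂ) (a b : J r) :
    xOne r i t a b = if a = b then 1
      else if b.val = a.val + 1 ∧ (a.val + 1 = i ∨ a.val + i = 2 * r) then t else 0 := by
  rw [xOne_eq, eMat_mul_eMat_of_lt hi]
  simp only [eMat, Matrix.add_apply, Matrix.smul_apply, Matrix.of_apply, Matrix.one_apply,
    if_pos hi, IsPlain, IsBar, Fin.ext_iff]
  split_ifs <;> first | (exfalso; omega) | simp

theorem yOne_apply_of_lt {r i : ℕ} (hi : i < r) (t : ℂ) (a b : J r) :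
    yOne r i t a b = if a = b then 1
      else if a.val = b.val + 1 ∧ (b.val + 1 = i ∨ b.val + i = 2 * r) then t else 0 := by
  rw [yOne_eq, fMat_mul_fMat_of_lt hi]
  simp only [fMat, Matrix.add_apply, Matrix.smul_apply, Matrix.of_apply, Matrix.one_apply,
    if_pos hi, IsPlain, IsBar, Fin.ext_iff]
  split_ifs <;> first | (exfalso; omega) | simp

theorem xOne_apply_of_le {r i : ℕ} (hi : r ≤ i) (t : ℂ) (a b : J r) :
    xOne r i t a b = if a = b then 1
      else if a.val = r ∧ b.val = r + 1 then t
      else if a.val + 1 = r ∧ b.val = r then 2 * t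
      else if a.val + 1 = r ∧ b.val = r + 1 then t ^ 2 else 0 := by
  rw [xOne_eq]
  simp only [Matrix.add_apply, Matrix.smul_apply, eMat_mul_eMat_of_le hi]
  simp only [eMat, Matrix.of_apply, Matrix.one_apply,
    if_neg (not_lt.2 hi), IsPlain, IsBar, IsZero, Fin.ext_iff]
  split_ifs <;> first | (exfalso; omega) | (simp; done) | (simp; ring)

theorem yOne_apply_of_le {r i : ℕ} (hi : r ≤ i) (t : ℂ) (a b : J r) :
    yOne r i t a b = if a = b then 1
      else if b.val + 1 = r ∧ a.val = r then t
      else if b.val = r ∧ a.val = r + 1 then 2 * t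
      else if b.val + 1 = r ∧ a.val = r + 1 then t ^ 2 else 0 := by
  rw [yOne_eq]
  simp only [Matrix.add_apply, Matrix.smul_apply, fMat_mul_fMat_of_le hi]
  simp only [fMat, Matrix.of_apply, Matrix.one_apply,
    if_neg (not_lt.2 hi), IsPlain, IsBar, IsZero, Fin.ext_iff]
  split_ifs <;> first | (exfalso; omega) | (simp; done) | (simp; ring)

theorem xOne_apply_self (r i : ℕ) (t : ℂ) (a : J r) : xOne r i t a a = 1 := by
  rcases lt_or_ge i r with hi | hi
  · simp [xOne_apply_of_lt hi]
  · simp [xOne_apply_of_le hi]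

theorem yOne_apply_self (r i : ℕ) (t : ℂ) (a : J r) : yOne r i t a a = 1 := by
  rcases lt_or_ge i r with hi | hi
  · simp [yOne_apply_of_lt hi]
  · simp [yOne_apply_of_le hi]

theorem xOne_apply_eq_zero {r i : ℕ} (t : ℂ) {a b : J r} (h : b < a) : xOne r i t a b = 0 := by
  have h' : b.val < a.val := h
  rcases lt_or_ge i r with hi | hi
  · rw [xOne_apply_of_lt hi, if_neg h.ne', if_neg (by omega)]
  · rw [xOne_apply_of_le hi, if_neg h.ne', if_neg (by omega), if_neg (by omega),
      if_neg (by omega)]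

theorem yOne_apply_eq_zero {r i : ℕ} (t : ℂ) {a b : J r} (h : a < b) : yOne r i t a b = 0 := by
  have h' : a.val < b.val := h
  rcases lt_or_ge i r with hi | hi
  · rw [yOne_apply_of_lt hi, if_neg h.ne, if_neg (by omega)]
  · rw [yOne_apply_of_le hi, if_neg h.ne, if_neg (by omega), if_neg (by omega),
      if_neg (by omega)]

/-! ### The orthogonal group -/

theorem SO_one (r : ℕ) : (1 : Matrix (J r) (J r) ℂ) ∈ SO r := by simp [SO]

theorem SO_mul {r : ℕ} {g h : Matrix (J r) (J r) ℂ} (hg : g ∈ SO r) (hh : h ∈ SO r) :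
    g * h ∈ SO r := by
  refine ⟨?_, by rw [Matrix.det_mul, hg.2, hh.2, one_mul]⟩
  calc (g * h).transpose * form r * (g * h)
      = h.transpose * (g.transpose * form r * g) * h := by
        simp only [Matrix.transpose_mul, Matrix.mul_assoc]
    _ = form r := by rw [hg.1, hh.1]

theorem form_apply_of_add_ne {r : ℕ} {a b : J r} (h : a.val + b.val ≠ 2 * r) :
    form r a b = 0 := by
  simp only [form, Matrix.of_apply, if_neg h]
  rw [if_neg]
  unfold IsZero
  omega

theorem mul_form_apply {r : ℕ} (M : Matrix (J r) (J r) ℂ) (a b : J r) :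
    (M * form r) a b = M a b.rev * form r b.rev b := by
  rw [Matrix.mul_apply, Finset.sum_eq_single b.rev]
  · intro c _ hc
    rw [form_apply_of_add_ne, mul_zero]
    intro h
    apply hc
    ext
    rw [Fin.val_rev]
    omega
  · simp

theorem form_mul_apply {r : ℕ} (M : Matrix (J r) (J r) ℂ) (a b : J r) :
    (form r * M) a b = form r a a.rev * M a.rev b := by
  rw [Matrix.mul_apply, Finset.sum_eq_single a.rev]
  · intro c _ hc
    rw [form_apply_of_add_ne, zero_mul]
    intro h
    apply hc
    ext
    rw [Fin.val_rev]
    omega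
  · simp

theorem neg_one_pow_eq_neg {m n : ℕ} (h : m + 1 = n ∨ n + 1 = m) : (-1 : ℂ) ^ m = -(-1) ^ n := by
  rcases h with rfl | rfl <;> simp [pow_succ]

/-- The alternating signs of `form` make the generators with `i < r` skew, and the value `-2` at
`v_0` balances the coefficient `2` in `e_r v_0 = 2 v_r`. -/
theorem transpose_eMat_mul_form (r i : ℕ) :
    (eMat r i).transpose * form r = -(form r * eMat r i) := by
  ext a b
  rw [Matrix.neg_apply, mul_form_apply, form_mul_apply]
  simp only [eMat, form, Matrix.transpose_apply, Matrix.of_apply, IsPlain, IsBar, IsZero,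
    Fin.val_rev]
  rcases lt_or_ge i r with hi | hi
  · simp only [if_pos hi]
    split_ifs <;> first | (exfalso; omega) | (simp; done) |
      (simp only [one_mul, mul_one]; exact neg_one_pow_eq_neg (by omega))
  · simp only [if_neg (not_lt.2 hi)]
    split_ifs <;> first | (exfalso; omega) | (simp; done) | skip
    -- Only pairings of `v_r` with `v_r̄` are left; their sign exponent is `r + r`.
    all_goals
      rw [Even.neg_one_pow (by rw [Nat.even_iff]; omega)]
      norm_num

theorem transpose_fMat_mul_form (r i : ℕ) :
    (fMat r i).transpose * form r = -(form r * fMat r i) := by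
  ext a b
  rw [Matrix.neg_apply, mul_form_apply, form_mul_apply]
  simp only [fMat, form, Matrix.transpose_apply, Matrix.of_apply, IsPlain, IsBar, IsZero,
    Fin.val_rev]
  rcases lt_or_ge i r with hi | hi
  · simp only [if_pos hi]
    split_ifs <;> first | (exfalso; omega) | (simp; done) |
      (simp only [one_mul, mul_one]; exact neg_one_pow_eq_neg (by omega))
  · simp only [if_neg (not_lt.2 hi)]
    split_ifs <;> first | (exfalso; omega) | (simp; done) | skip
    all_goals
      rw [Even.neg_one_pow (by rw [Nat.even_iff]; omega)]
      norm_num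

/-- Skewness turns the transpose of `exp(tA)` into `exp(-tA)` on the other side of the form; both
exponentials are quadratic because the cube vanishes. -/
theorem transpose_mul_form_mul_of_skew {r : ℕ} {A : Matrix (J r) (J r) ℂ}
    (hA : A.transpose * form r = -(form r * A)) (h3 : A * A * A = 0) (t : ℂ) :
    (1 + t • A + (2 : ℂ)⁻¹ • (t ^ 2) • (A * A)).transpose * form r *
      (1 + t • A + (2 : ℂ)⁻¹ • (t ^ 2) • (A * A)) = form r := by
  have hAA : (A * A).transpose * form r = form r * (A * A) := by
    rw [Matrix.transpose_mul, Matrix.mul_assoc, hA, Matrix.mul_neg, ← Matrix.mul_assoc, hA,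
      Matrix.neg_mul, neg_neg, Matrix.mul_assoc]
  have h1 : (1 + t • A + (2 : ℂ)⁻¹ • (t ^ 2) • (A * A)).transpose * form r
      = form r * (1 - t • A + (2 : ℂ)⁻¹ • (t ^ 2) • (A * A)) := by
    simp only [Matrix.transpose_add, Matrix.transpose_smul, Matrix.transpose_one, Matrix.add_mul,
      Matrix.smul_mul, hA, hAA, Matrix.mul_add, Matrix.mul_smul, Matrix.mul_neg, Matrix.one_mul,
      Matrix.mul_one, smul_neg, sub_eq_add_neg]
  have h4 : A * (A * A) = 0 := by rw [← Matrix.mul_assoc, h3]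
  have h2 : (1 - t • A + (2 : ℂ)⁻¹ • (t ^ 2) • (A * A)) *
      (1 + t • A + (2 : ℂ)⁻¹ • (t ^ 2) • (A * A)) = 1 := by
    simp only [Matrix.add_mul, Matrix.sub_mul, Matrix.mul_add, Matrix.smul_mul, Matrix.mul_smul,
      Matrix.one_mul, Matrix.mul_one, Matrix.mul_assoc, h4, Matrix.mul_zero, smul_zero]
    module
  rw [h1, Matrix.mul_assoc, h2, Matrix.mul_one]

theorem det_xOne (r i : ℕ) (t : ℂ) : (xOne r i t).det = 1 := by
  rw [Matrix.det_of_isUpperTriangular]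
  · simp [xOne_apply_self]
  · intro a b hab
    exact xOne_apply_eq_zero t hab

theorem det_yOne (r i : ℕ) (t : ℂ) : (yOne r i t).det = 1 := by
  rw [Matrix.det_of_isLowerTriangular]
  · simp [yOne_apply_self]
  · intro a b hab
    exact yOne_apply_eq_zero t hab

theorem xOne_mem (r i : ℕ) (t : ℂ) : xOne r i t ∈ SO r :=
  ⟨xOne_eq r i t ▸ transpose_mul_form_mul_of_skew (transpose_eMat_mul_form r i) (eMat_cube r i) t,
    det_xOne r i t⟩

theorem yOne_mem (r i : ℕ) (t : ℂ) : yOne r i t ∈ SO r :=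
  ⟨yOne_eq r i t ▸ transpose_mul_form_mul_of_skew (transpose_fMat_mul_form r i) (fMat_cube r i) t,
    det_yOne r i t⟩

theorem yOne_mem_unipLower (r i : ℕ) (t : ℂ) : yOne r i t ∈ unipLower r :=
  ⟨yOne_mem r i t, yOne_apply_self r i t, fun _ _ h => yOne_apply_eq_zero t h⟩

theorem hPair_rev (r i : ℕ) (b : J r) : hPair r i b.rev = -hPair r i b := by
  simp only [hPair, IsPlain, IsBar, Fin.val_rev]
  split_ifs <;> first | (exfalso; omega) | simp

theorem sum_hPair (r i : ℕ) : ∑ b : J r, hPair r i b = 0 := by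
  have h : ∑ b : J r, hPair r i b.rev = ∑ b : J r, hPair r i b :=
    Equiv.sum_comp Fin.revPerm (hPair r i)
  simp only [hPair_rev, Finset.sum_neg_distrib] at h
  omega

theorem coroot_mem (r i : ℕ) (t : ℂˣ) : coroot r i t ∈ SO r := by
  have ht : (t : ℂ) ≠ 0 := t.ne_zero
  constructor
  · ext a b
    rw [Matrix.mul_assoc, coroot, Matrix.diagonal_transpose, Matrix.diagonal_mul,
      Matrix.mul_diagonal]
    by_cases h : a.val + b.val = 2 * r
    · have hb : b = a.rev := by
        ext
        rw [Fin.val_rev]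
        omega
      rw [hb, hPair_rev, mul_comm (form r a a.rev), ← mul_assoc, zpow_neg,
        mul_inv_cancel₀ (zpow_ne_zero _ ht), one_mul]
    · rw [form_apply_of_add_ne h]
      simp
  · rw [coroot, Matrix.det_diagonal]
    have key : ∀ s : Finset (J r), ∏ b ∈ s, (t : ℂ) ^ hPair r i b
        = (t : ℂ) ^ ∑ b ∈ s, hPair r i b := by
      intro s
      induction s using Finset.cons_induction with
      | empty => simp
      | cons b s hb ih => rw [Finset.prod_cons, Finset.sum_cons, zpow_add₀ ht, ih]
    rw [key, sum_hPair, zpow_zero]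

theorem xMinus_mem (r i : ℕ) (t : ℂˣ) : xMinus r i t ∈ SO r :=
  SO_mul (yOne_mem r i t) (coroot_mem r i _)

/-! ### Leading minors and triangular factorizations -/

/-- The upper left `d × d` block of a square matrix. -/
abbrev leading {K : Type*} {N d : ℕ} (h : d ≤ N) (M : Matrix (Fin N) (Fin N) K) :
    Matrix (Fin d) (Fin d) K :=
  M.submatrix (Fin.castLE h) (Fin.castLE h)

theorem sum_castLE {K : Type*} [AddCommMonoid K] {N d : ℕ} (h : d ≤ N) (f : Fin N → K)
    (hf : ∀ c : Fin N, d ≤ c.val → f c = 0) : ∑ c, f c = ∑ i, f (Fin.castLE h i) := by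
  obtain ⟨e, rfl⟩ := Nat.exists_eq_add_of_le h
  rw [Fin.sum_univ_add, Finset.sum_eq_zero fun i _ => hf (Fin.natAdd d i) (by simp), add_zero]
  rfl

theorem prod_castLE {K : Type*} [CommMonoid K] {N d : ℕ} (h : d ≤ N) (f : Fin N → K)
    (hf : ∀ c : Fin N, d ≤ c.val → f c = 1) : ∏ c, f c = ∏ i, f (Fin.castLE h i) := by
  obtain ⟨e, rfl⟩ := Nat.exists_eq_add_of_le h
  rw [Fin.prod_univ_add, Finset.prod_eq_one fun i _ => hf (Fin.natAdd d i) (by simp), mul_one]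
  rfl

/-- The first `d` rows of a lower triangular matrix involve only the first `d` coordinates. -/
theorem leading_mul_of_lower {K : Type*} [CommRing K] {N d : ℕ} (h : d ≤ N)
    {A : Matrix (Fin N) (Fin N) K} (hA : ∀ a b, a < b → A a b = 0)
    (B : Matrix (Fin N) (Fin N) K) :
    leading h (A * B) = leading h A * leading h B := by
  ext i j
  simp only [Matrix.submatrix_apply, Matrix.mul_apply]
  refine sum_castLE h _ fun c hc => ?_
  rw [hA _ _ (Fin.lt_def.2 (lt_of_lt_of_le i.2 hc)), zero_mul]

theorem det_leading_of_unitriangular_lower {K : Type*} [CommRing K] {N d : ℕ} (h : d ≤ N)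
    {A : Matrix (Fin N) (Fin N) K} (h1 : ∀ a, A a a = 1) (hA : ∀ a b, a < b → A a b = 0) :
    (leading h A).det = 1 := by
  rw [Matrix.det_of_isLowerTriangular]
  · simp [h1]
  · intro a b hab
    exact hA _ _ hab

theorem det_leading_of_upper {K : Type*} [CommRing K] {N d : ℕ} (h : d ≤ N)
    {A : Matrix (Fin N) (Fin N) K} (hA : ∀ a b, b < a → A a b = 0) :
    (leading h A).det = ∏ i, A (Fin.castLE h i) (Fin.castLE h i) := by
  rw [Matrix.det_of_isUpperTriangular]
  · simp
  · intro a b hab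
    exact hA _ _ hab

/-- Gaussian elimination by bordering: the factorization of the upper left block, invertible by
hypothesis, is extended by one row and one column. -/
theorem exists_lower_mul_upper {K : Type*} [Field K] (N : ℕ) (M : Matrix (Fin N) (Fin N) K)
    (hM : ∀ k (hk : k ≤ N), (leading hk M).det ≠ 0) :
    ∃ L U : Matrix (Fin N) (Fin N) K, (∀ a, L a a = 1) ∧ (∀ a b, a < b → L a b = 0) ∧
      (∀ a b, b < a → U a b = 0) ∧ L * U = M := by
  induction N with
  | zero => exact ⟨1, 1, fun a => a.elim0, fun a => a.elim0, fun a => a.elim0,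
      by ext a; exact a.elim0⟩
  | succ N ih =>
    set A : Matrix (Fin N) (Fin N) K := M.submatrix Fin.castSucc Fin.castSucc with hAdef
    obtain ⟨L, U, hL1, hL0, hU0, hLU⟩ := ih A fun k hk => by
      have := hM k (hk.trans (Nat.le_succ N))
      exact this
    have hA : IsUnit A.det := (hM N (Nat.le_succ N)).isUnit
    have hLu : IsUnit L := (Matrix.isUnit_iff_isUnit_det _).2
      (isUnit_of_mul_isUnit_left (by rwa [← hLU, Matrix.det_mul] at hA))
    have hUu : IsUnit U := (Matrix.isUnit_iff_isUnit_det _).2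
      (isUnit_of_mul_isUnit_right (by rwa [← hLU, Matrix.det_mul] at hA))
    -- The new column `y` of `U` solves `L y = (last column)` and the new row `x` of `L` solves `x U
    -- = (last row)`; the new corner of `U` is then forced to be the last corner of `M` minus `x ⬝ᵥ
    -- y`.
    obtain ⟨y, hy⟩ := (Matrix.mulVec_surjective_iff_isUnit.2 hLu)
      fun a => M a.castSucc (Fin.last N)
    obtain ⟨x, hx⟩ := (Matrix.vecMul_surjective_iff_isUnit.2 hUu)
      fun b => M (Fin.last N) b.castSucc
    refine ⟨Matrix.of (Fin.snoc (α := fun _ => Fin (N + 1) → K)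
        (fun a => Fin.snoc (α := fun _ => K) (L a) 0) (Fin.snoc (α := fun _ => K) x 1)),
      Matrix.of (Fin.snoc (α := fun _ => Fin (N + 1) → K)
        (fun a => Fin.snoc (α := fun _ => K) (U a) (y a))
        (Fin.snoc (α := fun _ => K) 0 (M (Fin.last N) (Fin.last N) - x ⬝ᵥ y))), ?_, ?_, ?_, ?_⟩
    · intro a
      refine Fin.lastCases ?_ (fun a => ?_) a
      · simp
      · simpa using hL1 a
    · intro a b
      refine Fin.lastCases ?_ (fun a => ?_) a <;> refine Fin.lastCases ?_ (fun b => ?_) b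
      · simp
      · intro h
        exact absurd h (not_lt.2 (Fin.le_last _))
      · simp
      · intro h
        simpa using hL0 a b h
    · intro a b
      refine Fin.lastCases ?_ (fun a => ?_) a <;> refine Fin.lastCases ?_ (fun b => ?_) b
      · simp
      · simp
      · intro h
        exact absurd h (not_lt.2 (Fin.le_last _))
      · intro h
        simpa using hU0 a b h
    · ext a b
      rw [Matrix.mul_apply, Fin.sum_univ_castSucc]
      refine Fin.lastCases ?_ (fun a => ?_) a <;> refine Fin.lastCases ?_ (fun b => ?_) b
      · simp [dotProduct]
      · simpa [Matrix.vecMul, dotProduct] using congrFun hx b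
      · simpa [Matrix.mulVec, dotProduct] using congrFun hy a
      · simpa [Matrix.mul_apply, hAdef] using congrFun (congrFun hLU a) b

/-! ### The big cell -/

theorem SO_of_mul_left {r : ℕ} {g h : Matrix (J r) (J r) ℂ} (hg : g ∈ SO r)
    (hgh : g * h ∈ SO r) : h ∈ SO r := by
  refine ⟨?_, by have := hgh.2; rwa [Matrix.det_mul, hg.2, one_mul] at this⟩
  calc h.transpose * form r * h
      = h.transpose * (g.transpose * form r * g) * h := by rw [hg.1]
    _ = (g * h).transpose * form r * (g * h) := by
        simp only [Matrix.transpose_mul, Matrix.mul_assoc]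
    _ = form r := hgh.1

theorem transpose_mul_form_mul_apply {r : ℕ} (A B : Matrix (J r) (J r) ℂ) (a b : J r) :
    (A.transpose * form r * B) a b = ∑ c, A c a * form r c c.rev * B c.rev b := by
  rw [Matrix.mul_assoc, Matrix.mul_apply]
  refine Finset.sum_congr rfl fun c _ => ?_
  rw [form_mul_apply, Matrix.transpose_apply, mul_assoc]

/-- Invariance of the form under `L U` equates `Lᵀ F L` with the corresponding expression in `U⁻¹`.
Triangularity makes the first vanish below the antidiagonal and the second above it, while on the
antidiagonal unitriangularity of `L` leaves `F` unchanged. -/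
theorem lower_upper_mem_SO {r : ℕ} {L U : Matrix (J r) (J r) ℂ} (hL1 : ∀ a, L a a = 1)
    (hL0 : ∀ a b, a < b → L a b = 0) (hU0 : ∀ a b, b < a → U a b = 0) (h : L * U ∈ SO r) :
    L ∈ SO r ∧ U ∈ SO r := by
  have hdL : L.det = 1 := by
    rw [Matrix.det_of_isLowerTriangular]
    · simp [hL1]
    · exact fun a b hab => hL0 a b hab
  have hdU : U.det = 1 := by
    have := h.2
    rwa [Matrix.det_mul, hdL, one_mul] at this
  have hUu : IsUnit U.det := by rw [hdU]; exact isUnit_one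
  have : Invertible U := Matrix.invertibleOfIsUnitDet U hUu
  have hV0 : ∀ a b, b < a → U⁻¹ a b = 0 := fun a b hab =>
    Matrix.blockTriangular_inv_of_blockTriangular (M := U) (b := id)
      (fun i j hij => hU0 i j hij) hab
  have hA : L.transpose * form r * L = U⁻¹.transpose * form r * U⁻¹ := by
    have h1 : U.transpose * (L.transpose * form r * L) * U = form r := by
      refine Eq.trans ?_ h.1
      simp only [Matrix.transpose_mul, Matrix.mul_assoc]
    calc L.transpose * form r * L
        = (U * U⁻¹).transpose * (L.transpose * form r * L) * (U * U⁻¹) := by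
          rw [Matrix.mul_nonsing_inv _ hUu, Matrix.transpose_one, Matrix.one_mul, Matrix.mul_one]
      _ = U⁻¹.transpose * (U.transpose * (L.transpose * form r * L) * U) * U⁻¹ := by
          simp only [Matrix.transpose_mul, Matrix.mul_assoc]
      _ = _ := by rw [h1]
  have hLF : L.transpose * form r * L = form r := by
    ext a b
    rcases lt_trichotomy (a.val + b.val) (2 * r) with hab | hab | hab
    · rw [hA, transpose_mul_form_mul_apply, form_apply_of_add_ne hab.ne]
      refine Finset.sum_eq_zero fun c _ => ?_
      by_cases hc : a < c
      · rw [hV0 _ _ hc, zero_mul, zero_mul]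
      · rw [hV0 c.rev b, mul_zero]
        rw [Fin.lt_def, Fin.val_rev]
        have : c.val ≤ a.val := not_lt.1 hc
        omega
    · have hb : b = a.rev := by
        ext
        rw [Fin.val_rev]
        omega
      rw [transpose_mul_form_mul_apply, Finset.sum_eq_single a]
      · rw [hb, hL1, hL1, one_mul, mul_one]
      · intro c _ hc
        rcases lt_or_gt_of_ne hc with hc | hc
        · rw [hL0 _ _ hc, zero_mul, zero_mul]
        · rw [hL0 c.rev b, mul_zero]
          rw [hb]
          exact Fin.rev_lt_rev.2 hc
      · simp
    · rw [transpose_mul_form_mul_apply, form_apply_of_add_ne hab.ne']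
      refine Finset.sum_eq_zero fun c _ => ?_
      by_cases hc : c < a
      · rw [hL0 _ _ hc, zero_mul, zero_mul]
      · rw [hL0 c.rev b, mul_zero]
        rw [Fin.lt_def, Fin.val_rev]
        have : a.val ≤ c.val := not_lt.1 hc
        omega
  exact ⟨⟨hLF, hdL⟩, SO_of_mul_left ⟨hLF, hdL⟩ h⟩

/-- The antidiagonal entries of `Uᵀ F U` involve only the diagonal of `U`, so the diagonal part is
itself orthogonal and can be split off. -/
theorem upper_eq_torus_mul {r : ℕ} {U : Matrix (J r) (J r) ℂ} (hU0 : ∀ a b, b < a → U a b = 0)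
    (hU : U ∈ SO r) : ∃ h ∈ torus r, ∃ n ∈ unipUpper r, U = h * n := by
  set D : Matrix (J r) (J r) ℂ := Matrix.diagonal fun a => U a a with hD
  have hdet : ∏ a, U a a = 1 := by
    rw [← Matrix.det_of_isUpperTriangular (fun a b hab => hU0 a b hab), hU.2]
  have hne : ∀ a, U a a ≠ 0 := fun a h0 => by
    rw [Finset.prod_eq_zero (f := fun a => U a a) (Finset.mem_univ a) h0] at hdet
    exact zero_ne_one hdet
  have hDm : D ∈ SO r := by
    refine ⟨?_, by rw [hD, Matrix.det_diagonal, hdet]⟩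
    ext a b
    rw [Matrix.mul_assoc, hD, Matrix.diagonal_transpose, Matrix.diagonal_mul, Matrix.mul_diagonal]
    by_cases h : a.val + b.val = 2 * r
    · have hb : b = a.rev := by
        ext
        rw [Fin.val_rev]
        omega
      have := congrFun (congrFun hU.1 a) b
      rw [transpose_mul_form_mul_apply, Finset.sum_eq_single a] at this
      · subst hb
        refine Eq.trans ?_ this
        ring
      · intro c _ hc
        rcases lt_or_gt_of_ne hc with hc | hc
        · rw [hU0 c.rev b, mul_zero]
          rw [hb]
          exact Fin.rev_lt_rev.2 hc
        · rw [hU0 _ _ hc, zero_mul, zero_mul]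
      · simp
    · rw [form_apply_of_add_ne h]
      simp
  have hinv : D * (Matrix.diagonal fun a => (U a a)⁻¹) = 1 := by
    rw [hD, Matrix.diagonal_mul_diagonal]
    simp [hne]
  refine ⟨D, ⟨hDm, fun a b hab => Matrix.diagonal_apply_ne _ hab⟩,
    (Matrix.diagonal fun a => (U a a)⁻¹) * U, ⟨?_, ?_, ?_⟩, ?_⟩
  · apply SO_of_mul_left hDm
    rwa [← Matrix.mul_assoc, hinv, Matrix.one_mul]
  · intro a
    rw [Matrix.diagonal_mul, inv_mul_cancel₀ (hne a)]
  · intro a b hab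
    rw [Matrix.diagonal_mul, hU0 _ _ hab, mul_zero]
  · rw [← Matrix.mul_assoc, hinv, Matrix.one_mul]

/-- The big cell `G_0 = N₋ H N`. -/
def bigCell (r : ℕ) : Set (Matrix (J r) (J r) ℂ) :=
  {g | ∃ n' ∈ unipLower r, ∃ h ∈ torus r, ∃ n ∈ unipUpper r, g = n' * h * n}

theorem mem_bigCell_of_leading_ne_zero {r : ℕ} {g : Matrix (J r) (J r) ℂ} (hg : g ∈ SO r)
    (h : ∀ k (hk : k ≤ 2 * r + 1), (leading hk g).det ≠ 0) : g ∈ bigCell r := by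
  obtain ⟨L, U, hL1, hL0, hU0, rfl⟩ := exists_lower_mul_upper _ g h
  obtain ⟨hL, hU⟩ := lower_upper_mem_SO hL1 hL0 hU0 hg
  obtain ⟨t, ht, n, hn, rfl⟩ := upper_eq_torus_mul hU0 hU
  exact ⟨L, ⟨hL, hL1, hL0⟩, t, ht, n, hn, (Matrix.mul_assoc _ _ _).symm⟩

theorem unipLower_mul {r : ℕ} {g h : Matrix (J r) (J r) ℂ} (hg : g ∈ unipLower r)
    (hh : h ∈ unipLower r) : g * h ∈ unipLower r := by
  have h0 : ∀ a b, a < b → (g * h) a b = 0 := by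
    intro a b hab
    rw [Matrix.mul_apply]
    refine Finset.sum_eq_zero fun c _ => ?_
    by_cases hc : a < c
    · rw [hg.2.2 _ _ hc, zero_mul]
    · rw [hh.2.2 c b (lt_of_le_of_lt (not_lt.1 hc) hab), mul_zero]
  refine ⟨SO_mul hg.1 hh.1, fun a => ?_, h0⟩
  rw [Matrix.mul_apply, Finset.sum_eq_single a]
  · rw [hg.2.1, hh.2.1, one_mul]
  · intro c _ hc
    rcases lt_or_gt_of_ne hc with hc | hc
    · rw [hh.2.2 _ _ hc, mul_zero]
    · rw [hg.2.2 _ _ hc, zero_mul]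
  · simp

/-- The Zariski closure of the big cell in the space of matrices. -/
def bigCellClosure (r : ℕ) : Set (Matrix (J r) (J r) ℂ) :=
  {g | ∀ P : MvPolynomial (J r × J r) ℂ,
    (∀ x ∈ bigCell r, MvPolynomial.eval (fun p => x p.1 p.2) P = 0) →
      MvPolynomial.eval (fun p => g p.1 p.2) P = 0}

theorem subset_bigCellClosure (r : ℕ) : bigCell r ⊆ bigCellClosure r := fun g hg _ hP => hP g hg

/-- The polynomial function `g ↦ P (A * g)`. -/
noncomputable def translatePoly {r : ℕ} (A : Matrix (J r) (J r) ℂ)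
    (P : MvPolynomial (J r × J r) ℂ) : MvPolynomial (J r × J r) ℂ :=
  MvPolynomial.bind₁ (fun p => ∑ c, MvPolynomial.C (A p.1 c) * MvPolynomial.X (c, p.2)) P

theorem eval_translatePoly {r : ℕ} (A g : Matrix (J r) (J r) ℂ)
    (P : MvPolynomial (J r × J r) ℂ) :
    MvPolynomial.eval (fun p => g p.1 p.2) (translatePoly A P) =
      MvPolynomial.eval (fun p => (A * g) p.1 p.2) P := by
  rw [translatePoly, ← MvPolynomial.aeval_eq_eval, ← MvPolynomial.aeval_eq_eval,
    MvPolynomial.aeval_bind₁]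
  simp [Matrix.mul_apply]

/-- Left translation is polynomial, so carrying the cell into its closure already carries the
closure into itself. -/
theorem mul_mem_bigCellClosure {r : ℕ} {A : Matrix (J r) (J r) ℂ}
    (hA : ∀ g ∈ bigCell r, A * g ∈ bigCellClosure r) {g : Matrix (J r) (J r) ℂ}
    (hg : g ∈ bigCellClosure r) : A * g ∈ bigCellClosure r := by
  intro P hP
  rw [← eval_translatePoly]
  refine hg _ fun x hx => ?_
  rw [eval_translatePoly]
  exact hA x hx P hP

theorem yOne_mul_mem {r : ℕ} (i : ℕ) (t : ℂ) {g : Matrix (J r) (J r) ℂ}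
    (hg : g ∈ bigCellClosure r) : yOne r i t * g ∈ bigCellClosure r := by
  refine mul_mem_bigCellClosure ?_ hg
  rintro _ ⟨n', hn', h, hh, n, hn, rfl⟩
  refine subset_bigCellClosure r ⟨_, unipLower_mul (yOne_mem_unipLower r i t) hn', h, hh, n, hn, ?_⟩
  simp only [Matrix.mul_assoc]

theorem coroot_mul_coroot_inv (r i : ℕ) (t : ℂˣ) : coroot r i t⁻¹ * coroot r i t = 1 := by
  rw [coroot, coroot, Matrix.diagonal_mul_diagonal, ← Matrix.diagonal_one]
  congr 1
  ext b
  rw [Units.val_inv_eq_inv_val, inv_zpow, inv_mul_cancel₀ (zpow_ne_zero _ t.ne_zero)]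

/-- The torus normalizes `N₋`, so the coroot element can be moved past `n₋` and absorbed into `H`.
-/
theorem coroot_mul_mem {r : ℕ} (i : ℕ) (t : ℂˣ) {g : Matrix (J r) (J r) ℂ}
    (hg : g ∈ bigCellClosure r) : coroot r i t * g ∈ bigCellClosure r := by
  refine mul_mem_bigCellClosure ?_ hg
  rintro _ ⟨n', hn', h, hh, n, hn, rfl⟩
  have hap : ∀ a b, (coroot r i t * n' * coroot r i t⁻¹) a b
      = (t : ℂ) ^ hPair r i a * n' a b * ((t⁻¹ : ℂˣ) : ℂ) ^ hPair r i b := fun a b => by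
    rw [coroot, coroot, Matrix.mul_diagonal, Matrix.diagonal_mul]
  refine subset_bigCellClosure r ⟨coroot r i t * n' * coroot r i t⁻¹,
    ⟨SO_mul (SO_mul (coroot_mem r i t) hn'.1) (coroot_mem r i _), fun a => ?_, fun a b hab => ?_⟩,
    coroot r i t * h, ⟨SO_mul (coroot_mem r i t) hh.1, fun a b hab => ?_⟩, n, hn, ?_⟩
  · rw [hap, hn'.2.1, mul_one, Units.val_inv_eq_inv_val, inv_zpow,
      mul_inv_cancel₀ (zpow_ne_zero _ t.ne_zero)]
  · rw [hap, hn'.2.2 a b hab, mul_zero, zero_mul]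
  · rw [coroot, Matrix.diagonal_mul, hh.2 a b hab, mul_zero]
  · have := coroot_mul_coroot_inv r i t
    calc coroot r i t * (n' * h * n)
        = coroot r i t * n' * (coroot r i t⁻¹ * coroot r i t) * h * n := by
          rw [this]
          simp only [Matrix.mul_assoc, Matrix.one_mul]
      _ = _ := by simp only [Matrix.mul_assoc]

open Polynomial in
/-- The curve `t ↦ x_i(t)` as a matrix of polynomials. -/
noncomputable def xCurve (r i : ℕ) : Matrix (J r) (J r) ℂ[X] :=
  1 + (X : ℂ[X]) • (eMat r i).map C + (C (2 : ℂ)⁻¹ * X ^ 2) • (eMat r i * eMat r i).map C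

open Polynomial in
theorem eval_xCurve (r i : ℕ) (t : ℂ) : (xCurve r i).map (eval t) = xOne r i t := by
  ext a b
  rw [xOne_eq]
  simp only [xCurve, Matrix.map_apply, Matrix.add_apply, Matrix.smul_apply, smul_eq_mul,
    Matrix.one_apply]
  split_ifs <;> simp <;> ring

open Polynomial in
theorem eval_xCurve_mul (r i : ℕ) (t : ℂ) (g : Matrix (J r) (J r) ℂ) :
    (xCurve r i * g.map C).map (eval t) = xOne r i t * g := by
  rw [← eval_xCurve, ← coe_evalRingHom, Matrix.map_mul]
  congr 1
  ext a b
  simp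

-- The leading minors of `x_i(t) g` are polynomials in `t` with value `1` at `t = 0`; away from
-- their finitely many zeros the triangular factorization exists.
open Polynomial in
theorem xOne_mul_mem_bigCell {r : ℕ} (i : ℕ) {g : Matrix (J r) (J r) ℂ}
    (hg : g ∈ unipLower r) : {t : ℂ | xOne r i t * g ∉ bigCell r}.Finite := by
  set q : ∀ k : Fin (2 * r + 2), ℂ[X] := fun k =>
    (leading (Nat.le_of_lt_succ k.2) (xCurve r i * g.map C)).det with hq
  have hqe : ∀ k t, eval t (q k) = (leading (Nat.le_of_lt_succ k.2) (xOne r i t * g)).det := by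
    intro k t
    rw [hq, ← eval_xCurve_mul, ← coe_evalRingHom, RingHom.map_det]
    rfl
  have hq0 : ∀ k, q k ≠ 0 := by
    intro k h0
    have h1 := hqe k 0
    have hx : xOne r i 0 = 1 := by simp [xOne_eq]
    rw [h0, eval_zero, hx, Matrix.one_mul,
      det_leading_of_unitriangular_lower _ hg.2.1 hg.2.2] at h1
    exact zero_ne_one h1
  have hprod : ∏ k, q k ≠ 0 := Finset.prod_ne_zero_iff.2 fun k _ => hq0 k
  refine (Polynomial.finite_setOfPred_isRoot hprod).subset fun t ht => ?_
  by_contra hroot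
  apply ht
  refine mem_bigCell_of_leading_ne_zero (SO_mul (xOne_mem r i t) hg.1) fun k hk => ?_
  intro h0
  apply hroot
  show eval t (∏ k, q k) = 0
  rw [eval_prod]
  refine Finset.prod_eq_zero (Finset.mem_univ (⟨k, by omega⟩ : Fin (2 * r + 2))) ?_
  rw [hqe]
  exact h0

/-- `H N` is closed under products, by upper triangularity and `upper_eq_torus_mul`. -/
theorem mul_torus_mul_unipUpper_mem {r : ℕ} {g : Matrix (J r) (J r) ℂ} (hg : g ∈ bigCell r)
    {t n : Matrix (J r) (J r) ℂ} (ht : t ∈ torus r) (hn : n ∈ unipUpper r) :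
    g * t * n ∈ bigCell r := by
  obtain ⟨n', hn', h, hh, u, hu, rfl⟩ := hg
  have hU0 : ∀ a b, b < a → (h * u * t * n) a b = 0 := by
    have key : ∀ A B : Matrix (J r) (J r) ℂ, (∀ a b, b < a → A a b = 0) →
        (∀ a b, b < a → B a b = 0) → ∀ a b, b < a → (A * B) a b = 0 := by
      intro A B hA hB a b hab
      rw [Matrix.mul_apply]
      refine Finset.sum_eq_zero fun c _ => ?_
      by_cases hc : c < a
      · rw [hA _ _ hc, zero_mul]
      · rw [hB c b (lt_of_lt_of_le hab (not_lt.1 hc)), mul_zero]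
    exact key _ _ (key _ _ (key _ _ (fun a b h => hh.2 a b h.ne') hu.2.2)
      fun a b h => ht.2 a b h.ne') hn.2.2
  obtain ⟨t', ht', v, hv, he⟩ := upper_eq_torus_mul hU0
    (SO_mul (SO_mul (SO_mul hh.1 hu.1) ht.1) hn.1)
  refine ⟨n', hn', t', ht', v, hv, ?_⟩
  rw [Matrix.mul_assoc n' t' v, ← he]
  simp only [Matrix.mul_assoc]

-- A polynomial vanishing on the big cell, restricted to the curve `t ↦ x_i(t) g`, vanishes for all
-- but finitely many `t`, hence identically. This replaces an appeal to the irreducibility of `G`.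
open Polynomial in
theorem xOne_mul_mem {r : ℕ} (i : ℕ) (t : ℂ) {g : Matrix (J r) (J r) ℂ}
    (hg : g ∈ bigCellClosure r) : xOne r i t * g ∈ bigCellClosure r := by
  refine mul_mem_bigCellClosure ?_ hg
  rintro _ ⟨n', hn', h, hh, n, hn, rfl⟩ P hP
  set g := n' * h * n with hgdef
  set p : ℂ[X] := MvPolynomial.aeval (fun q => (xCurve r i * g.map C) q.1 q.2) P with hp
  have hpe : ∀ s, eval s p = MvPolynomial.eval (fun q => (xOne r i s * g) q.1 q.2) P := by
    intro s
    rw [hp, ← coe_evalRingHom, MvPolynomial.aeval_def, MvPolynomial.eval₂_comp_left,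
      ← eval_xCurve_mul, MvPolynomial.eval]
    rw [MvPolynomial.coe_eval₂Hom]
    congr 1
    ext x
    simp
  have hfin := xOne_mul_mem_bigCell i hn'
  have hp0 : p = 0 := by
    refine Polynomial.eq_zero_of_infinite_isRoot p ?_
    refine (hfin.infinite_compl).mono fun s hs => ?_
    have hs' : xOne r i s * n' ∈ bigCell r := not_not.1 hs
    show eval s p = 0
    rw [hpe]
    refine hP _ ?_
    rw [hgdef, ← Matrix.mul_assoc, ← Matrix.mul_assoc]
    exact mul_torus_mul_unipUpper_mem hs' hh hn
  rw [← hpe, hp0, eval_zero]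

/-! ### Generalized minors as ordinary minors -/

theorem det_leading_bigCell {r d : ℕ} (hd : d ≤ 2 * r + 1) {n' h n : Matrix (J r) (J r) ℂ}
    (hn' : n' ∈ unipLower r) (hh : h ∈ torus r) (hn : n ∈ unipUpper r) :
    (leading hd (n' * h * n)).det = weightChar r d h := by
  have h0 : ∀ a b, b < a → (h * n) a b = 0 := by
    intro a b hab
    rw [Matrix.mul_apply]
    refine Finset.sum_eq_zero fun c _ => ?_
    by_cases hc : a = c
    · rw [← hc, hn.2.2 _ _ hab, mul_zero]
    · rw [hh.2 _ _ hc, zero_mul]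
  have h1 : ∀ a, (h * n) a a = h a a := by
    intro a
    rw [Matrix.mul_apply, Finset.sum_eq_single a]
    · rw [hn.2.1, mul_one]
    · intro c _ hc
      rw [hh.2 _ _ hc.symm, zero_mul]
    · simp
  rw [Matrix.mul_assoc, leading_mul_of_lower hd hn'.2.2, Matrix.det_mul,
    det_leading_of_unitriangular_lower hd hn'.2.1 hn'.2.2, one_mul, det_leading_of_upper hd h0,
    weightChar, prod_castLE hd]
  · refine Finset.prod_congr rfl fun i _ => ?_
    rw [h1, if_pos (by simp)]
  · intro c hc
    rw [if_neg (not_lt.2 hc)]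

theorem wBar_mem (r : ℕ) (w : List ℕ) : wBar r w ∈ SO r := by
  induction w with
  | nil => simpa [wBar] using SO_one r
  | cons i w ih =>
    have h : wBar r (i :: w) = sBar r i * wBar r w := by simp [wBar]
    rw [h]
    exact SO_mul (SO_mul (SO_mul (xOne_mem r i _) (yOne_mem r i _)) (xOne_mem r i _)) ih

/-- The inverse of each `s̄_i` is again a product of elements `x_i(·)` and `y_i(·)`. -/
theorem wBar_inv_mul_mem {r : ℕ} (w : List ℕ) {g : Matrix (J r) (J r) ℂ}
    (hg : g ∈ bigCellClosure r) : (wBar r w)⁻¹ * g ∈ bigCellClosure r := by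
  induction w generalizing g with
  | nil => simpa [wBar] using hg
  | cons i w ih =>
    have h : wBar r (i :: w) = sBar r i * wBar r w := by simp [wBar]
    have hx : (xOne r i (-1))⁻¹ = xOne r i 1 := by
      rw [xOne, xOne, ← Matrix.exp_neg, neg_smul, neg_neg]
    have hy : (yOne r i 1)⁻¹ = yOne r i (-1) := by
      rw [yOne, yOne, ← Matrix.exp_neg, neg_smul]
    rw [h, Matrix.mul_inv_rev, Matrix.mul_assoc]
    apply ih
    rw [sBar, Matrix.mul_inv_rev, Matrix.mul_inv_rev, hx, hy, Matrix.mul_assoc, Matrix.mul_assoc]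
    exact xOne_mul_mem i _ (yOne_mul_mem i _ (xOne_mul_mem i _ hg))

theorem one_mem_bigCell (r : ℕ) : (1 : Matrix (J r) (J r) ℂ) ∈ bigCell r := by
  refine ⟨1, ⟨SO_one r, by simp, fun a b h => Matrix.one_apply_ne h.ne⟩, 1,
    ⟨SO_one r, fun a b h => Matrix.one_apply_ne h⟩, 1,
    ⟨SO_one r, by simp, fun a b h => Matrix.one_apply_ne h.ne'⟩, by simp⟩

theorem list_prod_xMinus_mem (r : ℕ) (l : List (ℕ × ℂˣ)) :
    (l.map fun q => xMinus r q.1 q.2).prod ∈ SO r ∧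
      (l.map fun q => xMinus r q.1 q.2).prod ∈ bigCellClosure r := by
  induction l with
  | nil => simpa using ⟨SO_one r, subset_bigCellClosure r (one_mem_bigCell r)⟩
  | cons q l ih =>
    rw [List.map_cons, List.prod_cons]
    refine ⟨SO_mul (xMinus_mem r _ _) ih.1, ?_⟩
    rw [xMinus, Matrix.mul_assoc]
    exact yOne_mul_mem _ _ (coroot_mul_mem _ _ ih.2)

/-- Both sides come from polynomials and agree on `w̄ G_0`; the hypothesis on `g` puts `w̄⁻¹ g` in
the closure of `G_0`, where the agreement persists. -/
theorem genMinor_eq_det {r d : ℕ} (hd : d ≤ 2 * r + 1) (w : List ℕ) {g : Matrix (J r) (J r) ℂ}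
    (hg : g ∈ SO r) (hg' : g ∈ bigCellClosure r) :
    genMinor r w d g = (leading hd ((wBar r w)⁻¹ * g)).det := by
  obtain ⟨⟨P, hP⟩, hspec⟩ := genMinor_spec r w d
  -- The difference of the two sides at `w̄ x`, as a polynomial in `x`. It vanishes for `x` in the
  -- big cell and is evaluated at `x = w̄⁻¹ g`.
  set Q : MvPolynomial (J r × J r) ℂ := translatePoly (wBar r w) P -
    (leading hd (Matrix.of fun a b => (MvPolynomial.X (a, b) : MvPolynomial (J r × J r) ℂ))).det
    with hQ
  have hQe : ∀ x, MvPolynomial.eval (fun p => x p.1 p.2) Q =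
      MvPolynomial.eval (fun p => (wBar r w * x) p.1 p.2) P - (leading hd x).det := by
    intro x
    rw [hQ, map_sub, eval_translatePoly, RingHom.map_det]
    congr 2
    ext i j
    simp
  have hdet : IsUnit (wBar r w).det := (Matrix.isUnit_iff_isUnit_det _).1 (isUnit_wBar r w)
  have := wBar_inv_mul_mem w hg' Q ?_
  · rw [hQe, ← Matrix.mul_assoc, Matrix.mul_nonsing_inv _ hdet, Matrix.one_mul, ← hP g hg] at this
    exact sub_eq_zero.1 this
  · rintro _ ⟨n', hn', h, hh, n, hn, rfl⟩
    rw [hQe, det_leading_bigCell hd hn' hh hn, ← hP, hspec n' hn' h hh n hn, sub_self]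
    exact SO_mul (wBar_mem r w) (SO_mul (SO_mul hn'.1 hh.1) hn.1)

/-! ### The Cauchy–Binet formula and its iteration -/

theorem det_mul_eq_sum_fun {R ι : Type*} [CommRing R] [Fintype ι] [DecidableEq ι] {d : ℕ}
    (A : Matrix (Fin d) ι R) (B : Matrix ι (Fin d) R) :
    (A * B).det = ∑ f : Fin d → ι, (∏ i, B (f i) i) * (A.submatrix id f).det := by
  rw [Matrix.det_apply']
  simp only [Matrix.mul_apply, Finset.prod_univ_sum, Fintype.piFinset_univ, Finset.mul_sum]
  rw [Finset.sum_comm]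
  refine Finset.sum_congr rfl fun f _ => ?_
  rw [Matrix.det_apply', Finset.mul_sum]
  refine Finset.sum_congr rfl fun σ _ => ?_
  rw [Finset.prod_mul_distrib]
  simp only [Matrix.submatrix_apply, id]
  ring

-- Cauchy–Binet: in the expansion over all column choices the non-injective ones repeat a column,
-- and an injective one is uniquely an increasing choice composed with a permutation.
open Classical in
theorem det_mul_eq_sum_strictMono {R ι : Type*} [CommRing R] [Fintype ι] [LinearOrder ι] {d : ℕ}
    (A : Matrix (Fin d) ι R) (B : Matrix ι (Fin d) R) :
    (A * B).det = ∑ c : Fin d → ι with StrictMono c,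
      (A.submatrix id c).det * (B.submatrix c id).det := by
  have hR : ∀ c : Fin d → ι, (A.submatrix id c).det * (B.submatrix c id).det =
      ∑ τ : Equiv.Perm (Fin d), (∏ i, B ((c ∘ τ) i) i) * (A.submatrix id (c ∘ τ)).det := by
    intro c
    rw [Matrix.det_apply' (B.submatrix c id), Finset.mul_sum]
    refine Finset.sum_congr rfl fun τ _ => ?_
    have : A.submatrix id (c ∘ τ) = (A.submatrix id c).submatrix id τ := rfl
    rw [this, Matrix.det_permute']
    simp only [Matrix.submatrix_apply, id, Function.comp]
    ring
  rw [det_mul_eq_sum_fun, Finset.sum_congr rfl fun c _ => hR c, ← Finset.sum_product']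
  rw [← Finset.sum_filter_of_ne (p := Function.Injective)]
  · symm
    refine Finset.sum_bij (fun q _ => q.1 ∘ q.2) ?_ ?_ ?_ ?_
    · rintro ⟨c, τ⟩ h
      simp only [Finset.mem_product, Finset.mem_filter, Finset.mem_univ, true_and, and_true] at h ⊢
      exact h.injective.comp τ.injective
    · rintro ⟨c, τ⟩ h ⟨c', τ'⟩ h' he
      simp only [Finset.mem_product, Finset.mem_filter, Finset.mem_univ, true_and,
        and_true] at h h' he
      have hc : c = c' := (h.range_inj h').1 (by
        rw [← τ.surjective.range_comp c, ← τ'.surjective.range_comp c', he])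
      subst hc
      congr 1
      exact Equiv.ext fun i => h.injective (congrFun he i)
    · intro f hf
      simp only [Finset.mem_filter, Finset.mem_univ, true_and] at hf
      -- Sorting `f` gives the increasing choice; the inverse of the sorting permutation recovers
      -- `f`.
      refine ⟨(f ∘ Tuple.sort f, (Tuple.sort f)⁻¹), ?_, ?_⟩
      · simp only [Finset.mem_product, Finset.mem_filter, Finset.mem_univ, true_and, and_true]
        exact (Tuple.monotone_sort f).strictMono_of_injective
          (hf.comp (Tuple.sort f).injective)
      · ext i
        simp
    · rintro ⟨c, τ⟩ _
      rfl
  · intro f _ hf i j hij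
    by_contra hne
    apply hf
    rw [Matrix.det_zero_of_column_eq hne fun k => by simp [hij], mul_zero]

theorem det_one_submatrix {R ι : Type*} [CommRing R] [Fintype ι] [LinearOrder ι] {d : ℕ}
    {a b : Fin d → ι} (ha : StrictMono a) (hb : StrictMono b) [Decidable (a = b)] :
    ((1 : Matrix ι ι R).submatrix a b).det = if a = b then 1 else 0 := by
  split_ifs with h
  · subst h
    rw [Matrix.submatrix_one a ha.injective, Matrix.det_one]
  · have hr : ∃ i, a i ∉ Set.range b := by
      by_contra hcon
      push Not at hcon
      apply h
      refine (ha.range_inj hb).1 ?_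
      have hsub : Finset.univ.image a ⊆ Finset.univ.image b := by
        intro x hx
        obtain ⟨i, _, rfl⟩ := Finset.mem_image.1 hx
        obtain ⟨j, hj⟩ := hcon i
        exact Finset.mem_image.2 ⟨j, Finset.mem_univ j, hj⟩
      have := Finset.eq_of_subset_of_card_le hsub (by
        rw [Finset.card_image_of_injective _ ha.injective,
          Finset.card_image_of_injective _ hb.injective])
      simpa using congrArg (fun s : Finset ι => (s : Set ι)) this
    obtain ⟨i, hi⟩ := hr
    refine Matrix.det_eq_zero_of_row_eq_zero i fun j => ?_
    rw [Matrix.submatrix_apply, Matrix.one_apply_ne]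
    exact fun he => hi ⟨j, he.symm⟩

-- Cauchy–Binet iterated over the factors: `P t` is the set of letters occupied at time `t`, from
-- the columns `b` at time `0` to the rows `a` at time `n`.
open Classical in
theorem det_submatrix_eq_sum_paths {R ι : Type*} [CommRing R] [Fintype ι] [LinearOrder ι] {d : ℕ}
    (L X : ℕ → Matrix ι ι R) (h0 : X 0 = 1) (hX : ∀ n, X (n + 1) = L n * X n) (n : ℕ)
    {a b : Fin d → ι} (ha : StrictMono a) (hb : StrictMono b) :
    ((X n).submatrix a b).det =
      ∑ P : Fin (n + 1) → Fin d → ι with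
          P 0 = b ∧ P (Fin.last n) = a ∧ ∀ t, StrictMono (P t),
        ∏ t : Fin n, ((L t).submatrix (P t.succ) (P t.castSucc)).det := by
  induction n generalizing a with
  | zero =>
    rw [h0, det_one_submatrix ha hb]
    simp only [Finset.univ_eq_empty, Finset.prod_empty]
    rw [Finset.sum_const, nsmul_eq_mul, mul_one]
    split_ifs with h
    · subst h
      rw [Finset.card_eq_one.2 ⟨fun _ => a, ?_⟩, Nat.cast_one]
      ext P
      simp only [Finset.mem_filter, Finset.mem_univ, true_and, Finset.mem_singleton]
      constructor
      · rintro ⟨h, -, -⟩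
        ext t
        rw [Fin.fin_one_eq_zero t, h]
      · rintro rfl
        exact ⟨rfl, rfl, fun _ => ha⟩
    · rw [Finset.filter_eq_empty_iff.2, Finset.card_empty, Nat.cast_zero]
      rintro P - ⟨h1, h2, -⟩
      exact h (h2.symm.trans h1)
  | succ n ih =>
    have hsub : (X (n + 1)).submatrix a b = (L n).submatrix a id * (X n).submatrix id b := by
      rw [hX, Matrix.submatrix_mul_equiv (L n) (X n) a (Equiv.refl ι) b |>.symm]
      rfl
    rw [hsub, det_mul_eq_sum_strictMono, Finset.sum_filter, Finset.sum_filter,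
      ← (Fin.snocEquiv fun _ => Fin d → ι).sum_comp, Fintype.sum_prod_type]
    refine Eq.trans ?_ (Finset.sum_eq_single a ?_ ?_).symm
    · have h1 : ∀ c : Fin d → ι, (if StrictMono c then
          (((L n).submatrix a id).submatrix id c).det * (((X n).submatrix id b).submatrix c id).det
          else 0) = ∑ Q : Fin (n + 1) → Fin d → ι,
            if StrictMono c ∧ Q 0 = b ∧ Q (Fin.last n) = c ∧ ∀ t, StrictMono (Q t) then
              ((L n).submatrix a c).det *
                ∏ t : Fin n, ((L t).submatrix (Q t.succ) (Q t.castSucc)).det else 0 := by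
        intro c
        split_ifs with hc
        · simp only [Matrix.submatrix_submatrix, Function.comp_id, Function.id_comp, hc, true_and]
          rw [ih hc, Finset.mul_sum, Finset.sum_filter]
        · simp [hc]
      rw [Finset.sum_congr rfl fun c _ => h1 c, Finset.sum_comm]
      refine Finset.sum_congr rfl fun Q _ => ?_
      rw [Finset.sum_eq_single (Q (Fin.last n))]
      · have hP0 : ∀ x : Fin d → ι, (Fin.snocEquiv fun _ => Fin d → ι) (x, Q) 0 = Q 0 := fun x =>
          Fin.snoc_castSucc (α := fun _ => Fin d → ι) x Q 0
        have hPl : ∀ x : Fin d → ι,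
            (Fin.snocEquiv fun _ => Fin d → ι) (x, Q) (Fin.last (n + 1)) = x := fun x =>
          Fin.snoc_last (α := fun _ => Fin d → ι) x Q
        have hPc : ∀ x : Fin d → ι, ∀ t : Fin (n + 1),
            (Fin.snocEquiv fun _ => Fin d → ι) (x, Q) t.castSucc = Q t := fun x t =>
          Fin.snoc_castSucc (α := fun _ => Fin d → ι) x Q t
        have hcond : (StrictMono (Q (Fin.last n)) ∧ Q 0 = b ∧ Q (Fin.last n) = Q (Fin.last n) ∧
            ∀ t, StrictMono (Q t)) ↔ ((Fin.snocEquiv fun _ => Fin d → ι) (a, Q) 0 = b ∧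
            (Fin.snocEquiv fun _ => Fin d → ι) (a, Q) (Fin.last (n + 1)) = a ∧
            ∀ t, StrictMono ((Fin.snocEquiv fun _ => Fin d → ι) (a, Q) t)) := by
          rw [hP0, hPl, Fin.forall_fin_succ' (P := fun t =>
            StrictMono ((Fin.snocEquiv fun _ => Fin d → ι) (a, Q) t)), hPl]
          simp only [hPc, true_and]
          constructor
          · rintro ⟨_, h1, h2⟩
            exact ⟨h1, h2, ha⟩
          · rintro ⟨h1, h2, _⟩
            exact ⟨h2 _, h1, h2⟩
        rw [if_congr hcond rfl rfl]
        split_ifs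
        · rw [Fin.prod_univ_castSucc, mul_comm]
          simp only [Fin.succ_last, hPl, hPc, ← Fin.castSucc_succ, Fin.val_castSucc, Fin.val_last]
        · rfl
      · intro c _ hc
        rw [if_neg]
        rintro ⟨-, -, h, -⟩
        exact hc h.symm
      · simp
    · intro c _ hc
      refine Finset.sum_eq_zero fun Q _ => if_neg ?_
      rintro ⟨-, h, -⟩
      apply hc
      rw [← h]
      exact (Fin.snoc_last (α := fun _ => Fin d → ι) c Q).symm
    · simp

/-! ### Minors of a layer -/

theorem det_eq_mul_of_row_zero {K : Type*} [CommRing K] {n : ℕ}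
    (A : Matrix (Fin (n + 1)) (Fin (n + 1)) K) (h : ∀ j : Fin n, A 0 j.succ = 0) :
    A.det = A 0 0 * (A.submatrix Fin.succ Fin.succ).det := by
  rw [Matrix.det_succ_row_zero, Fin.sum_univ_succ, Finset.sum_eq_zero fun j _ => by simp [h j]]
  simp

theorem det_eq_mul_of_column_zero {K : Type*} [CommRing K] {n : ℕ}
    (A : Matrix (Fin (n + 1)) (Fin (n + 1)) K) (h : ∀ i : Fin n, A i.succ 0 = 0) :
    A.det = A 0 0 * (A.submatrix Fin.succ Fin.succ).det := by
  rw [Matrix.det_succ_column_zero, Fin.sum_univ_succ,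
    Finset.sum_eq_zero fun j _ => by simp [h j]]
  simp

theorem det_eq_zero_of_columns_proportional {K : Type*} [Field K] {n : Type*} [Fintype n]
    [DecidableEq n] (A : Matrix n n K) {j k : n} (hjk : j ≠ k) (c : K)
    (h : ∀ i, A i k = c * A i j) : A.det = 0 := by
  have hA : A = A.updateCol k (c • fun i => A i j) := by
    ext i l
    by_cases hl : l = k
    · subst hl
      simp [h i]
    · simp [hl]
  rw [hA, Matrix.det_updateCol_smul, show (A.updateCol k fun i => A i j).det = 0 from
    Matrix.det_updateCol_eq_zero hjk,
    mul_zero]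

/-- The entries of the matrix of a full cycle `x_{-1} ⋯ x_{-r}`: from an unbarred letter `b` one
stays with weight `S b` or moves to the next letter with weight `1`; the entries in the rows
`a ≥ r` have the shape `V b / U a`. -/
def layerEntry {K : Type*} [Field K] (r : ℕ) (S V U : ℕ → K) (a b : ℕ) : K :=
  if b < r then
    if a = b then S b
    else if a < r then (if a = b + 1 then 1 else 0)
    else if b + 1 = r then (U a)⁻¹ else 0
  else if a < b then 0 else (if b = r ∧ r < a then 2 else 1) * V b * (U a)⁻¹

theorem layerEntry_of_lt {K : Type*} [Field K] (r : ℕ) (S V U : ℕ → K) {a b : ℕ} (h : a < b) :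
    layerEntry r S V U a b = 0 := by
  unfold layerEntry
  split_ifs <;> first | rfl | omega

theorem layerEntry_enter {K : Type*} [Field K] {r : ℕ} (S V U : ℕ → K) {a b : ℕ} (hb : b + 1 = r)
    (ha : r ≤ a) : layerEntry r S V U a b = (U a)⁻¹ := by
  rw [layerEntry, if_pos (by omega), if_neg (by omega), if_neg (by omega), if_pos hb]

theorem layerEntry_of_le {K : Type*} [Field K] {r : ℕ} (S V U : ℕ → K) {a b : ℕ} (hb : r ≤ b)
    (hab : b ≤ a) :
    layerEntry r S V U a b = (if b = r ∧ r < a then 2 else 1) * V b * (U a)⁻¹ := by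
  rw [layerEntry, if_neg (by omega), if_neg (by omega)]

/-- The interaction of the transitions of two neighbouring particles. -/
def crossing (K : Type*) [Field K] (r a b : ℕ) : K :=
  if a < b ∨ (a = b ∧ a < r) then 1 else if a = b ∧ a = r then 2⁻¹ else 0

/-- The first particle splits off. Either the first row or the first column has at most its corner
entry nonzero, possibly after one column operation, or the first two columns are proportional and
the minor vanishes. -/
theorem det_layerEntry_succ {K : Type*} [Field K] [CharZero K] {r : ℕ} {S V U : ℕ → K}
    (hV : ∀ b, V b ≠ 0) (n : ℕ) {a b : ℕ → ℕ}
    (ha : ∀ i j, i < j → j < n + 2 → a i < a j) (hb : ∀ i j, i < j → j < n + 2 → b i < b j) :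
    (Matrix.of fun i j : Fin (n + 2) => layerEntry r S V U (a i) (b j)).det =
      layerEntry r S V U (a 0) (b 0) * crossing K r (a 0) (b 1) *
        (Matrix.of fun i j : Fin (n + 1) => layerEntry r S V U (a (i + 1)) (b (j + 1))).det := by
  set A : Matrix (Fin (n + 2)) (Fin (n + 2)) K :=
    Matrix.of fun i j => layerEntry r S V U (a i) (b j) with hA
  have hAs : A.submatrix Fin.succ Fin.succ =
      Matrix.of fun i j : Fin (n + 1) => layerEntry r S V U (a (i + 1)) (b (j + 1)) := rfl
  rw [← hAs]
  have hA00 : A 0 0 = layerEntry r S V U (a 0) (b 0) := rfl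
  rw [← hA00]
  have hb01 : b 0 < b 1 := hb 0 1 (by omega) (by omega)
  have ha0 : ∀ i : Fin (n + 1), a 0 < a (i + 1) := fun i => ha 0 _ (by omega) (by omega)
  have hai : ∀ i : Fin (n + 2), a 0 ≤ a i := fun i => by
    rcases Nat.eq_zero_or_pos i.val with h | h
    · rw [h]
    · exact (ha 0 _ h i.2).le
  have h01 : (0 : Fin (n + 2)) ≠ 1 := by simp
  have hprop : ∀ c, (∀ i : Fin (n + 2), layerEntry r S V U (a i) (b 1) =
      c * layerEntry r S V U (a i) (b 0)) → A.det = 0 := fun c hc =>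
    det_eq_zero_of_columns_proportional A h01 c fun i => hc i
  by_cases h1 : a 0 < b 1
  -- The first particle ends to the left of every other starting point, so the rest of the first row
  -- vanishes.
  · rw [det_eq_mul_of_row_zero A, crossing, if_pos (Or.inl h1), mul_one]
    intro j
    refine layerEntry_of_lt _ _ _ _ (lt_of_lt_of_le h1 ?_)
    rcases Nat.eq_zero_or_pos j.val with h | h
    · simp [h]
    · refine (hb 1 _ ?_ j.succ.2).le
      simpa using h
  rw [not_lt] at h1
  by_cases h2 : b 0 + 1 < r
  -- Starting before `r`, the first particle reaches at most `b 0 + 1`; here `a 0 ≥ b 1 ≥ b 0 + 1`,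
  -- so all lower rows have entry zero in the first column.
  · rw [det_eq_mul_of_column_zero A]
    · by_cases h3 : a 0 = b 0 + 1
      · rw [crossing, if_pos (Or.inr ⟨by omega, by omega⟩), mul_one]
      · have : A 0 0 = 0 := by
          rw [hA00, layerEntry, if_pos (by omega), if_neg (by omega)]
          split_ifs <;> first | rfl | omega
        rw [this]
        ring
    · intro i
      have := ha0 i
      show layerEntry r S V U (a (i.succ : Fin (n + 2)).val) (b 0) = 0
      rw [Fin.val_succ, layerEntry, if_pos (by omega), if_neg (by omega)]
      split_ifs <;> first | rfl | omega
  by_cases h4 : b 0 + 1 = r ∧ b 1 = r ∧ a 0 = r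
  · obtain ⟨h4, h5, h6⟩ := h4
    have hA0 : ∀ i, A i 0 = (U (a i))⁻¹ := fun i => by
      have := hai i
      show layerEntry r S V U (a i) (b 0) = _
      exact layerEntry_enter _ _ _ h4 (by omega)
    have hA1 : ∀ i, A i 1 = (if r < a i then 2 else 1) * V r * (U (a i))⁻¹ := fun i => by
      have := hai i
      show layerEntry r S V U (a i) (b 1) = _
      rw [layerEntry_of_le _ _ _ h5.ge (by omega), h5]
      simp
    -- The first column is `1 / U`, the second is `2 V / U` except at the first row, where the
    -- letter is `0` and the `2` is missing. Subtracting `1 / (2 V r)` times the second column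
    -- leaves only `1 / (2 U r)` in the corner: this is the crossing factor `1/2`.
    have hdec : A = A.updateCol 0 ((fun i => if i = 0 then (2 * U r)⁻¹ else 0) +
        (2 * V r)⁻¹ • fun i => A i 1) := by
      ext i j
      by_cases hj : j = 0
      · subst hj
        rw [Matrix.updateCol_self, Pi.add_apply, Pi.smul_apply, hA0, hA1, smul_eq_mul]
        have := hV r
        by_cases hi : i = 0
        · subst hi
          simp only [Fin.val_zero, h6, if_true, lt_irrefl, if_false]
          by_cases hU : U r = 0
          · simp [hU]
          · field_simp
            norm_num
        · have hr : r < a i := h6 ▸ ha 0 i (Nat.pos_of_ne_zero fun h => hi (Fin.ext h)) i.2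
          rw [if_neg hi, if_pos hr, zero_add, ← mul_assoc, inv_mul_cancel₀ (by simpa using this),
            one_mul]
      · simp [hj]
    have hz : (A.updateCol 0 fun i => A i 1).det = 0 :=
      Matrix.det_updateCol_eq_zero h01.symm
    have hdet : A.det = (A.updateCol 0 fun i => if i = 0 then (2 * U r)⁻¹ else 0).det := by
      conv_lhs => rw [hdec]
      rw [Matrix.det_updateCol_add, Matrix.det_updateCol_smul, hz, mul_zero, add_zero]
    rw [hdet, det_eq_mul_of_column_zero]
    · rw [Matrix.updateCol_self, if_pos rfl, hA0, Fin.val_zero, h6, crossing, if_neg (by omega),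
        if_pos (by omega), mul_inv, mul_comm (2 : K)⁻¹]
      congr 2
    · intro i
      rw [Matrix.updateCol_self, if_neg (Fin.succ_ne_zero i)]
  · have hcr : crossing K r (a 0) (b 1) = 0 := by
      rw [crossing, if_neg (by omega), if_neg (by omega)]
    rw [hcr, mul_zero, zero_mul]
    -- All rows lie weakly beyond `b 1 ≥ r`, where both columns are multiples of `1 / U`.
    by_cases h5 : b 0 < r
    · refine hprop ((if b 1 = r then 2 else 1) * V (b 1)) fun i => ?_
      have := hai i
      rw [layerEntry_of_le _ _ _ (by omega) (by omega),
        layerEntry_enter _ _ _ (by omega) (by omega)]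
      by_cases h6 : b 1 = r
      · rw [if_pos (by omega), if_pos h6]
      · rw [if_neg (by omega), if_neg h6]
    · refine hprop (V (b 1) * ((if b 0 = r then 2 else 1) * V (b 0))⁻¹) fun i => ?_
      have := hai i
      have hV0 := hV (b 0)
      rw [layerEntry_of_le _ _ _ (by omega) (by omega),
        layerEntry_of_le _ _ _ (by omega) (by omega),
        if_neg (by omega), one_mul]
      by_cases h6 : b 0 = r
      · rw [if_pos h6, if_pos (by omega)]
        field_simp
      · rw [if_neg h6, if_neg (by omega)]
        field_simp

theorem det_layerEntry {K : Type*} [Field K] [CharZero K] {r : ℕ} {S V U : ℕ → K}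
    (hV : ∀ b, V b ≠ 0) (d : ℕ) {a b : ℕ → ℕ}
    (ha : ∀ i j, i < j → j < d → a i < a j) (hb : ∀ i j, i < j → j < d → b i < b j) :
    (Matrix.of fun i j : Fin d => layerEntry r S V U (a i) (b j)).det =
      (∏ i ∈ Finset.range d, layerEntry r S V U (a i) (b i)) *
        ∏ i ∈ Finset.range (d - 1), crossing K r (a i) (b (i + 1)) := by
  induction d generalizing a b with
  | zero => simp
  | succ n ih =>
    cases n with
    | zero => simp
    | succ n =>
      rw [det_layerEntry_succ hV n ha hb,
        ih (a := fun i => a (i + 1)) (b := fun i => b (i + 1))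
          (fun i j hij hj => ha _ _ (by omega) (by omega))
          (fun i j hij hj => hb _ _ (by omega) (by omega)),
        Finset.prod_range_succ' _ (n + 1)]
      simp only [Nat.add_sub_cancel]
      rw [Finset.prod_range_succ' (fun i => crossing K r (a i) (b (i + 1))) n]
      ring

/-! ### The matrix of a full cycle -/

theorem xMinus_apply_of_lt {r i : ℕ} (hi : i < r) (t : ℂˣ) (a b : J r) :
    xMinus r i t a b = if a = b then
        (if b.val + 1 = i ∨ b.val + i = 2 * r then (t : ℂ)⁻¹
          else if b.val = i ∨ b.val + i = 2 * r + 1 then (t : ℂ) else 1)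
      else if a.val = b.val + 1 ∧ (b.val + 1 = i ∨ b.val + i = 2 * r) then 1 else 0 := by
  have ht := t.ne_zero
  rw [xMinus, coroot, Matrix.mul_diagonal, yOne_apply_of_lt hi, hPair, if_pos hi,
    Units.val_inv_eq_inv_val]
  simp only [IsPlain, IsBar]
  split_ifs <;> first | (exfalso; omega) | simp

theorem xMinus_apply_of_eq {r : ℕ} (t : ℂˣ) (a b : J r) :
    xMinus r r t a b = if a = b then
        (if b.val + 1 = r then (t : ℂ)⁻¹ ^ 2 else if b.val = r + 1 then (t : ℂ) ^ 2 else 1)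
      else if b.val + 1 = r ∧ a.val = r then (t : ℂ)⁻¹
      else if b.val = r ∧ a.val = r + 1 then 2 * t
      else if b.val + 1 = r ∧ a.val = r + 1 then 1 else 0 := by
  have ht := t.ne_zero
  rw [xMinus, coroot, Matrix.mul_diagonal, yOne_apply_of_le le_rfl, hPair, if_neg (lt_irrefl r),
    Units.val_inv_eq_inv_val]
  simp only [IsPlain, IsBar]
  split_ifs <;> first | (exfalso; omega) | (simp; done) | skip
  all_goals simp [zpow_ofNat, ht, pow_two]

/-- The entries of `x_{-1}(y_1) ⋯ x_{-j}(y_j)` for `j < r`. -/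
noncomputable def partialCycleEntry (r : ℕ) (y : ℕ → ℂ) (j a b : ℕ) : ℂ :=
  if b < j then (if a = b then y b / y (b + 1) else if a = b + 1 then 1 else 0)
  else if b = j then (if a = b then y j else 0)
  else if b + j < 2 * r then (if a = b then 1 else 0)
  else if a < b then 0
  else if b + j = 2 * r then (y (2 * r - a))⁻¹
  else y (2 * r + 1 - b) / y (2 * r - a)

theorem sum_eq_of_eq_zero_of_ne {ι : Type*} [Fintype ι] [DecidableEq ι] {x y : ι} (hxy : x ≠ y)
    (f : ι → ℂ) (h : ∀ c, c ≠ x → c ≠ y → f c = 0) : ∑ c, f c = f x + f y := by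
  rw [← Finset.sum_pair hxy]
  symm
  refine Finset.sum_subset (Finset.subset_univ _) fun c _ hc => ?_
  simp only [Finset.mem_insert, Finset.mem_singleton, not_or] at hc
  exact h c hc.1 hc.2

section PartialCycle

variable {r j a b : ℕ} (y : ℕ → ℂ)

theorem partialCycleEntry_done (h : b < j) : partialCycleEntry r y j a b =
    if a = b then y b / y (b + 1) else if a = b + 1 then 1 else 0 := by
  rw [partialCycleEntry, if_pos h]

theorem partialCycleEntry_self : partialCycleEntry r y j a j = if a = j then y j else 0 := by
  rw [partialCycleEntry, if_neg (lt_irrefl j), if_pos rfl]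

theorem partialCycleEntry_middle (h : j < b) (h' : b + j < 2 * r) :
    partialCycleEntry r y j a b = if a = b then 1 else 0 := by
  rw [partialCycleEntry, if_neg (by omega), if_neg (by omega), if_pos h']

theorem partialCycleEntry_front (h : j < b) (h' : b + j = 2 * r) :
    partialCycleEntry r y j a b = if a < b then 0 else (y (2 * r - a))⁻¹ := by
  rw [partialCycleEntry, if_neg (by omega), if_neg (by omega), if_neg (by omega)]
  split_ifs
  · rfl
  · rfl

theorem partialCycleEntry_bar (h : j < b) (h' : 2 * r < b + j) :
    partialCycleEntry r y j a b = if a < b then 0 else y (2 * r + 1 - b) / y (2 * r - a) := by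
  rw [partialCycleEntry, if_neg (by omega), if_neg (by omega), if_neg (by omega)]
  split_ifs
  · rfl
  · omega
  · rfl

end PartialCycle

/-- Right multiplication by `x_{-(j+1)}` changes only the columns of the letters `j+1`, `j+2` and
their barred counterparts: in each pair it rescales both columns and adds the second to the first.
-/
theorem prod_xMinus_apply_of_lt {r : ℕ} (y : ℕ → ℂˣ) (y' : ℕ → ℂ) (hy0 : y' 0 = 1)
    (hy : ∀ l, 1 ≤ l → y' l = y l) (j : ℕ) (hj : j < r) (a b : J r) :
    ((List.range j).map fun i => xMinus r (i + 1) (y (i + 1))).prod a b =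
      partialCycleEntry r y' j a b := by
  have ha2 := a.2
  have hb2 := b.2
  induction j generalizing b with
  | zero =>
    rw [List.range_zero, List.map_nil, List.prod_nil, Matrix.one_apply]
    rcases (by omega : b.val = 0 ∨ (0 < b.val ∧ b.val < 2 * r) ∨ b.val = 2 * r) with h | h | h
    · rw [h, partialCycleEntry_self, hy0]
      simp only [Fin.ext_iff, h]
    · rw [partialCycleEntry_middle _ h.1 (by omega)]
      simp only [Fin.ext_iff]
    · rw [partialCycleEntry_front _ (by omega) (by omega)]
      by_cases hab : a = b
      · rw [if_pos hab, if_neg (by rw [hab]; omega), hab, h, Nat.sub_self, hy0, inv_one]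
      · have : a.val ≠ b.val := fun h => hab (Fin.ext h)
        rw [if_neg hab, if_pos (by omega)]
  | succ j ih =>
    have ih := fun c : J r => ih (by omega) c c.2
    have hne : y' (j + 1) ≠ 0 := by
      rw [hy _ (by omega)]
      exact (y _).ne_zero
    rw [List.range_succ, List.map_append, List.prod_append, List.map_singleton,
      List.prod_singleton, Matrix.mul_apply]
    have hE := fun c : J r => xMinus_apply_of_lt hj (y (j + 1)) c b
    rw [← hy (j + 1) (by omega)] at hE
    -- The columns `j+1` and `(j+2)‾` are those combined with the next column; all others are only
    -- rescaled.
    by_cases hb : b.val = j ∨ b.val + (j + 1) = 2 * r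
    · rw [sum_eq_of_eq_zero_of_ne (x := b) (y := ⟨b.val + 1, by omega⟩)
        (by simp [Fin.ext_iff])]
      · rw [ih, ih, hE, hE, if_pos rfl, if_pos (by omega), if_neg (by simp [Fin.ext_iff]),
          if_pos (by dsimp only; omega), mul_one]
        dsimp only
        rcases hb with hb | hb
        · rw [hb, partialCycleEntry_self, partialCycleEntry_middle _ (by omega) (by omega),
            partialCycleEntry_done _ (by omega)]
          split_ifs <;> first | (exfalso; omega) | simp [div_eq_mul_inv]
        · rw [partialCycleEntry_middle _ (by omega) (by omega),
            partialCycleEntry_front _ (by omega) (by omega),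
            partialCycleEntry_front _ (by omega) (by omega)]
          split_ifs <;> first | (exfalso; omega) | (simp; done) | skip
          rw [show 2 * r - a.val = j + 1 by omega]
          simp
      · intro c hc1 hc2
        have : c.val ≠ b.val + 1 := fun h => hc2 (Fin.ext h)
        rw [hE, if_neg hc1, if_neg (by omega), mul_zero]
    · rw [Finset.sum_eq_single b]
      · rw [ih, hE, if_pos rfl, if_neg (by omega)]
        rcases (by omega : b.val < j ∨ b.val = j + 1 ∨ (j + 1 < b.val ∧ b.val + (j + 1) < 2 * r) ∨
          b.val + j = 2 * r ∨ 2 * r < b.val + j) with h | h | h | h | h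
        · rw [if_neg (by omega), partialCycleEntry_done _ h, partialCycleEntry_done _ (by omega),
            mul_one]
        · rw [if_pos (by omega), h, partialCycleEntry_self,
            partialCycleEntry_middle _ (by omega) (by omega)]
          simp
        · rw [if_neg (by omega), partialCycleEntry_middle _ (by omega) (by omega),
            partialCycleEntry_middle _ h.1 h.2, mul_one]
        · rw [if_pos (by omega), partialCycleEntry_front _ (by omega) h,
            partialCycleEntry_bar _ (by omega) (by omega), show 2 * r + 1 - b.val = j + 1 by omega]
          split_ifs
          · simp
          · rw [div_eq_mul_inv, mul_comm]
        · rw [if_neg (by omega), partialCycleEntry_bar _ (by omega) h,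
            partialCycleEntry_bar _ (by omega) (by omega), mul_one]
      · intro c _ hc
        rw [hE, if_neg hc, if_neg (by omega), mul_zero]
      · simp

/-- The weight of staying at an unbarred letter. -/
noncomputable def stayWeight (r : ℕ) (y : ℕ → ℂ) (b : ℕ) : ℂ :=
  if b + 1 < r then y b / y (b + 1) else y (r - 1) / y r ^ 2

/-- The weight of leaving the letter `0` or a barred letter. -/
noncomputable def leaveWeight (r : ℕ) (y : ℕ → ℂ) (b : ℕ) : ℂ :=
  if b = r then y r else if b = r + 1 then y r ^ 2 else y (2 * r + 1 - b)

/-- The inverse of the weight of entering the letter `0` or a barred letter. -/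
noncomputable def enterWeight (r : ℕ) (y : ℕ → ℂ) (a : ℕ) : ℂ :=
  if a = r then y r else y (2 * r - a)

/-- The last factor `x_{-r}` mixes the columns of `r`, `0` and `r̄`; this is where the factor `2` on
leaving `0` arises. -/
theorem prod_xMinus_apply {r : ℕ} (hr : 1 ≤ r) (y : ℕ → ℂˣ) (y' : ℕ → ℂ) (hy0 : y' 0 = 1)
    (hy : ∀ l, 1 ≤ l → y' l = y l) (a b : J r) :
    ((List.range r).map fun i => xMinus r (i + 1) (y (i + 1))).prod a b =
      layerEntry r (stayWeight r y') (leaveWeight r y') (enterWeight r y') a b := by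
  have ha2 := a.2
  have hb2 := b.2
  obtain ⟨s, rfl⟩ : ∃ s, r = s + 1 := ⟨r - 1, by omega⟩
  have hne : y' (s + 1) ≠ 0 := by
    rw [hy _ (by omega)]
    exact (y _).ne_zero
  rw [List.range_succ, List.map_append, List.prod_append, List.map_singleton,
    List.prod_singleton, Matrix.mul_apply]
  have hE := fun c : J (s + 1) => xMinus_apply_of_eq (y (s + 1)) c b
  rw [← hy (s + 1) (by omega)] at hE
  have hR := fun c : J (s + 1) => prod_xMinus_apply_of_lt y y' hy0 hy s (by omega) a c
  -- `z` is the letter `0` and `w` the letter `r̄`.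
  obtain ⟨z, hzv⟩ : ∃ z : J (s + 1), z.val = s + 1 := ⟨⟨s + 1, by omega⟩, rfl⟩
  obtain ⟨w, hwv⟩ : ∃ w : J (s + 1), w.val = s + 2 := ⟨⟨s + 2, by omega⟩, rfl⟩
  have hRz := hR z
  have hRw := hR w
  rw [hzv, partialCycleEntry_middle _ (by omega) (by omega)] at hRz
  rw [hwv, partialCycleEntry_front _ (by omega) (by omega)] at hRw
  have hEb := hE b
  have hEz := hE z
  have hEw := hE w
  rw [if_pos rfl] at hEb
  have hsingle : (∀ c, c ≠ b → xMinus (s + 1) (s + 1) (y (s + 1)) c b = 0) → ∀ M : Matrix _ _ ℂ,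
      ∑ c, M a c * xMinus (s + 1) (s + 1) (y (s + 1)) c b =
        M a b * xMinus (s + 1) (s + 1) (y (s + 1)) b b := fun h M =>
    Finset.sum_eq_single b (fun c _ hc => by rw [h c hc, mul_zero]) (by simp)
  rcases (by omega : b.val < s ∨ b.val = s ∨ b.val = s + 1 ∨ b.val = s + 2 ∨ s + 2 < b.val)
    with hb | hb | hb | hb | hb
  · rw [hsingle, hR, hEb, if_neg (by omega), if_neg (by omega), mul_one,
      partialCycleEntry_done _ hb, layerEntry, stayWeight]
    · split_ifs <;> first | rfl | (exfalso; omega)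
    · intro c hc
      rw [hE, if_neg hc, if_neg (by omega), if_neg (by omega), if_neg (by omega)]
  · have hbz : z ≠ b := fun h => by rw [← h] at hb; omega
    have hbw : w ≠ b := fun h => by rw [← h] at hb; omega
    have hzw : w ≠ z := fun h => by rw [Fin.ext_iff] at h; omega
    rw [if_pos (by omega)] at hEb
    rw [if_neg hbz, if_pos (by omega)] at hEz
    rw [if_neg hbw, if_neg (by omega), if_neg (by omega), if_pos (by omega)] at hEw
    -- The column of the letter `r` in `x_{-r}` has exactly the three entries at `r`, `0` and `r̄`.
    rw [← Finset.add_sum_erase _ _ (Finset.mem_univ b),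
      ← Finset.add_sum_erase _ _ (Finset.mem_erase.2 ⟨hbz, Finset.mem_univ z⟩),
      ← Finset.add_sum_erase _ _ (Finset.mem_erase.2 ⟨hzw, Finset.mem_erase.2
        ⟨hbw, Finset.mem_univ w⟩⟩), Finset.sum_eq_zero, add_zero, hRz, hRw, hR b,
      hEb, hEz, hEw, hb, partialCycleEntry_self, layerEntry, stayWeight, enterWeight]
    · split_ifs <;> first | (exfalso; omega) | (simp; done) | skip
      simp [div_eq_mul_inv]
    · intro c hc
      simp only [Finset.mem_erase, Finset.mem_univ, and_true] at hc
      obtain ⟨hcw, hcz, hcb⟩ := hc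
      have h1 : c.val ≠ s + 1 := fun h => hcz (Fin.ext (h.trans hzv.symm))
      have h2 : c.val ≠ s + 2 := fun h => hcw (Fin.ext (h.trans hwv.symm))
      rw [hE, if_neg hcb, if_neg (by omega), if_neg (by omega), if_neg (by omega), mul_zero]
  · have hbz : z = b := Fin.ext (hzv.trans hb.symm)
    have hbw : w ≠ b := fun h => by rw [← h] at hb; omega
    rw [if_neg (by omega), if_neg (by omega)] at hEb
    rw [if_neg hbw, if_neg (by omega), if_pos (by omega)] at hEw
    rw [hbz] at hRz
    rw [sum_eq_of_eq_zero_of_ne hbw.symm, hRw, hRz, hEb, hEw, hb, layerEntry, leaveWeight,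
      enterWeight]
    · split_ifs <;> first | (exfalso; omega) | (simp; done) | (simp [hne]; done) | skip
      ring
    · intro c hc1 hc2
      have h2 : c.val ≠ s + 2 := fun h => hc2 (Fin.ext (h.trans hwv.symm))
      rw [hE, if_neg hc1, if_neg (by omega), if_neg (by omega), if_neg (by omega), mul_zero]
  · have hbw : w = b := Fin.ext (hwv.trans hb.symm)
    rw [hbw] at hRw
    rw [hsingle, hEb, hRw, hb, layerEntry, leaveWeight, enterWeight]
    · split_ifs <;> first | (exfalso; omega) | (simp; done) | skip
      ring
    · intro c hc
      rw [hE, if_neg hc, if_neg (by omega), if_neg (by omega), if_neg (by omega)]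
  · rw [hsingle, hEb, if_neg (by omega), if_neg (by omega), hR, mul_one,
      partialCycleEntry_bar _ (by omega) (by omega), layerEntry, leaveWeight, enterWeight]
    · split_ifs <;> first | (exfalso; omega) | (simp; done) | skip
      ring
    · intro c hc
      rw [hE, if_neg hc, if_neg (by omega), if_neg (by omega), if_neg (by omega)]

/-! ### Rows of the representatives of Weyl group elements -/

/-- Row `a` of `M` is `ε` times the `b`-th coordinate functional. -/
def RowIs {r : ℕ} (M : Matrix (J r) (J r) ℂ) (a b : ℕ) (ε : ℂ) : Prop :=
  ∀ x y : J r, x.val = a → M x y = if y.val = b then ε else 0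

theorem RowIs.mul {r : ℕ} {M N : Matrix (J r) (J r) ℂ} {a b c : ℕ} {ε δ : ℂ} (hb : b < 2 * r + 1)
    (hM : RowIs M a b ε) (hN : RowIs N b c δ) : RowIs (M * N) a c (ε * δ) := by
  intro x y hx
  rw [Matrix.mul_apply, Finset.sum_eq_single ⟨b, hb⟩]
  · rw [hM x _ hx, if_pos rfl, hN _ y rfl]
    split_ifs <;> simp
  · intro z _ hz
    rw [hM x z hx, if_neg fun h => hz (Fin.ext h), zero_mul]
  · simp

/-- The `n`-th coordinate functional. -/
def coordFun (r n : ℕ) : J r → ℂ := fun c => if c.val = n then 1 else 0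

theorem vecMul_coordFun {r n : ℕ} (hn : n < 2 * r + 1) (M : Matrix (J r) (J r) ℂ) :
    Matrix.vecMul (coordFun r n) M = M ⟨n, hn⟩ := by
  ext c
  rw [Matrix.vecMul, dotProduct, Finset.sum_eq_single ⟨n, hn⟩]
  · simp [coordFun]
  · intro z _ hz
    rw [coordFun, if_neg fun h => hz (Fin.ext h), zero_mul]
  · simp

theorem rowIs_of_vecMul {r a b : ℕ} {ε : ℂ} (ha : a < 2 * r + 1) {M : Matrix (J r) (J r) ℂ}
    (h : Matrix.vecMul (coordFun r a) M = ε • coordFun r b) : RowIs M a b ε := by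
  intro x y hx
  have hx' : x = ⟨a, ha⟩ := Fin.ext hx
  rw [hx', ← vecMul_coordFun ha M, h]
  simp [coordFun]

section Rows

variable {r i a : ℕ} (t : ℂ)

theorem vecMul_xOne_special (hi : i < r) (h : a + 1 = i ∨ a + i = 2 * r) (hi1 : 1 ≤ i) :
    Matrix.vecMul (coordFun r a) (xOne r i t) = coordFun r a + t • coordFun r (a + 1) := by
  rw [vecMul_coordFun (by omega)]
  ext c
  rw [xOne_apply_of_lt hi]
  simp only [coordFun, Pi.add_apply, Pi.smul_apply, Fin.ext_iff]
  split_ifs <;> first | (exfalso; omega) | simp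

theorem vecMul_xOne_fixed (hi : i < r) (ha : a < 2 * r + 1) (h : a + 1 ≠ i) (h' : a + i ≠ 2 * r) :
    Matrix.vecMul (coordFun r a) (xOne r i t) = coordFun r a := by
  rw [vecMul_coordFun ha]
  ext c
  rw [xOne_apply_of_lt hi]
  simp only [coordFun, Fin.ext_iff]
  split_ifs <;> first | (exfalso; omega) | simp

theorem vecMul_yOne_special (hi : i < r) (h : a + 1 = i ∨ a + i = 2 * r) (hi1 : 1 ≤ i) :
    Matrix.vecMul (coordFun r (a + 1)) (yOne r i t) = coordFun r (a + 1) + t • coordFun r a := by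
  rw [vecMul_coordFun (by omega)]
  ext c
  rw [yOne_apply_of_lt hi]
  simp only [coordFun, Pi.add_apply, Pi.smul_apply, Fin.ext_iff]
  split_ifs <;> first | (exfalso; omega) | simp

theorem vecMul_yOne_fixed (hi : i < r) (ha : a < 2 * r + 1) (h : a ≠ i) (h' : a + i ≠ 2 * r + 1) :
    Matrix.vecMul (coordFun r a) (yOne r i t) = coordFun r a := by
  rw [vecMul_coordFun ha]
  ext c
  rw [yOne_apply_of_lt hi]
  simp only [coordFun, Fin.ext_iff]
  split_ifs <;> first | (exfalso; omega) | simp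

end Rows

/-- On the plane of the two adjacent letters `s̄_i` is a quarter turn; the sign `-1` falls on the
other row, see `rowIs_sBar_up`. -/
theorem rowIs_sBar_down {r i a : ℕ} (hi1 : 1 ≤ i) (hi : i < r)
    (h : a + 1 = i ∨ a + i = 2 * r) : RowIs (sBar r i) (a + 1) a 1 := by
  refine rowIs_of_vecMul (by omega) ?_
  rw [sBar, ← Matrix.vecMul_vecMul, ← Matrix.vecMul_vecMul,
    vecMul_xOne_fixed _ hi (by omega) (by omega) (by omega), vecMul_yOne_special _ hi h hi1,
    Matrix.add_vecMul, Matrix.smul_vecMul, vecMul_xOne_special _ hi h hi1,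
    vecMul_xOne_fixed _ hi (by omega) (by omega) (by omega)]
  module

theorem rowIs_sBar_up {r i a : ℕ} (hi1 : 1 ≤ i) (hi : i < r)
    (h : a + 1 = i ∨ a + i = 2 * r) : RowIs (sBar r i) a (a + 1) (-1) := by
  refine rowIs_of_vecMul (by omega) ?_
  rw [sBar, ← Matrix.vecMul_vecMul, ← Matrix.vecMul_vecMul,
    vecMul_xOne_special _ hi h hi1, Matrix.add_vecMul, Matrix.smul_vecMul,
    vecMul_yOne_special _ hi h hi1, vecMul_yOne_fixed _ hi (by omega) (by omega) (by omega),
    Matrix.add_vecMul, Matrix.smul_vecMul, Matrix.add_vecMul, Matrix.smul_vecMul,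
    vecMul_xOne_special _ hi h hi1, vecMul_xOne_fixed _ hi (by omega) (by omega) (by omega)]
  module

theorem rowIs_sBar_fixed {r i a : ℕ} (hi : i < r) (ha : a < 2 * r + 1)
    (h1 : a + 1 ≠ i) (h2 : a ≠ i) (h3 : a + i ≠ 2 * r) (h4 : a + i ≠ 2 * r + 1) :
    RowIs (sBar r i) a a 1 := by
  refine rowIs_of_vecMul ha ?_
  rw [sBar, ← Matrix.vecMul_vecMul, ← Matrix.vecMul_vecMul,
    vecMul_xOne_fixed _ hi ha h1 h3, vecMul_yOne_fixed _ hi ha h2 h4,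
    vecMul_xOne_fixed _ hi ha h1 h3, one_smul]

theorem rowIs_sBar_last_fixed {r a : ℕ} (ha : a < 2 * r + 1) (h : a + 1 < r ∨ r + 1 < a) :
    RowIs (sBar r r) a a 1 := by
  have hx : ∀ t, Matrix.vecMul (coordFun r a) (xOne r r t) = coordFun r a := by
    intro t
    rw [vecMul_coordFun ha]
    ext c
    rw [xOne_apply_of_le le_rfl]
    simp only [coordFun, Fin.ext_iff]
    split_ifs <;> first | (exfalso; omega) | simp
  have hy : ∀ t, Matrix.vecMul (coordFun r a) (yOne r r t) = coordFun r a := by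
    intro t
    rw [vecMul_coordFun ha]
    ext c
    rw [yOne_apply_of_le le_rfl]
    simp only [coordFun, Fin.ext_iff]
    split_ifs <;> first | (exfalso; omega) | simp
  refine rowIs_of_vecMul ha ?_
  rw [sBar, ← Matrix.vecMul_vecMul, ← Matrix.vecMul_vecMul, hx, hy, hx, one_smul]

/-- The contributions at `0` and `r̄` cancel, leaving `r`. The rows of `s̄_r` at `r` and `0` are not
met when rows are followed through the cycles. -/
theorem rowIs_sBar_last {s : ℕ} : RowIs (sBar (s + 1) (s + 1)) (s + 2) s 1 := by
  have h1 : ∀ t, Matrix.vecMul (coordFun (s + 1) (s + 2)) (xOne (s + 1) (s + 1) t) =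
      coordFun (s + 1) (s + 2) := by
    intro t
    rw [vecMul_coordFun (by omega)]
    ext c
    rw [xOne_apply_of_le le_rfl]
    simp only [coordFun, Fin.ext_iff]
    split_ifs <;> first | (exfalso; omega) | simp
  have h2 : Matrix.vecMul (coordFun (s + 1) (s + 2)) (yOne (s + 1) (s + 1) 1) =
      coordFun (s + 1) (s + 2) + (2 : ℂ) • coordFun (s + 1) (s + 1) + coordFun (s + 1) s := by
    rw [vecMul_coordFun (by omega)]
    ext c
    rw [yOne_apply_of_le le_rfl]
    simp only [coordFun, Fin.ext_iff, Pi.add_apply, Pi.smul_apply, and_true]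
    split_ifs <;> first | (exfalso; omega) | simp
  have h3 : Matrix.vecMul (coordFun (s + 1) (s + 1)) (xOne (s + 1) (s + 1) (-1)) =
      coordFun (s + 1) (s + 1) - coordFun (s + 1) (s + 2) := by
    rw [vecMul_coordFun (by omega)]
    ext c
    rw [xOne_apply_of_le le_rfl]
    simp only [coordFun, Fin.ext_iff, Pi.sub_apply, true_and]
    split_ifs <;> first | (exfalso; omega) | simp
  have h4 : Matrix.vecMul (coordFun (s + 1) s) (xOne (s + 1) (s + 1) (-1)) =
      coordFun (s + 1) s - (2 : ℂ) • coordFun (s + 1) (s + 1) + coordFun (s + 1) (s + 2) := by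
    rw [vecMul_coordFun (by omega)]
    ext c
    rw [xOne_apply_of_le le_rfl]
    simp only [coordFun, Fin.ext_iff, Pi.sub_apply, Pi.add_apply, Pi.smul_apply, true_and]
    split_ifs <;> first | (exfalso; omega) | simp
  refine rowIs_of_vecMul (by omega) ?_
  rw [sBar, ← Matrix.vecMul_vecMul, ← Matrix.vecMul_vecMul, h1, h2, Matrix.add_vecMul,
    Matrix.add_vecMul, Matrix.smul_vecMul, h1, h3, h4]
  module

theorem wBar_append (r : ℕ) (v w : List ℕ) : wBar r (v ++ w) = wBar r v * wBar r w := by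
  simp [wBar]

theorem wBar_range_succ (r j : ℕ) :
    wBar r ((List.range (j + 1)).map (· + 1)) =
      wBar r ((List.range j).map (· + 1)) * sBar r (j + 1) := by
  rw [List.range_succ, List.map_append, wBar_append]
  simp [wBar]

theorem rowIs_wBar_nil (r a : ℕ) : RowIs (wBar r []) a a 1 := by
  intro x y hx
  simp only [wBar, List.map_nil, List.prod_nil, Matrix.one_apply, Fin.ext_iff, hx, eq_comm]

/-- The row waits until the reflection exchanging its letter with the previous one, moves down once
and is fixed afterwards. -/
theorem rowIs_cycle_plain {r j a : ℕ} (hj : j ≤ r) (ha : 1 ≤ a) (har : a < r) :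
    RowIs (wBar r ((List.range j).map (· + 1))) a (if j < a then a else a - 1) 1 := by
  induction j with
  | zero =>
    rw [if_pos (by omega)]
    exact rowIs_wBar_nil r a
  | succ j ih =>
    rw [wBar_range_succ]
    have ih := ih (by omega)
    rw [← mul_one (1 : ℂ)]
    refine RowIs.mul (by split_ifs <;> omega) ih ?_
    rcases (by omega : j + 1 < a ∨ j + 1 = a ∨ (a < j + 1 ∧ j + 1 < r) ∨ j + 1 = r)
      with h | h | h | h
    · rw [if_pos (by omega), if_pos (by omega)]
      exact rowIs_sBar_fixed (by omega) (by omega) (by omega) (by omega) (by omega) (by omega)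
    · rw [if_pos (by omega), if_neg (by omega), ← h]
      exact rowIs_sBar_down (by omega) (by omega) (Or.inl rfl)
    · rw [if_neg (by omega), if_neg (by omega)]
      exact rowIs_sBar_fixed (by omega) (by omega) (by omega) (by omega) (by omega) (by omega)
    · rw [if_neg (by omega), if_neg (by omega), h]
      exact rowIs_sBar_last_fixed (by omega) (by omega)

/-- Barred rows also move once per cycle, but upwards, which costs the sign `-1`. -/
theorem rowIs_cycle_bar {r j a : ℕ} (hj : j ≤ r) (ha : r < a) (har : a < 2 * r) :
    RowIs (wBar r ((List.range j).map (· + 1))) a (if j + a < 2 * r then a else a + 1)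
      (if j + a < 2 * r then 1 else -1) := by
  induction j with
  | zero =>
    rw [if_pos (by omega), if_pos (by omega)]
    exact rowIs_wBar_nil r a
  | succ j ih =>
    rw [wBar_range_succ]
    have ih := ih (by omega)
    rcases (by omega : j + 1 + a < 2 * r ∨ j + 1 + a = 2 * r ∨ (2 * r < j + 1 + a ∧ j + 1 < r) ∨
      (j + 1 = r)) with h | h | h | h
    · rw [if_pos (by omega), if_pos (by omega)] at ih ⊢
      rw [← mul_one (1 : ℂ)]
      exact ih.mul (by omega)
        (rowIs_sBar_fixed (by omega) (by omega) (by omega) (by omega) (by omega) (by omega))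
    · rw [if_pos (by omega), if_pos (by omega)] at ih
      rw [if_neg (by omega), if_neg (by omega), ← one_mul (-1 : ℂ)]
      exact ih.mul (by omega) (rowIs_sBar_up (by omega) (by omega) (Or.inr (by omega)))
    · rw [if_neg (by omega), if_neg (by omega)] at ih ⊢
      rw [← mul_one (-1 : ℂ)]
      exact ih.mul (by omega)
        (rowIs_sBar_fixed (by omega) (by omega) (by omega) (by omega) (by omega) (by omega))
    · rw [if_neg (by omega), if_neg (by omega)] at ih ⊢
      rw [← mul_one (-1 : ℂ), h]
      exact ih.mul (by omega) (rowIs_sBar_last_fixed (by omega) (by omega))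

/-- The row of `1̄` is lowered by every reflection and finally crosses from `r̄` to `r`, without any
sign. -/
theorem rowIs_cycle_top {r : ℕ} (hr : 1 ≤ r) :
    RowIs (wBar r ((List.range r).map (· + 1))) (2 * r) (r - 1) 1 := by
  have key : ∀ j, j < r → RowIs (wBar r ((List.range j).map (· + 1))) (2 * r) (2 * r - j) 1 := by
    intro j hj
    induction j with
    | zero => exact rowIs_wBar_nil r _
    | succ j ih =>
      rw [wBar_range_succ, ← mul_one (1 : ℂ)]
      refine RowIs.mul (by omega) (ih (by omega)) ?_
      have := rowIs_sBar_down (r := r) (i := j + 1) (a := 2 * r - (j + 1)) (by omega) hj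
        (Or.inr (by omega))
      rwa [show 2 * r - (j + 1) + 1 = 2 * r - j by omega] at this
  obtain ⟨s, rfl⟩ : ∃ s, r = s + 1 := ⟨r - 1, by omega⟩
  rw [wBar_range_succ, ← mul_one (1 : ℂ)]
  refine RowIs.mul (by omega) (key s (by omega)) ?_
  rw [show 2 * (s + 1) - s = s + 2 by omega]
  exact rowIs_sBar_last

/-- `c` full cycles `1, …, r` followed by `1, …, d`. -/
def cycleWord (r c d : ℕ) : List ℕ :=
  (List.replicate c (List.range' 1 r)).flatten ++ List.range' 1 d

theorem range'_one (n : ℕ) : List.range' 1 n = (List.range n).map (· + 1) := by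
  rw [List.range_eq_range', List.map_congr_left fun x _ => Nat.add_comm x 1, List.map_add_range']

/-- The letter `u_{≤k}(b)`, where `u_{≤k}` consists of `c - 1` full cycles and a partial one. -/
def weylImage (r c b : ℕ) : ℕ := if b + c < r then b + c else 3 * r - b - c

/-- Induction peeling off the leftmost cycle. Only cycles spent among the barred letters contribute
a sign, whence the truncated exponent. -/
theorem rowIs_wBar_cycleWord {r c d b : ℕ} (hdr : d < r) (hb : b < d) (hc : c + 1 ≤ r) :
    RowIs (wBar r (cycleWord r c d)) (weylImage r (c + 1) b) b ((-1) ^ (b + (c + 1) - r)) := by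
  induction c with
  | zero =>
    have := rowIs_cycle_plain (r := r) (j := d) (a := b + 1) (by omega) (by omega) (by omega)
    rw [if_neg (by omega)] at this
    rw [weylImage, if_pos (by omega), show b + (0 + 1) - r = 0 by omega, pow_zero]
    simpa [cycleWord, range'_one] using this
  | succ c ih =>
    have ih := ih (by omega)
    have hw : cycleWord r (c + 1) d = (List.range r).map (· + 1) ++ cycleWord r c d := by
      simp [cycleWord, List.replicate_succ, range'_one]
    rw [hw, wBar_append]
    rcases (by omega : b + (c + 1 + 1) < r ∨ b + (c + 1 + 1) = r ∨ r < b + (c + 1 + 1))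
      with h | h | h
    · have h1 := rowIs_cycle_plain (r := r) (j := r) (a := b + (c + 1 + 1)) le_rfl (by omega) h
      rw [if_neg (by omega)] at h1
      rw [weylImage, if_pos (by omega)] at ih ⊢
      rw [show b + (c + 1 + 1) - r = 0 by omega, pow_zero, ← one_mul (1 : ℂ)]
      rw [show b + (c + 1) - r = 0 by omega, pow_zero] at ih
      exact RowIs.mul (by omega) h1 (by simpa using ih)
    · rw [weylImage, if_pos (by omega)] at ih
      rw [weylImage, if_neg (by omega), show 3 * r - b - (c + 1 + 1) = 2 * r by omega,
        show b + (c + 1 + 1) - r = 0 by omega, pow_zero, ← one_mul (1 : ℂ)]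
      rw [show b + (c + 1) - r = 0 by omega, pow_zero] at ih
      exact RowIs.mul (by omega) (rowIs_cycle_top (by omega))
        (by rwa [show r - 1 = b + (c + 1) by omega])
    · rw [weylImage, if_neg (by omega)] at ih ⊢
      have h1 := rowIs_cycle_bar (r := r) (j := r) (a := 3 * r - b - (c + 1 + 1)) le_rfl (by omega)
        (by omega)
      rw [if_neg (by omega), if_neg (by omega)] at h1
      rw [show b + (c + 1 + 1) - r = b + (c + 1) - r + 1 by omega, pow_succ,
        mul_comm _ (-1 : ℂ)]
      exact RowIs.mul (by omega) h1
        (by rwa [show 3 * r - b - (c + 1 + 1) + 1 = 3 * r - b - (c + 1) by omega])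

/-! ### The minor as a minor of a product of full cycles -/

theorem cycleWord_eq_map {r d : ℕ} (hdr : d < r) (c : ℕ) :
    cycleWord r c d = (List.range (c * r + d)).map fun q => q % r + 1 := by
  induction c with
  | zero =>
    simp only [cycleWord, List.replicate_zero, List.flatten_nil, List.nil_append, zero_mul,
      zero_add, range'_one]
    refine List.map_congr_left fun q hq => ?_
    rw [Nat.mod_eq_of_lt ((List.mem_range.1 hq).trans hdr)]
  | succ c ih =>
    have hw : cycleWord r (c + 1) d = (List.range r).map (· + 1) ++ cycleWord r c d := by
      simp [cycleWord, List.replicate_succ, range'_one]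
    rw [hw, ih, show (c + 1) * r + d = r + (c * r + d) by ring,
      List.range_add (n := r) (m := c * r + d), List.map_append, List.map_map]
    congr 1
    · refine List.map_congr_left fun q hq => ?_
      rw [Nat.mod_eq_of_lt (List.mem_range.1 hq)]
    · refine List.map_congr_left fun q _ => ?_
      simp

theorem word_eq_map {r m d : ℕ} (hdr : d < r) :
    word r m d = (List.range ((m - 1) * r + d)).map fun q => q % r + 1 :=
  cycleWord_eq_map hdr (m - 1)

theorem length_word {r m d : ℕ} (hdr : d < r) : (word r m d).length = (m - 1) * r + d := by
  rw [word_eq_map hdr, List.length_map, List.length_range]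

/-- The letter `d` occurs once in each cycle, so the cycle number determines the position. -/
theorem position_eq {r m d k m' : ℕ} (hdr : d < r)
    (hk : 1 ≤ k) (hkn : k ≤ (word r m d).length) (hkd : (word r m d).getD (k - 1) 0 = d)
    (hcycle : (m' - 1) * r < k ∧ k ≤ m' * r) :
    ∃ c, m' = c + 1 ∧ k = c * r + d ∧ c ≤ m - 1 := by
  rw [length_word hdr] at hkn
  rw [word_eq_map hdr, List.getD_eq_getElem _ _ (by simp; omega), List.getElem_map,
    List.getElem_range] at hkd
  obtain ⟨c, rfl⟩ : ∃ c, m' = c + 1 := by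
    rcases m' with _ | c
    · simp at hcycle
      omega
    · exact ⟨c, rfl⟩
  obtain ⟨h1, h2⟩ := hcycle
  rw [Nat.add_sub_cancel] at h1
  have h3 : (c + 1) * r = c * r + r := by ring
  obtain ⟨e, he⟩ : ∃ e, k - 1 = c * r + e := ⟨k - 1 - c * r, by omega⟩
  have he' : (k - 1) % r = e := by
    rw [he, mul_comm, Nat.mul_add_mod, Nat.mod_eq_of_lt (by omega)]
  refine ⟨c, rfl, by omega, ?_⟩
  by_contra hcon
  have : (m - 1 + 1) * r ≤ c * r := Nat.mul_le_mul_right r (by omega)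
  have h4 : (m - 1 + 1) * r = (m - 1) * r + r := by ring
  omega

theorem take_word {r m d c : ℕ} (hdr : d < r) (hc : c ≤ m - 1) :
    (word r m d).take (c * r + d) = cycleWord r c d := by
  have : c * r ≤ (m - 1) * r := Nat.mul_le_mul_right r hc
  rw [word_eq_map hdr, cycleWord_eq_map hdr, ← List.map_take, List.take_range, min_eq_left]
  omega

/-- The coordinate `Y_{s,l}` as a unit. -/
noncomputable def coordUnit (r : ℕ) {n : ℕ} (Y : Fin n → ℂˣ) (s l : ℕ) : ℂˣ :=
  if l = 0 ∨ l = r + 1 then 1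
  else if h : (s - 1) * r + (l - 1) < n then Y ⟨(s - 1) * r + (l - 1), h⟩
  else 1

theorem coe_coordUnit (r : ℕ) {n : ℕ} (Y : Fin n → ℂˣ) (s l : ℕ) :
    (coordUnit r Y s l : ℂ) = coord r Y s l := by
  unfold coordUnit coord
  split_ifs <;> rfl

theorem coord_ne_zero (r : ℕ) {n : ℕ} (Y : Fin n → ℂˣ) (s l : ℕ) : coord r Y s l ≠ 0 := by
  rw [← coe_coordUnit]
  exact Units.ne_zero _

theorem coord_zero (r : ℕ) {n : ℕ} (Y : Fin n → ℂˣ) (s : ℕ) : coord r Y s 0 = 1 := by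
  simp [coord]

/-- The factor number `q` of the product of full cycles. -/
noncomputable def factor (r : ℕ) {n : ℕ} (Y : Fin n → ℂˣ) (q : ℕ) : Matrix (J r) (J r) ℂ :=
  xMinus r (q % r + 1) (coordUnit r Y (q / r + 1) (q % r + 1))

theorem xL_eq {r m d : ℕ} (hdr : d < r) (Y : Fin (word r m d).length → ℂˣ) :
    xL r (word r m d) Y = ((List.range ((m - 1) * r + d)).map (factor r Y)).prod := by
  have hr : 0 < r := by omega
  rw [xL, ← length_word (m := m) hdr, ← List.map_coe_finRange_eq_range, List.map_map,
    List.ofFn_eq_map]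
  congr 1
  refine List.map_congr_left fun j _ => ?_
  have h1 : (word r m d).get j = j.val % r + 1 := by
    rw [List.get_eq_getElem, List.getElem_of_eq (word_eq_map hdr), List.getElem_map,
      List.getElem_range]
  have h2 : (j.val / r + 1 - 1) * r + (j.val % r + 1 - 1) = j.val := by
    simp only [Nat.add_sub_cancel]
    exact Nat.div_add_mod' _ _
  have h3 : coordUnit r Y (j.val / r + 1) (j.val % r + 1) = Y j := by
    have := Nat.mod_lt j.val hr
    rw [coordUnit, if_neg (by omega), dif_pos (by rw [h2]; exact j.2)]
    congr 1
    exact Fin.ext h2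
  rw [Function.comp_apply, factor, h1, h3]

/-- The matrix of the cycle number `s` (counted from `0`). -/
noncomputable def cycleMatrix (r : ℕ) {n : ℕ} (Y : Fin n → ℂˣ) (s : ℕ) : Matrix (J r) (J r) ℂ :=
  ((List.range r).map fun i => xMinus r (i + 1) (coordUnit r Y (s + 1) (i + 1))).prod

theorem prod_factor_range {r : ℕ} (hr : 1 ≤ r) {n : ℕ} (Y : Fin n → ℂˣ) (m : ℕ) :
    ((List.range (m * r)).map (factor r Y)).prod =
      ((List.range m).map (cycleMatrix r Y)).prod := by
  induction m with
  | zero => simp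
  | succ m ih =>
    rw [List.range_succ, List.map_append, List.prod_append, ← ih, show (m + 1) * r = m * r + r by
      ring, List.range_add, List.map_append, List.prod_append, List.map_map, List.map_singleton,
      List.prod_singleton, cycleMatrix]
    congr 2
    refine List.map_congr_left fun q hq => ?_
    have hq := List.mem_range.1 hq
    have h1 : (m * r + q) % r = q := by
      rw [mul_comm, Nat.mul_add_mod, Nat.mod_eq_of_lt hq]
    have h2 : (m * r + q) / r = m := by
      rw [mul_comm, Nat.mul_add_div hr, Nat.div_eq_of_lt hq, add_zero]
    rw [Function.comp_apply, factor, h1, h2]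

/-- The product of the last `n` of `m` cycles. -/
noncomputable def tailProduct (r m : ℕ) {N : ℕ} (Y : Fin N → ℂˣ) : ℕ → Matrix (J r) (J r) ℂ
  | 0 => 1
  | n + 1 => cycleMatrix r Y (m - 1 - n) * tailProduct r m Y n

theorem prod_cycleMatrix (r m : ℕ) {N : ℕ} (Y : Fin N → ℂˣ) :
    ((List.range m).map (cycleMatrix r Y)).prod = tailProduct r m Y m := by
  have key : ∀ n, n ≤ m → ((List.range (m - n)).map (cycleMatrix r Y)).prod * tailProduct r m Y n
      = ((List.range m).map (cycleMatrix r Y)).prod := by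
    intro n hn
    induction n with
    | zero => simp [tailProduct]
    | succ n ih =>
      rw [← ih (by omega), show m - n = m - (n + 1) + 1 by omega, List.range_succ, List.map_append,
        List.prod_append, List.map_singleton, List.prod_singleton, tailProduct, Matrix.mul_assoc,
        show m - 1 - n = m - (n + 1) by omega]
  have := key m le_rfl
  rw [← this]
  simp

theorem factor_column {r m d : ℕ} (hdr : d < r) {n : ℕ} (hn : n = (m - 1) * r + d)
    (Y : Fin n → ℂˣ) {j : ℕ} (hj : j < r - d) (a b : J r) (hb : b.val < d) :
    factor r Y ((m - 1) * r + d + j) a b = if a = b then 1 else 0 := by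
  have hr : 0 < r := by omega
  have h1 : ((m - 1) * r + d + j) % r = d + j := by
    rw [mul_comm, add_assoc, Nat.mul_add_mod, Nat.mod_eq_of_lt (by omega)]
  have h2 : ((m - 1) * r + d + j) / r = m - 1 := by
    rw [mul_comm, add_assoc, Nat.mul_add_div hr, Nat.div_eq_of_lt (by omega), add_zero]
  -- Positions past the end of the word take the default value `1`; the missing factors of the last
  -- cycle are thus `x_{-j}(1)` with `j > d`.
  have h3 : coordUnit r Y (m - 1 + 1) (d + j + 1) = 1 := by
    rw [coordUnit, if_neg (by omega), dif_neg]
    rw [hn]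
    simp only [Nat.add_sub_cancel]
    omega
  rw [factor, h1, h2, h3]
  rcases (by omega : d + j + 1 < r ∨ d + j + 1 = r) with h | h
  · rw [xMinus_apply_of_lt h]
    split_ifs <;> first | rfl | (exfalso; omega)
  · rw [h, xMinus_apply_of_eq]
    split_ifs <;> first | rfl | (exfalso; omega)

theorem prod_factor_column {r m d : ℕ} (hdr : d < r) {n : ℕ} (hn : n = (m - 1) * r + d)
    (Y : Fin n → ℂˣ) {j : ℕ} (hj : j ≤ r - d) (A : Matrix (J r) (J r) ℂ) (a b : J r)
    (hb : b.val < d) :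
    (A * ((List.range j).map fun i => factor r Y ((m - 1) * r + d + i)).prod) a b = A a b := by
  induction j generalizing A with
  | zero => simp
  | succ j ih =>
    rw [List.range_succ, List.map_append, List.prod_append, ← Matrix.mul_assoc, List.map_singleton,
      List.prod_singleton, Matrix.mul_apply, Finset.sum_eq_single b]
    · rw [factor_column hdr hn Y (by omega) b b hb, if_pos rfl, mul_one, ih (by omega)]
    · intro c _ hc
      rw [factor_column hdr hn Y (by omega) c b hb, if_neg hc, mul_zero]
    · simp

/-- The factors completing the last cycle have index `j > d` and act on the right, hence fix the
first `d` columns. -/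
theorem tailProduct_column {r m d : ℕ} (hm : 1 ≤ m) (hdr : d < r)
    (Y : Fin (word r m d).length → ℂˣ) (a b : J r) (hb : b.val < d) :
    tailProduct r m Y m a b = xL r (word r m d) Y a b := by
  have hn := length_word (m := m) hdr
  have hmr : m * r = (m - 1) * r + d + (r - d) := by
    obtain ⟨c, rfl⟩ : ∃ c, m = c + 1 := ⟨m - 1, by omega⟩
    rw [Nat.add_sub_cancel, add_mul]
    omega
  rw [← prod_cycleMatrix, ← prod_factor_range (by omega), hmr, List.range_add, List.map_append,
    List.prod_append, List.map_map, ← xL_eq hdr]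
  have := prod_factor_column hdr hn Y le_rfl (xL r (word r m d) Y) a b hb
  rw [← this]
  rfl

/-! ### The sign -/

/-- The letters of `u_{≤k}{1, …, d}` in increasing order. -/
def target (r c d i : ℕ) : ℕ := if i + c < r then i + c else 2 * r + 1 + i - d

/-- The reversal of `{u, …, d - 1}`. -/
def tailRev (d u : ℕ) : Equiv.Perm (Fin d) :=
  Function.Involutive.toPerm
    (fun i => if h : u ≤ i.val then ⟨u + (d - 1) - i.val, by omega⟩ else i) (by
      intro i
      dsimp only
      split_ifs with h1 h2
      · ext
        dsimp only
        omega
      · dsimp only at h2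
        omega
      · rfl)

theorem tailRev_val (d u : ℕ) (i : Fin d) :
    (tailRev d u i).val = if u ≤ i.val then u + (d - 1) - i.val else i.val := by
  show (dite _ _ _ : Fin d).val = _
  split_ifs <;> rfl

/-- For a fixed larger index `j`, the inverted pairs are those with smaller index in `[u, j)`; for
`j < u` the truncated exponent is `0`. -/
theorem sign_tailRev (d u : ℕ) :
    ((Equiv.Perm.sign (tailRev d u) : ℤˣ) : ℤ) = ∏ j : Fin d, (-1) ^ (j.val - u) := by
  rw [Equiv.Perm.sign_eq_prod_prod_Iio, Units.coe_prod]
  refine Finset.prod_congr rfl fun j _ => ?_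
  rw [Units.coe_prod]
  have : ∀ i ∈ Finset.Iio j, (((if tailRev d u i < tailRev d u j then 1 else -1 : ℤˣ)) : ℤ) =
      if u ≤ i.val then -1 else 1 := by
    intro i hi
    have hij : i < j := Finset.mem_Iio.1 hi
    rw [Fin.lt_def] at hij
    have h2 := j.2
    simp only [Fin.lt_def, tailRev_val]
    split_ifs <;> first | rfl | (exfalso; omega)
  rw [Finset.prod_congr rfl this, Finset.prod_ite, Finset.prod_const, Finset.prod_const_one,
    mul_one]
  congr 1
  rw [← Nat.card_Ico, ← Finset.card_map Fin.valEmbedding]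
  congr 1
  ext x
  simp only [Finset.mem_map, Finset.mem_filter, Finset.mem_Iio, Fin.valEmbedding_apply,
    Finset.mem_Ico]
  constructor
  · rintro ⟨i, ⟨h1, h2⟩, rfl⟩
    exact ⟨h2, h1⟩
  · rintro ⟨h1, h2⟩
    exact ⟨⟨x, h2.trans j.2⟩, ⟨h2, h1⟩, rfl⟩

/-- Row `i` of `w̄⁻¹ x` is, up to sign, the row of `x` at the letter `u_{≤k}(i)`. These letters
increase while unbarred and decrease while barred, so sorting them reverses a tail; its sign equals
the product of the row signs. -/
theorem DeltaL_eq_det {r m d k m' : ℕ} (hm : 1 ≤ m) (hmr : m ≤ r) (hdr : d < r)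
    (hk : 1 ≤ k) (hkn : k ≤ (word r m d).length) (hkd : (word r m d).getD (k - 1) 0 = d)
    (hcycle : (m' - 1) * r < k ∧ k ≤ m' * r) (Y : Fin (word r m d).length → ℂˣ)
    (a b : Fin d → J r) (ha : ∀ i, (a i).val = target r m' d i) (hb : ∀ i, (b i).val = i.val) :
    DeltaL r (word r m d) k Y = ((tailProduct r m Y m).submatrix a b).det := by
  obtain ⟨c, rfl, rfl, hc⟩ := position_eq hdr hk hkn hkd hcycle
  have hd' : d ≤ 2 * r + 1 := by omega
  set x := xL r (word r m d) Y with hx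
  set w := cycleWord r c d with hw
  have hxm : x ∈ SO r ∧ x ∈ bigCellClosure r := by
    have := list_prod_xMinus_mem r ((List.range ((m - 1) * r + d)).map fun q =>
      (q % r + 1, coordUnit r Y (q / r + 1) (q % r + 1)))
    rw [List.map_map] at this
    rw [hx, xL_eq hdr]
    exact this
  have hdet : IsUnit (wBar r w).det := (Matrix.isUnit_iff_isUnit_det _).1 (isUnit_wBar r w)
  have hrow : leading hd' ((wBar r w)⁻¹ * x) = Matrix.of fun i j =>
      ((-1 : ℂ) ^ (i.val - (r - (c + 1)))) *
        ((tailProduct r m Y m).submatrix a b).submatrix (tailRev d (r - (c + 1))) id i j := by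
    ext i j
    simp only [Matrix.of_apply, Matrix.submatrix_apply, id]
    rw [tailProduct_column hm hdr Y _ _ (by rw [hb]; exact j.2), ← hx]
    have hbj : b j = Fin.castLE hd' j := Fin.ext (hb j)
    have h1 := rowIs_wBar_cycleWord (b := i) hdr i.2 (by omega : c + 1 ≤ r)
    have h2 : (a (tailRev d (r - (c + 1)) i)).val = weylImage r (c + 1) i := by
      rw [ha, target, tailRev_val, weylImage]
      have := i.2
      split_ifs <;> omega
    have h3 : x = wBar r w * ((wBar r w)⁻¹ * x) := by
      rw [← Matrix.mul_assoc, Matrix.mul_nonsing_inv _ hdet, Matrix.one_mul]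
    have h4 : ∀ z : Matrix (J r) (J r) ℂ, (wBar r w * z) (a (tailRev d (r - (c + 1)) i)) (b j) =
        (-1) ^ (i.val + (c + 1) - r) * z (Fin.castLE hd' i) (Fin.castLE hd' j) := by
      intro z
      rw [Matrix.mul_apply, Finset.sum_eq_single (Fin.castLE hd' i), h1 _ _ h2, hbj,
        if_pos (Fin.val_castLE hd' i)]
      · intro y _ hy
        rw [h1 _ _ h2, if_neg fun h : y.val = i.val => hy (Fin.ext h), zero_mul]
      · simp
    conv_rhs => rw [h3]
    rw [h4, ← mul_assoc, show i.val + (c + 1) - r = i.val - (r - (c + 1)) by omega, ← mul_pow]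
    simp
  rw [DeltaL, hkd, take_word hdr hc, genMinor_eq_det hd' _ hxm.1 hxm.2, hrow, Matrix.det_mul_column,
    Matrix.det_permute]
  -- The sign of the reversal and the row signs are the same product of powers of `-1`, so together
  -- they give squares.
  have hs := congrArg (fun z : ℤ => (z : ℂ)) (sign_tailRev d (r - (c + 1)))
  rw [hs]
  push_cast
  rw [← mul_assoc, ← Finset.prod_mul_distrib]
  simp [← mul_pow]

/-! ### Trajectories of one particle and the sequence of its rests -/

/-- A trajectory starting at `i`: a weakly increasing sequence moving by at most one letter as long
as it has not left the unbarred letters. -/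
structure Trajectory (r i : ℕ) (p : ℕ → ℕ) : Prop where
  lt : i < r
  start : p 0 = i
  mono : Monotone p
  step : ∀ t, p t + 1 < r → p (t + 1) ≤ p t + 1

/-- The number of rests of a trajectory before time `t`; once the unbarred letters have been left,
every time counts as a rest. -/
def rests (r i : ℕ) (p : ℕ → ℕ) (t : ℕ) : ℕ := t + i - min (p t) r

/-- The time of the `s`-th rest. -/
noncomputable def restTime (r i : ℕ) (p : ℕ → ℕ) (s : ℕ) : ℕ := sInf {t | s < rests r i p (t + 1)}

namespace Trajectory

variable {r i : ℕ} {p : ℕ → ℕ} (h : Trajectory r i p)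
include h

theorem cap_succ_le (t : ℕ) : min (p (t + 1)) r ≤ min (p t) r + 1 := by
  have h1 := h.step t
  omega

theorem cap_le_cap_succ (t : ℕ) : min (p t) r ≤ min (p (t + 1)) r := by
  have h1 := h.mono (Nat.le_succ t)
  simp only [Nat.succ_eq_add_one] at h1
  omega

theorem cap_le (t : ℕ) : min (p t) r ≤ t + i := by
  induction t with
  | zero =>
    have := h.start
    omega
  | succ t ih =>
    have := h.cap_succ_le t
    omega

/-- The truncation in `rests` is harmless because the capped position grows by at most one per step.
Knowing any two of time, capped letter and number of rests determines the third. -/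
theorem rests_add (t : ℕ) : rests r i p t + min (p t) r = t + i :=
  Nat.sub_add_cancel (h.cap_le t)

theorem rests_zero : rests r i p 0 = 0 := by
  have h1 := h.rests_add 0
  have h2 := h.start
  have h3 := h.lt
  omega

theorem rests_succ (t : ℕ) : (rests r i p (t + 1) = rests r i p t + 1 ∧
      min (p (t + 1)) r = min (p t) r) ∨
    (rests r i p (t + 1) = rests r i p t ∧ min (p (t + 1)) r = min (p t) r + 1) := by
  have h1 := h.rests_add t
  have h2 := h.rests_add (t + 1)
  have h3 := h.cap_succ_le t
  have h4 := h.cap_le_cap_succ t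
  omega

theorem rests_mono : Monotone (rests r i p) :=
  monotone_nat_of_le_succ fun t => by
    have := h.rests_succ t
    omega

theorem restTime_mem (s : ℕ) : s < rests r i p (restTime r i p s + 1) := by
  -- By time `s + r + 1` more than `s` rests have occurred, since the capped position never exceeds
  -- `r`.
  refine Nat.sInf_mem (s := {t | s < rests r i p (t + 1)}) ⟨s + r, ?_⟩
  have h1 := h.rests_add (s + r + 1)
  show s < rests r i p (s + r + 1)
  omega

theorem rests_restTime (s : ℕ) : rests r i p (restTime r i p s) = s := by
  have h1 := h.restTime_mem s
  have h2 := h.rests_succ (restTime r i p s)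
  have h3 : rests r i p (restTime r i p s) ≤ s := by
    rcases Nat.eq_zero_or_pos (restTime r i p s) with h0 | h0
    · rw [h0, h.rests_zero]
      exact Nat.zero_le s
    · have h4 : restTime r i p s - 1 ∉ {t | s < rests r i p (t + 1)} :=
        Nat.notMem_of_lt_sInf (Nat.sub_lt h0 one_pos)
      have h5 : ¬ s < rests r i p (restTime r i p s - 1 + 1) := h4
      rw [Nat.sub_add_cancel h0] at h5
      omega
  omega

theorem restTime_succ_cap (s : ℕ) :
    min (p (restTime r i p s + 1)) r = min (p (restTime r i p s)) r := by
  have h1 := h.restTime_mem s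
  have h2 := h.rests_succ (restTime r i p s)
  have h3 := h.rests_restTime s
  omega

theorem restTime_add (s : ℕ) : restTime r i p s + i = min (p (restTime r i p s)) r + s := by
  have h1 := h.rests_restTime s
  have h2 := h.rests_add (restTime r i p s)
  omega

theorem restTime_eq {s t : ℕ} (h1 : rests r i p t = s)
    (h2 : min (p (t + 1)) r = min (p t) r) : restTime r i p s = t := by
  have h3 := h.rests_succ t
  have h4 := h.restTime_mem s
  have h5 := h.rests_restTime s
  rcases lt_trichotomy (restTime r i p s) t with h6 | h6 | h6
  · have := h.rests_mono (Nat.succ_le_of_lt h6)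
    simp only [Nat.succ_eq_add_one] at this
    omega
  · exact h6
  · have := h.rests_mono (Nat.succ_le_of_lt h6)
    simp only [Nat.succ_eq_add_one] at this
    omega

/-- From `r` on every time is a rest, so the rest number is a fixed shift of time depending on the
particle. -/
theorem restTime_eq_of_le {t : ℕ} (ht : r ≤ p t) : restTime r i p (t + i - r) = t := by
  have h1 := h.rests_add t
  have h2 := h.cap_le_cap_succ t
  exact h.restTime_eq (by omega) (by omega)

theorem restTime_strictMono : StrictMono (restTime r i p) :=
  strictMono_nat_of_lt_succ fun s => by
    by_contra hcon
    have h1 := h.rests_mono (not_lt.1 hcon)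
    rw [h.rests_restTime, h.rests_restTime] at h1
    omega

theorem le_restTime {s t : ℕ} (ht : rests r i p t ≤ s) : t ≤ restTime r i p s := by
  by_contra hcon
  have h1 := h.rests_mono (Nat.succ_le_of_lt (not_le.1 hcon))
  have h2 := h.restTime_mem s
  simp only [Nat.succ_eq_add_one] at h1
  omega

theorem prod_rests {M : Type*} [CommMonoid M] (f : ℕ → M) (n : ℕ) :
    (∏ t ∈ Finset.range n, if min (p (t + 1)) r = min (p t) r then f t else 1) =
      ∏ s ∈ Finset.range (rests r i p n), f (restTime r i p s) := by
  induction n with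
  | zero => simp [h.rests_zero]
  | succ n ih =>
    rw [Finset.prod_range_succ, ih]
    rcases h.rests_succ n with ⟨h1, h2⟩ | ⟨h1, h2⟩
    · rw [if_pos h2, h1, Finset.prod_range_succ, h.restTime_eq rfl h2]
    · rw [if_neg (by omega), h1, mul_one]

end Trajectory

/-- A sequence of positions of rests of a trajectory starting at `i`. -/
structure RestSequence (r i : ℕ) (k : ℕ → ℕ) : Prop where
  lt : i < r
  le : i ≤ k 0
  mono : Monotone k

/-- The number of rests before time `t`. -/
noncomputable def restCount (r i : ℕ) (k : ℕ → ℕ) (t : ℕ) : ℕ := sInf {s | t + i ≤ min (k s) r + s}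

/-- The trajectory with a given sequence of rests. -/
noncomputable def trajectoryOf (r i : ℕ) (k : ℕ → ℕ) (t : ℕ) : ℕ :=
  if i + t - restCount r i k t < r then i + t - restCount r i k t else k (restCount r i k t)

namespace RestSequence

variable {r i : ℕ} {k : ℕ → ℕ} (h : RestSequence r i k)
include h

theorem restCount_mem (t : ℕ) :
    t + i ≤ min (k (restCount r i k t)) r + restCount r i k t := by
  refine Nat.sInf_mem (s := {s | t + i ≤ min (k s) r + s}) ⟨t, ?_⟩
  have h1 := h.mono (Nat.zero_le t)
  have h2 := h.le
  have h3 := h.lt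
  show t + i ≤ min (k t) r + t
  omega

omit h in
theorem restCount_le {s t : ℕ} (hs : t + i ≤ min (k s) r + s) : restCount r i k t ≤ s :=
  Nat.sInf_le hs

omit h in
theorem lt_of_lt_restCount {s t : ℕ} (hs : s < restCount r i k t) : min (k s) r + s < t + i :=
  not_le.1 (show ¬ t + i ≤ min (k s) r + s from
    Nat.notMem_of_lt_sInf (s := {s | t + i ≤ min (k s) r + s}) hs)

omit h in
theorem restCount_le_self (t : ℕ) : restCount r i k t ≤ t + i := by
  refine restCount_le ?_
  omega

theorem cap_trajectoryOf (t : ℕ) :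
    min (trajectoryOf r i k t) r + restCount r i k t = t + i := by
  have h1 := h.restCount_mem t
  have h2 := restCount_le_self (r := r) (i := i) (k := k) t
  rw [trajectoryOf]
  split_ifs <;> omega

/-- Either the next prescribed rest is due at time `t`, and then the position is the prescribed
letter, or the particle moves on and is still unbarred. -/
theorem restCount_succ (t : ℕ) :
    (restCount r i k (t + 1) = restCount r i k t + 1 ∧
      trajectoryOf r i k t = k (restCount r i k t) ∧
      min (k (restCount r i k t)) r + restCount r i k t = t + i) ∨
    (restCount r i k (t + 1) = restCount r i k t ∧ trajectoryOf r i k t < r) := by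
  have h1 := h.restCount_mem t
  have h2 := h.cap_trajectoryOf t
  have h3 := h.mono (Nat.le_succ (restCount r i k t))
  simp only [Nat.succ_eq_add_one] at h3
  have h4 : restCount r i k (t + 1) ≤ restCount r i k t + 1 := restCount_le (by omega)
  have h5 : restCount r i k t ≤ restCount r i k (t + 1) := restCount_le (by
    have := h.restCount_mem (t + 1)
    omega)
  have h6 := h.restCount_mem (t + 1)
  rcases (by omega : restCount r i k (t + 1) = restCount r i k t + 1 ∨
    restCount r i k (t + 1) = restCount r i k t) with h7 | h7
  · left
    have h8 := lt_of_lt_restCount (r := r) (i := i) (k := k) (s := restCount r i k t)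
      (t := t + 1) (by omega)
    refine ⟨h7, ?_, by omega⟩
    rw [trajectoryOf]
    split_ifs <;> omega
  · right
    refine ⟨h7, ?_⟩
    rw [h7] at h6
    omega

theorem trajectory : Trajectory r i (trajectoryOf r i k) where
  lt := h.lt
  start := by
    have h0 : restCount r i k 0 = 0 := by
      have h1 := h.le
      have h2 := h.lt
      have : restCount r i k 0 ≤ 0 := restCount_le (by omega)
      omega
    have := h.lt
    rw [trajectoryOf, h0, if_pos (by omega)]
    omega
  mono := monotone_nat_of_le_succ fun t => by
    have h1 := h.cap_trajectoryOf t
    have h2 := h.cap_trajectoryOf (t + 1)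
    rcases h.restCount_succ t with ⟨h3, h4, h5⟩ | ⟨h3, h4⟩
    · by_cases h6 : i + (t + 1) - restCount r i k (t + 1) < r
      · rw [h4]
        omega
      · have h7 : trajectoryOf r i k (t + 1) = k (restCount r i k (t + 1)) := by
          rw [trajectoryOf, if_neg h6]
        rw [h4, h7, h3]
        exact h.mono (Nat.le_succ _)
    · omega
  step t := by
    have h1 := h.cap_trajectoryOf t
    have h2 := h.cap_trajectoryOf (t + 1)
    have h3 := h.restCount_succ t
    omega

theorem rests_trajectoryOf (t : ℕ) : rests r i (trajectoryOf r i k) t = restCount r i k t := by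
  have h1 := h.trajectory.rests_add t
  have h2 := h.cap_trajectoryOf t
  omega

theorem trajectoryOf_of_le {t : ℕ} (ht : r ≤ trajectoryOf r i k t) :
    trajectoryOf r i k t = k (t + i - r) := by
  have h2 := h.cap_trajectoryOf t
  rw [trajectoryOf, if_neg (by omega)]
  congr 1
  omega

theorem trajectoryOf_restTime (s : ℕ) :
    trajectoryOf r i k (restTime r i (trajectoryOf r i k) s) = k s := by
  have h1 := h.trajectory.restTime_mem s
  have h2 := h.trajectory.rests_restTime s
  rw [h.rests_trajectoryOf] at h1 h2
  rcases h.restCount_succ (restTime r i (trajectoryOf r i k) s) with ⟨_, h4, _⟩ | ⟨h3, _⟩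
  · rw [h4, h2]
  · omega

end RestSequence

/-- The positions of the rests of a trajectory. -/
noncomputable def restsOf (r i : ℕ) (p : ℕ → ℕ) (s : ℕ) : ℕ := p (restTime r i p s)

theorem Trajectory.restSequence {r i : ℕ} {p : ℕ → ℕ} (h : Trajectory r i p) :
    RestSequence r i (restsOf r i p) where
  lt := h.lt
  le := by
    have := h.mono (Nat.zero_le (restTime r i p 0))
    rwa [h.start] at this
  mono := h.mono.comp h.restTime_strictMono.monotone

/-- Rests before `t` occur at lower counts and the next one not before `t`, so the count
reconstructed from the positions equals the true one; capped position and, beyond `r`, the letter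
itself follow. -/
theorem Trajectory.trajectoryOf_restsOf {r i : ℕ} {p : ℕ → ℕ} (h : Trajectory r i p) (t : ℕ) :
    trajectoryOf r i (restsOf r i p) t = p t := by
  have h1 := h.rests_add t
  have hcount : restCount r i (restsOf r i p) t = rests r i p t := by
    refine le_antisymm (RestSequence.restCount_le ?_) ?_
    · have h2 := h.mono (h.le_restTime (le_refl (rests r i p t)))
      rw [restsOf]
      omega
    · by_contra hcon
      have h2 := h.restSequence.restCount_mem t
      set s := restCount r i (restsOf r i p) t with hs
      have h3 := h.restTime_add s
      rw [restsOf] at h2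
      have h4 : t ≤ restTime r i p s := by omega
      have h5 := h.rests_mono h4
      rw [h.rests_restTime] at h5
      omega
  rw [trajectoryOf, hcount]
  split_ifs with h2
  · omega
  · have h3 : r ≤ p t := by omega
    have h4 := h.restTime_eq_of_le h3
    rw [restsOf, show rests r i p t = t + i - r by omega, h4]

/-! ### Families of trajectories and arrays of rests -/

/-- The final positions of a family of `d` particles starting at `0, …, d - 1` and reaching the letters
`T 0 < ⋯ < T (d - 1)` at time `m`; the letter `T i` is `i + c` if this is unbarred, and otherwise
barred, in which case the next letters `T (i + 1), …` are consecutive. -/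
structure IsTarget (r d c : ℕ) (T : ℕ → ℕ) : Prop where
  lt : d < r
  le : c ≤ r
  plain : ∀ i, i + c < r → T i = i + c
  bar : ∀ i, r ≤ i + c → i < d → r < T i
  succ : ∀ i, r ≤ i + c → i + 1 < d → T (i + 1) = T i + 1

theorem isTarget_target {r d c : ℕ} (hdr : d < r) (hc : c ≤ r) : IsTarget r d c (target r c d) where
  lt := hdr
  le := hc
  plain i hi := if_pos hi
  bar i hi hid := by
    rw [target, if_neg (by omega)]
    omega
  succ i hi hid := by
    rw [target, target, if_neg (by omega), if_neg (by omega)]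
    omega

/-- A family of trajectories of `d` particles, where `P t i` is the position of the particle
number `i` at time `t`, contributing to a minor of a product of `m` full cycles. -/
structure IsPath (r d m : ℕ) (T : ℕ → ℕ) (P : ℕ → ℕ → ℕ) : Prop where
  start : ∀ i < d, P 0 i = i
  final : ∀ t i, m ≤ t → i < d → P t i = T i
  mono : ∀ t, ∀ i < d, P t i ≤ P (t + 1) i
  step : ∀ t, ∀ i < d, P t i + 1 < r → P (t + 1) i ≤ P t i + 1
  strict : ∀ t i, i + 1 < d → P t i < P t (i + 1)
  cross : ∀ t i, i + 1 < d →
    P (t + 1) i < P t (i + 1) ∨ (P (t + 1) i = P t (i + 1) ∧ P t (i + 1) ≤ r)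

/-- The array with columns `K · i` for `i < d`, continued by the letters `T i` from the row number
`p` on, satisfies the conditions `Admissible`. -/
structure IsArray (r d p : ℕ) (T : ℕ → ℕ) (K : ℕ → ℕ → ℕ) : Prop where
  start : ∀ i < d, i ≤ K 0 i
  final : ∀ s i, p ≤ s → i < d → K s i = T i
  mono : ∀ s, ∀ i < d, K s i ≤ K (s + 1) i
  row : ∀ s i, i + 1 < d → K s i < K s (i + 1) ∨ (K s i = r ∧ K s (i + 1) = r)
  diag : ∀ s i, i + 1 < d → K s i < K (s + 1) (i + 1)

/-- The rests of a family of trajectories. -/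
noncomputable def arrayOf (r : ℕ) (P : ℕ → ℕ → ℕ) (s i : ℕ) : ℕ := restsOf r i (fun t => P t i) s

/-- The family of trajectories with given rests. -/
noncomputable def pathOf (r : ℕ) (K : ℕ → ℕ → ℕ) (t i : ℕ) : ℕ :=
  trajectoryOf r i (fun s => K s i) t

namespace IsPath

variable {r d c m i : ℕ} {T : ℕ → ℕ} {P : ℕ → ℕ → ℕ} (hT : IsTarget r d c T) (h : IsPath r d m T P)

include hT h in
theorem trajectory (hi : i < d) : Trajectory r i fun t => P t i where
  lt := hi.trans hT.lt
  start := h.start i hi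
  mono := monotone_nat_of_le_succ fun t => h.mono t i hi
  step t := h.step t i hi

include hT h in
theorem le_target (hi : i < d) (t : ℕ) : P t i ≤ T i := by
  rw [← h.final (m + t) i (by omega) hi]
  exact (h.trajectory hT hi).mono (by omega)

-- A barred destination freezes a particle early. When the left neighbour is at its target at time
-- `t + 1`, the crossing rule puts particle `i` strictly beyond that letter at time `t`, hence at
-- its own target since targets there are consecutive.
include hT h in
theorem eq_target {t : ℕ} (hi : i < d) (hb : r ≤ i + c) (ht : m + r ≤ t + i + c) : P t i = T i := by
  obtain ⟨j, hj⟩ : ∃ j, m ≤ t + j := ⟨m, by omega⟩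
  induction j generalizing t i with
  | zero => exact h.final t i (by omega) hi
  | succ j ih =>
    by_cases htm : m ≤ t
    · exact h.final t i htm hi
    obtain ⟨e, rfl⟩ : ∃ e, i = e + 1 := ⟨i - 1, by have := hT.le; omega⟩
    have h1 := ih (t := t + 1) (i := e) (by omega) (by omega) (by omega) (by omega)
    have h2 := h.cross t e hi
    have h3 := hT.succ e (by omega) hi
    have h4 := hT.bar e (by omega) (by omega)
    have h5 := h.le_target hT hi t
    omega

include hT h in
theorem rests_final (hcm : c ≤ m) (hi : i < d) :
    rests r i (fun t => P t i) m = if i + c < r then m - c else m + i - r := by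
  have h1 := (h.trajectory hT hi).rests_add m
  have h2 := h.final m i le_rfl hi
  split_ifs with h3
  · have := hT.plain i h3
    omega
  · have := hT.bar i (by omega) hi
    omega

-- The row condition compares rests with equal number, which beyond `r` occur one time step apart
-- and are governed by `cross`; the diagonal condition compares rests at equal times there and is
-- governed by `strict`.
include hT h in
theorem isArray (hcm : c ≤ m) : IsArray r d (m - c) T (arrayOf r P) where
  start i hi := (h.trajectory hT hi).restSequence.le
  mono s i hi := (h.trajectory hT hi).restSequence.mono (Nat.le_succ s)
  final s i hs hi := by
    have h1 := h.rests_final hT hcm hi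
    have htr := h.trajectory hT hi
    rw [arrayOf, restsOf]
    by_cases h3 : i + c < r
    · rw [if_pos h3] at h1
      exact h.final _ i (htr.le_restTime (by omega)) hi
    · have hm : m - (i + c - r) ≤ restTime r i (fun t => P t i) s := by
        refine htr.le_restTime ?_
        have h4 := htr.rests_add (m - (i + c - r))
        have hlt := hT.lt
        by_cases hmi : i + c ≤ m + r
        · rw [h.eq_target hT hi (by omega) (by omega : m + r ≤ m - (i + c - r) + i + c)] at h4
          have := hT.bar i (by omega) hi
          omega
        · omega
      exact h.eq_target hT hi (by omega) (by omega)
  row s i hi := by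
    have ha := h.trajectory hT (i := i) (by omega)
    have hb := h.trajectory hT hi
    rw [arrayOf, arrayOf, restsOf, restsOf]
    have h1 := ha.restTime_add s
    have h2 := hb.restTime_add s
    have h5 := ha.rests_restTime s
    have h6 := hb.restTime_succ_cap s
    set t := restTime r i (fun t => P t i) s
    set t' := restTime r (i + 1) (fun t => P t (i + 1)) s
    by_cases hc' : P t' (i + 1) < r
    · left
      -- Otherwise the left particle makes its rest number `s` after time `t'`, although strictness
      -- at `t' + 1`, after the right particle has rested, leaves it too far behind: it would
      -- already have more than `s` rests.
      by_contra hcon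
      have h7 := h.strict (t' + 1) i hi
      have h8 := ha.rests_add (t' + 1)
      have h9 := ha.rests_mono (show t' + 1 ≤ t by omega)
      omega
    -- Now `t ≤ t' + 1`, so the left rest position is bounded by its position at `t' + 1`, which
    -- crosses the right one at most by meeting it at `r`.
    · have h7 := ha.mono (show t ≤ t' + 1 by omega)
      have h8 := h.cross t' i hi
      omega
  diag s i hi := by
    have ha := h.trajectory hT (i := i) (by omega)
    have hb := h.trajectory hT hi
    rw [arrayOf, arrayOf, restsOf, restsOf]
    have h1 := ha.restTime_add s
    have h2 := hb.restTime_add (s + 1)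
    have h5 := ha.rests_restTime s
    set t := restTime r i (fun t => P t i) s
    set t' := restTime r (i + 1) (fun t => P t (i + 1)) (s + 1)
    have h7 := h.strict t' i hi
    by_cases hc' : P t' (i + 1) < r
    · by_contra hcon
      have h8 := ha.rests_add t'
      have h9 := ha.rests_mono (show t' ≤ t by omega)
      omega
    · have h8 := ha.mono (show t ≤ t' by omega)
      omega

include hT h in
theorem pathOf_arrayOf (hi : i < d) (t : ℕ) : pathOf r (arrayOf r P) t i = P t i :=
  (h.trajectory hT hi).trajectoryOf_restsOf t

end IsPath

namespace IsArray

variable {r d c m i : ℕ} {T : ℕ → ℕ} {K : ℕ → ℕ → ℕ} (hT : IsTarget r d c T)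
  (h : IsArray r d (m - c) T K)

include hT h in
theorem restSequence (hi : i < d) : RestSequence r i fun s => K s i where
  lt := hi.trans hT.lt
  le := h.start i hi
  mono := monotone_nat_of_le_succ fun s => h.mono s i hi

include hT h in
theorem le_target (hi : i < d) (s : ℕ) : K s i ≤ T i := by
  rw [← h.final (m - c + s) i (by omega) hi]
  exact (h.restSequence hT hi).mono (by omega)

include hT h in
theorem pathOf_final (hcm : c ≤ m) {t : ℕ} (ht : m ≤ t) (hi : i < d) : pathOf r K t i = T i := by
  have hq := h.restSequence hT hi
  have h1 := hq.restCount_mem t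
  have h2 := h.le_target hT hi (restCount r i (fun s => K s i) t)
  have h3 := h.final (restCount r i (fun s => K s i) t) i
  have hle := hT.le
  rw [pathOf, trajectoryOf]
  by_cases hb : i + c < r
  · have h4 := hT.plain i hb
    have h5 : restCount r i (fun s => K s i) t ≤ t - c := RestSequence.restCount_le (by
      rw [h.final (t - c) i (by omega) hi]
      omega)
    split_ifs <;> omega
  · have h4 := hT.bar i (by omega) hi
    have h5 : restCount r i (fun s => K s i) t ≤ t + i - r := RestSequence.restCount_le (by
      rw [h.final (t + i - r) i (by omega) hi]
      omega)
    split_ifs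
    · omega
    · exact h3 (by omega) hi

-- The right particle has rested at most once more than the left one. If it has not rested more, the
-- conservation law separates the capped positions; otherwise both are possibly beyond `r` and the
-- diagonal condition decides.
include hT h in
theorem pathOf_strict (t : ℕ) (hi : i + 1 < d) : pathOf r K t i < pathOf r K t (i + 1) := by
  have ha := h.restSequence hT (i := i) (by omega)
  have hb := h.restSequence hT hi
  have h1 := ha.restCount_mem t
  have h2 := ha.cap_trajectoryOf t
  have h3 := hb.cap_trajectoryOf t
  have h5 := h.row (restCount r i (fun s => K s i) t) i hi
  have h6 := h.diag (restCount r i (fun s => K s i) t) i hi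
  have h7 := h.mono (restCount r i (fun s => K s i) t) (i + 1) hi
  rw [pathOf, pathOf]
  have h4 : restCount r (i + 1) (fun s => K s (i + 1)) t ≤ restCount r i (fun s => K s i) t + 1 :=
    RestSequence.restCount_le (by
      omega)
  by_cases h8 : t + (i + 1) ≤ min (K (restCount r i (fun s => K s i) t) (i + 1)) r +
      restCount r i (fun s => K s i) t
  · have h9 : restCount r (i + 1) (fun s => K s (i + 1)) t ≤ restCount r i (fun s => K s i) t :=
      RestSequence.restCount_le h8
    omega
  · by_cases h9 : restCount r (i + 1) (fun s => K s (i + 1)) t ≤ restCount r i (fun s => K s i) t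
    · omega
    have h10 := ha.trajectoryOf_of_le (t := t) (by omega)
    have h11 := hb.trajectoryOf_of_le (t := t) (by omega)
    rw [h10, h11]
    rw [show t + i - r = restCount r i (fun s => K s i) t by omega,
      show t + (i + 1) - r = restCount r i (fun s => K s i) t + 1 by omega]
    exact h6

include hT h in
theorem isPath (hcm : c ≤ m) : IsPath r d m T (pathOf r K) where
  start i hi := (h.restSequence hT hi).trajectory.start
  final t i ht hi := h.pathOf_final hT hcm ht hi
  mono t i hi := (h.restSequence hT hi).trajectory.mono (Nat.le_succ t)
  step t i hi := (h.restSequence hT hi).trajectory.step t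
  strict t i hi := h.pathOf_strict hT t hi
  cross t i hi := by
    have ha := h.restSequence hT (i := i) (by omega)
    have hb := h.restSequence hT hi
    have h1 := h.pathOf_strict hT t hi
    have h2 := ha.trajectory.step t
    rw [pathOf, pathOf] at h1
    rw [pathOf, pathOf]
    by_cases h3 : trajectoryOf r (i + 1) (fun s => K s (i + 1)) t < r
    · omega
    by_cases h4 : trajectoryOf r i (fun s => K s i) (t + 1) < r
    · omega
    -- With both positions at least `r`, time `t + 1` of particle `i` and time `t` of particle `i +
    -- 1` belong to the same row of the array.
    rw [ha.trajectoryOf_of_le (by omega), hb.trajectoryOf_of_le (by omega),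
      show t + 1 + i - r = t + (i + 1) - r by omega]
    have := h.row (t + (i + 1) - r) i hi
    omega

include hT h in
theorem arrayOf_pathOf (hi : i < d) (s : ℕ) : arrayOf r (pathOf r K) s i = K s i :=
  (h.restSequence hT hi).trajectoryOf_restTime s

end IsArray

/-! ### The weight of a family of trajectories -/

/-- Separates a transition into a rest weight depending on `b` and an entering weight depending on
`a`, so that entering weights can be moved to the next time step. -/
theorem layerEntry_eq_mul {K : Type*} [Field K] {r : ℕ} (S V U : ℕ → K) {a b : ℕ} (hba : b ≤ a)
    (hstep : b + 1 < r → a ≤ b + 1) :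
    layerEntry r S V U a b = (if b = r ∧ r < a then 2 else 1) *
      ((if min a r = min b r then (if b < r then S b else V b) else 1) *
        if r ≤ a then (U a)⁻¹ else 1) := by
  rcases lt_or_ge b r with hb | hb
  · rw [if_neg (by omega : ¬ (b = r ∧ r < a)), if_pos hb, one_mul]
    rcases hba.eq_or_lt with rfl | hlt
    · rw [if_pos rfl, if_neg (by omega), mul_one, layerEntry, if_pos hb, if_pos rfl]
    · rw [if_neg (by omega : ¬ min a r = min b r), one_mul]
      rcases lt_or_ge a r with ha | ha
      · rw [if_neg (by omega), layerEntry, if_pos hb, if_neg (by omega), if_pos ha,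
          if_pos (by omega)]
      · rw [if_pos ha, layerEntry_enter S V U (by omega) ha]
  · rw [layerEntry_of_le S V U hb hba, if_pos (by omega : min a r = min b r),
      if_neg (by omega : ¬ b < r), if_pos (by omega : r ≤ a), mul_assoc]

/-- The monomial `B(l, κ)` as a function of the value of `κ`. -/
noncomputable def restWeight (r : ℕ) {n : ℕ} (Y : Fin n → ℂˣ) (l κ : ℕ) : ℂ :=
  if κ < r then stayWeight r (coord r Y l) κ
  else leaveWeight r (coord r Y l) κ * (enterWeight r (coord r Y (l + 1)) κ)⁻¹

theorem B_eq_restWeight (r : ℕ) {n : ℕ} (Y : Fin n → ℂˣ) (l : ℕ) (κ : J r) :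
    B r Y l κ = restWeight r Y l κ.val := by
  have hκ := κ.2
  unfold B restWeight stayWeight leaveWeight enterWeight
  by_cases h1 : κ.val + 1 < r
  · rw [if_pos h1, if_pos (by omega), if_pos h1]
  by_cases h2 : κ.val + 1 = r
  · rw [if_neg h1, if_pos h2, if_pos (by omega), if_neg h1]
  by_cases h3 : κ.val = r
  · rw [if_neg h1, if_neg h2, if_pos h3, if_neg (by omega), if_pos h3, if_pos h3, div_eq_mul_inv]
  by_cases h4 : κ.val = r + 1
  · rw [if_neg h1, if_neg h2, if_neg h3, if_pos (by omega), if_neg (by omega), if_neg h3,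
      if_pos h4, if_neg h3, div_eq_mul_inv, show 2 * r - κ.val = r - 1 by omega]
  · rw [if_neg h1, if_neg h2, if_neg h3, if_neg (by omega), if_neg (by omega), if_neg h3,
      if_neg h4, if_neg h3, div_eq_mul_inv, show 2 * r + 1 - κ.val - 1 = 2 * r - κ.val by omega]

/-- The weight of the transitions of the particle number `i` in the cycle number `l`. -/
noncomputable def cycleEntry (r : ℕ) {n : ℕ} (Y : Fin n → ℂˣ) (l a b : ℕ) : ℂ :=
  layerEntry r (stayWeight r (coord r Y l)) (leaveWeight r (coord r Y l))
    (enterWeight r (coord r Y l)) a b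

/-- The entering weight at time `t + 1` is combined with the leaving weight of the same letter in
the following step. Nothing is entered at time `0`, and the entering weight at time `m` is left
over. -/
theorem Trajectory.prod_cycleEntry {r i : ℕ} {p : ℕ → ℕ} (h : Trajectory r i p) {n : ℕ}
    (Y : Fin n → ℂˣ) (m : ℕ) :
    ∏ t ∈ Finset.range m, cycleEntry r Y (m - t) (p (t + 1)) (p t) =
      (∏ t ∈ Finset.range m, if p t = r ∧ r < p (t + 1) then 2 else 1) *
        ((∏ s ∈ Finset.range (rests r i p m),
          restWeight r Y (m - restTime r i p s) (restsOf r i p s)) *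
          if r ≤ p m then (enterWeight r (coord r Y 1) (p m))⁻¹ else 1) := by
  -- The inverse weight of entering the letter occupied at time `t`; that transition took place in
  -- cycle `m - (t - 1)`, whence `m + 1 - t`.
  set F : ℕ → ℂ := fun t => if r ≤ p t then (enterWeight r (coord r Y (m + 1 - t)) (p t))⁻¹ else 1
  have h0 : F 0 = 1 := if_neg (by
    have := h.start
    have := h.lt
    omega)
  have hm : F m = if r ≤ p m then (enterWeight r (coord r Y 1) (p m))⁻¹ else 1 := by
    simp only [F, Nat.add_sub_cancel_left]
  have hshift : ∏ t ∈ Finset.range m, F (t + 1) = (∏ t ∈ Finset.range m, F t) * F m := by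
    rw [← Finset.prod_range_succ, Finset.prod_range_succ', h0, mul_one]
  simp only [restsOf]
  rw [← hm, ← h.prod_rests (fun t => restWeight r Y (m - t) (p t))]
  calc _ = ∏ t ∈ Finset.range m, ((if p t = r ∧ r < p (t + 1) then 2 else 1) *
        ((if min (p (t + 1)) r = min (p t) r then (if p t < r then
          stayWeight r (coord r Y (m - t)) (p t) else leaveWeight r (coord r Y (m - t)) (p t))
          else 1) * F (t + 1))) := by
        refine Finset.prod_congr rfl fun t _ => ?_
        rw [cycleEntry, layerEntry_eq_mul _ _ _ (h.mono (Nat.le_succ t)) (h.step t)]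
        simp only [F, Nat.add_sub_add_right]
    _ = _ := by
        rw [Finset.prod_mul_distrib, Finset.prod_mul_distrib, hshift]
        congr 1
        rw [← mul_assoc, ← Finset.prod_mul_distrib]
        congr 1
        refine Finset.prod_congr rfl fun t ht => ?_
        have ht := Finset.mem_range.1 ht
        have h1 := h.mono (Nat.le_succ t)
        simp only [F, restWeight]
        rw [show m + 1 - t = m - t + 1 by omega]
        rcases lt_or_ge (p t) r with h2 | h2
        · rw [if_neg (by omega : ¬ r ≤ p t), mul_one, if_pos h2, if_pos h2]
        · have h3 : min (p (t + 1)) r = min (p t) r := by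
            simp only [Nat.succ_eq_add_one] at h1
            omega
          rw [if_pos h3, if_pos h3, if_pos h2, if_neg (by omega),
            if_neg (by omega)]

/-- Monomials with quotients the weights left over at the ends of the trajectories. -/
noncomputable def endWeight (r c d : ℕ) {n : ℕ} (Y : Fin n → ℂˣ) (i : ℕ) : ℂ :=
  ∏ l ∈ Finset.range (i + c - r), coord r Y (l + 1) (d - i)

theorem endWeight_ne_zero (r c d : ℕ) {n : ℕ} (Y : Fin n → ℂˣ) (i : ℕ) :
    endWeight r c d Y i ≠ 0 :=
  Finset.prod_ne_zero_iff.2 fun _ _ => coord_ne_zero r Y _ _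

/-- The product telescopes: `endWeight` at `0` is empty because `c ≤ r`, and at `d` it involves only
`Y_{l,0} = 1`. -/
theorem prod_endWeight {r c d : ℕ} (hc : c ≤ r) {n : ℕ} (Y : Fin n → ℂˣ) :
    ∏ i ∈ Finset.range d, endWeight r c d Y i / endWeight r c d Y (i + 1) = 1 := by
  have key : ∀ k, ∏ i ∈ Finset.range k, endWeight r c d Y i / endWeight r c d Y (i + 1) =
      endWeight r c d Y 0 / endWeight r c d Y k := fun k => by
    induction k with
    | zero => rw [Finset.prod_range_zero, div_self (endWeight_ne_zero r c d Y 0)]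
    | succ k ih =>
      rw [Finset.prod_range_succ, ih, div_mul_div_cancel₀ (endWeight_ne_zero r c d Y k)]
  rw [key, endWeight, endWeight, show 0 + c - r = 0 by omega, Finset.prod_range_zero,
    Finset.prod_eq_one, div_one]
  intro l _
  rw [Nat.sub_self, coord_zero]

theorem restWeight_of_lt {r : ℕ} {n : ℕ} (Y : Fin n → ℂˣ) (l : ℕ) {κ : ℕ} (h : r + 1 < κ) :
    restWeight r Y l κ = coord r Y l (2 * r + 1 - κ) * (coord r Y (l + 1) (2 * r - κ))⁻¹ := by
  rw [restWeight, if_neg (by omega), leaveWeight, enterWeight, if_neg (by omega),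
    if_neg (by omega), if_neg (by omega)]

/-- The rests of the particles `i` and `i + 1` contribute a factor `2`. -/
def IsDoubling (r : ℕ) (K : ℕ → ℕ → ℕ) (p i : ℕ) : Prop :=
  ∃ s < p, K s (i + 1) = r ∧ K (s + 1) (i + 1) ≠ r ∧ K s i ≠ r

namespace IsPath

variable {r d c m i : ℕ} {P : ℕ → ℕ → ℕ} (hdr : d < r) (hcr : c ≤ r) (hcm : c ≤ m)
  (h : IsPath r d m (target r c d) P)

-- The first `m - c` rests give the array entries. A particle with barred target rests `i + c - r`
-- further times at that target; these rests and the leftover entering weight form the quotient of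
-- end weights.
include hdr hcr hcm h in
theorem prod_cycleEntry {n : ℕ} (Y : Fin n → ℂˣ) (hi : i < d) :
    ∏ t ∈ Finset.range m, cycleEntry r Y (m - t) (P (t + 1) i) (P t i) =
      (∏ t ∈ Finset.range m, if P t i = r ∧ r < P (t + 1) i then 2 else 1) *
        ((∏ s ∈ Finset.range (m - c), restWeight r Y
          (m - (min (arrayOf r P s i) r + s - i)) (arrayOf r P s i)) *
          (endWeight r c d Y i / endWeight r c d Y (i + 1))) := by
  have hT := isTarget_target hdr hcr
  have htr := h.trajectory hT hi
  have h1 := htr.prod_cycleEntry Y m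
  have h2 := h.rests_final hT hcm hi
  have h3 := h.final m i le_rfl hi
  have harr : ∀ s, restWeight r Y (m - restTime r i (fun t => P t i) s)
      (restsOf r i (fun t => P t i) s) = restWeight r Y
        (m - (min (arrayOf r P s i) r + s - i)) (arrayOf r P s i) := by
    intro s
    have h4 := htr.restTime_add s
    rw [arrayOf, restsOf, ← h4, Nat.add_sub_cancel]
  rw [Finset.prod_congr rfl fun s _ => harr s] at h1
  rw [h1]
  congr 1
  rw [h2, h3]
  split_ifs with h4 h5 h5
  · rw [target, if_pos h4] at h5
    omega
  · rw [endWeight, endWeight, show i + c - r = 0 by omega, show i + 1 + c - r = 0 by omega]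
    simp
  -- The `e` surplus rests take place in the cycles `e, …, 1`; the leftover entering weight supplies
  -- the factor with cycle number `1` in the denominator.
  · obtain ⟨e, he⟩ : ∃ e, i + c = r + e := ⟨i + c - r, by omega⟩
    have htgt : target r c d i = 2 * r + 1 + i - d := if_neg (by omega)
    rw [show m + i - r = m - c + e by omega, Finset.prod_range_add, mul_assoc]
    congr 1
    have h6 : ∀ j ∈ Finset.range e, restWeight r Y
        (m - (min (arrayOf r P (m - c + j) i) r + (m - c + j) - i)) (arrayOf r P (m - c + j) i) =
        coord r Y (e - 1 - j + 1) (d - i) * (coord r Y (e - 1 - j + 2) (d - (i + 1)))⁻¹ := by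
      intro j hj
      have hj := Finset.mem_range.1 hj
      rw [(h.isArray hT hcm).final (m - c + j) i (by omega) hi, htgt,
        restWeight_of_lt Y _ (by omega),
        show m - (min (2 * r + 1 + i - d) r + (m - c + j) - i) = e - 1 - j + 1 by omega,
        show 2 * r + 1 - (2 * r + 1 + i - d) = d - i by omega,
        show 2 * r - (2 * r + 1 + i - d) = d - (i + 1) by omega]
    have h7 : (coord r Y (0 + 1) (d - (i + 1)))⁻¹ =
        (enterWeight r (coord r Y 1) (target r c d i))⁻¹ := by
      rw [enterWeight, htgt, if_neg (by omega)]
      congr 2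
      omega
    rw [Finset.prod_congr rfl h6, ← h7, endWeight, endWeight, show i + c - r = e by omega,
      show i + 1 + c - r = e + 1 by omega, Finset.prod_range_succ', Finset.prod_mul_distrib,
      Finset.prod_range_reflect (fun j => coord r Y (j + 1) (d - i)) e,
      Finset.prod_range_reflect (fun j => (coord r Y (j + 2) (d - (i + 1)))⁻¹) e,
      Finset.prod_inv_distrib, div_eq_mul_inv, mul_inv, mul_assoc]
  · exfalso
    have := hT.bar i (by omega) hi
    omega

-- At the letter `0`, row `s` corresponds to time `t = s + r - (i + 1)` for particle `i + 1` and to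
-- time `t + 1` for particle `i`. Since the target is not `0`, both ranges of `s` and `t` are
-- respected.
include hdr hcr hcm h in
theorem exists_iff_isDoubling (hi : i + 1 < d) :
    (∃ t < m, P t (i + 1) = r ∧ P (t + 1) (i + 1) ≠ r ∧ P (t + 1) i ≠ r) ↔
      IsDoubling r (arrayOf r P) (m - c) i := by
  have hT := isTarget_target hdr hcr
  have ha := h.trajectory hT (i := i) (by omega)
  have hb := h.trajectory hT hi
  have hne : target r c d (i + 1) ≠ r := by
    rw [target]
    split_ifs <;> omega
  constructor
  · rintro ⟨t, ht, h1, h2, h3⟩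
    have h4 := hb.cap_le t
    have h5 := hb.restTime_eq_of_le (t := t) h1.ge
    have h6 := hb.mono (Nat.le_succ t)
    have h7 := hb.restTime_eq_of_le (t := t + 1) (by rw [← h1]; exact h6)
    have h8 : arrayOf r P (t + (i + 1) - r) (i + 1) = r := by
      rw [arrayOf, restsOf, h5, h1]
    refine ⟨t + (i + 1) - r, ?_, h8, ?_, ?_⟩
    · by_contra hcon
      rw [(h.isArray hT hcm).final _ _ (not_lt.1 hcon) hi] at h8
      exact hne h8
    · rw [arrayOf, restsOf, show t + (i + 1) - r + 1 = t + 1 + (i + 1) - r by omega, h7]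
      exact h2
    · intro h9
      have h10 := ha.restTime_add (t + (i + 1) - r)
      rw [arrayOf, restsOf] at h9
      rw [h9] at h10
      rw [show restTime r i (fun t => P t i) (t + (i + 1) - r) = t + 1 by omega] at h9
      exact h3 h9
  · rintro ⟨s, hs, h1, h2, h3⟩
    have h4 := hb.restTime_add s
    rw [arrayOf, restsOf] at h1
    rw [h1] at h4
    set t := restTime r (i + 1) (fun t => P t (i + 1)) s with ht
    have h6 := hb.mono (Nat.le_succ t)
    have h7 := hb.restTime_eq_of_le (t := t + 1) (by rw [← h1]; exact h6)
    refine ⟨t, ?_, h1, ?_, ?_⟩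
    · by_contra hcon
      rw [h.final t _ (not_lt.1 hcon) hi] at h1
      exact hne h1
    · rw [arrayOf, restsOf, show s + 1 = t + 1 + (i + 1) - r by omega, h7] at h2
      exact h2
    · intro h8
      have h9 := ha.restTime_eq_of_le (t := t + 1) h8.ge
      rw [arrayOf, restsOf, show s = t + 1 + i - r by omega, h9] at h3
      exact h3 h8

-- The `2` for leaving `0` meets the crossing factor `1/2` exactly when the left neighbour arrives
-- at `0`. A particle leaves `0` at most once, so at most one `2` survives per neighbouring pair.
open Classical in
include hdr hcr hcm h in
theorem prod_two_mul_crossing (hi : i + 1 < d) :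
    ((∏ t ∈ Finset.range m, if P t (i + 1) = r ∧ r < P (t + 1) (i + 1) then (2 : ℂ) else 1) *
      ∏ t ∈ Finset.range m, crossing ℂ r (P (t + 1) i) (P t (i + 1))) =
      if IsDoubling r (arrayOf r P) (m - c) i then 2 else 1 := by
  have hb := h.trajectory (isTarget_target hdr hcr) hi
  -- If the left particle arrives at `0`, strictness at time `t + 1` forces the right one to have
  -- left it, so `1/2` never occurs without the matching `2`.
  have key : ∀ t, (if P t (i + 1) = r ∧ r < P (t + 1) (i + 1) then (2 : ℂ) else 1) *
      crossing ℂ r (P (t + 1) i) (P t (i + 1)) =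
      if P t (i + 1) = r ∧ P (t + 1) (i + 1) ≠ r ∧ P (t + 1) i ≠ r then 2 else 1 := by
    intro t
    have h1 := h.strict (t + 1) i hi
    have h2 := h.cross t i hi
    have h3 := h.mono t (i + 1) hi
    rw [crossing]
    split_ifs <;> first | (exfalso; omega) | norm_num
  rw [← Finset.prod_mul_distrib, Finset.prod_congr rfl fun t _ => key t,
    ← h.exists_iff_isDoubling hdr hcr hcm hi]
  split_ifs with hex
  · obtain ⟨t, ht, hC⟩ := hex
    rw [Finset.prod_eq_single t, if_pos hC]
    · intro t' _ hne
      refine if_neg fun hC' => ?_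
      rcases lt_or_gt_of_ne hne with hlt | hlt
      · have h1 := hb.mono (Nat.succ_le_of_lt hlt)
        have h2 := hb.mono (Nat.le_succ t')
        simp only [Nat.succ_eq_add_one] at h1 h2
        omega
      · have h1 := hb.mono (Nat.succ_le_of_lt hlt)
        have h2 := hb.mono (Nat.le_succ t)
        simp only [Nat.succ_eq_add_one] at h1 h2
        omega
    · intro hcon
      exact absurd (Finset.mem_range.2 ht) hcon
  · refine Finset.prod_eq_one fun t ht => if_neg fun hC => ?_
    exact hex ⟨t, Finset.mem_range.1 ht, hC⟩

-- Each factor `2` of particle `i + 1` is grouped with its crossing with particle `i`; the end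
-- weights disappear in the product over all particles.
open Classical in
include hdr hcr hcm h in
theorem prod_weight (hmr : m ≤ r) (hd : 1 ≤ d) {n : ℕ} (Y : Fin n → ℂˣ) :
    ∏ t ∈ Finset.range m, ((∏ i ∈ Finset.range d, cycleEntry r Y (m - t) (P (t + 1) i) (P t i)) *
      ∏ i ∈ Finset.range (d - 1), crossing ℂ r (P (t + 1) i) (P t (i + 1))) =
    (∏ i ∈ Finset.range (d - 1), if IsDoubling r (arrayOf r P) (m - c) i then 2 else 1) *
      ∏ i ∈ Finset.range d, ∏ s ∈ Finset.range (m - c), restWeight r Y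
          (m - (min (arrayOf r P s i) r + s - i)) (arrayOf r P s i) := by
  have hT := isTarget_target hdr hcr
  rw [Finset.prod_mul_distrib, Finset.prod_comm, Finset.prod_comm (s := Finset.range m)
    (t := Finset.range (d - 1)), Finset.prod_congr rfl fun i hi =>
      h.prod_cycleEntry hdr hcr hcm Y (Finset.mem_range.1 hi), Finset.prod_mul_distrib,
    Finset.prod_mul_distrib, prod_endWeight hcr, mul_one, mul_right_comm]
  congr 1
  obtain ⟨e, rfl⟩ : ∃ e, d = e + 1 := ⟨d - 1, by omega⟩
  -- The leftmost particle has no crossing partner, but needs `r` steps to reach `0` and so cannot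
  -- leave it before time `m ≤ r`.
  have h0 : (∏ t ∈ Finset.range m, if P t 0 = r ∧ r < P (t + 1) 0 then (2 : ℂ) else 1) = 1 := by
    refine Finset.prod_eq_one fun t ht => if_neg fun hC => ?_
    have h1 := (h.trajectory hT (i := 0) (by omega)).cap_le t
    have h2 := Finset.mem_range.1 ht
    omega
  rw [Finset.prod_range_succ', h0, mul_one, Nat.add_sub_cancel, ← Finset.prod_mul_distrib]
  refine Finset.prod_congr rfl fun i hi => ?_
  have hi := Finset.mem_range.1 hi
  exact h.prod_two_mul_crossing hdr hcr hcm (by omega)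

end IsPath

/-! ### Finite families and arrays -/

theorem IsTarget.strict {r d c : ℕ} {T : ℕ → ℕ} (hT : IsTarget r d c T) {i : ℕ} (hi : i + 1 < d) :
    T i < T (i + 1) := by
  have h1 := hT.plain i
  have h2 := hT.plain (i + 1)
  have h3 := hT.bar (i + 1)
  have h4 := hT.succ i
  omega

theorem IsTarget.ne {r d c : ℕ} {T : ℕ → ℕ} (hT : IsTarget r d c T) {i : ℕ} (hi : i < d) :
    T i ≠ r := by
  have h1 := hT.plain i
  have h2 := hT.bar i
  omega

theorem lt_of_lt_succ_of_lt {d : ℕ} {f : ℕ → ℕ} (h : ∀ i, i + 1 < d → f i < f (i + 1)) {i j : ℕ}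
    (hij : i < j) (hj : j < d) : f i < f j := by
  induction j, hij using Nat.le_induction with
  | base => exact h i hj
  | succ j _ ih => exact (ih (by omega)).trans (h j hj)

theorem target_le {r c d i : ℕ} (hi : i < d) : target r c d i ≤ 2 * r := by
  rw [target]
  split_ifs <;> omega

theorem le_target {r c d i : ℕ} (hdr : d < r) : i ≤ target r c d i := by
  rw [target]
  split_ifs <;> omega

/-- The letter with a given value. -/
def letter (r n : ℕ) : J r := ⟨min n (2 * r), by omega⟩

theorem letter_val {r n : ℕ} (h : n ≤ 2 * r) : (letter r n).val = n := min_eq_left h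

theorem letter_coe {r : ℕ} (κ : J r) : letter r κ.val = κ :=
  Fin.ext (letter_val (by have := κ.2; omega))

/-- A finite family of trajectories, continued by its last row. -/
def extendPath {r m d : ℕ} (P : Fin (m + 1) → Fin d → J r) (t i : ℕ) : ℕ :=
  if h : i < d then (P ⟨min t m, by omega⟩ ⟨i, h⟩).val else 0

theorem extendPath_apply {r m d : ℕ} (P : Fin (m + 1) → Fin d → J r) (t : Fin (m + 1)) (i : Fin d) :
    extendPath P t i = (P t i).val := by
  have h : (⟨min t.val m, by omega⟩ : Fin (m + 1)) = t := Fin.ext (min_eq_left (by omega))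
  rw [extendPath, dif_pos i.2, h]

theorem extendPath_of_le {r m d : ℕ} (P : Fin (m + 1) → Fin d → J r) {t : ℕ} (ht : m ≤ t)
    (i : Fin d) : extendPath P t i = (P (Fin.last m) i).val := by
  have h : (⟨min t m, by omega⟩ : Fin (m + 1)) = Fin.last m := Fin.ext (min_eq_right ht)
  rw [extendPath, dif_pos i.2, h]

/-- A finite array, continued by the letters `T i`. -/
def extendArray {r p d : ℕ} (T : ℕ → ℕ) (K : Fin p → Fin d → J r) (s i : ℕ) : ℕ :=
  if h : s < p ∧ i < d then (K ⟨s, h.1⟩ ⟨i, h.2⟩).val else T i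

theorem extendArray_apply {r p d : ℕ} (T : ℕ → ℕ) (K : Fin p → Fin d → J r) (s : Fin p)
    (i : Fin d) : extendArray T K s i = (K s i).val := dif_pos ⟨s.2, i.2⟩

theorem extendArray_of_le {r p d : ℕ} (T : ℕ → ℕ) (K : Fin p → Fin d → J r) {s : ℕ} (hs : p ≤ s)
    (i : ℕ) : extendArray T K s i = T i := dif_neg (by omega)

theorem IsPath.congr {r d m : ℕ} {T : ℕ → ℕ} {P Q : ℕ → ℕ → ℕ} (h : IsPath r d m T P)
    (hPQ : ∀ t, ∀ i < d, Q t i = P t i) : IsPath r d m T Q where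
  start i hi := by rw [hPQ 0 i hi, h.start i hi]
  final t i ht hi := by rw [hPQ t i hi, h.final t i ht hi]
  mono t i hi := by
    rw [hPQ _ i hi, hPQ _ i hi]
    exact h.mono t i hi
  step t i hi := by
    rw [hPQ _ i hi, hPQ _ i hi]
    exact h.step t i hi
  strict t i hi := by
    rw [hPQ _ i (by omega), hPQ _ _ hi]
    exact h.strict t i hi
  cross t i hi := by
    rw [hPQ _ i (by omega), hPQ _ _ hi]
    exact h.cross t i hi

theorem IsArray.congr {r d p : ℕ} {T : ℕ → ℕ} {K L : ℕ → ℕ → ℕ} (h : IsArray r d p T K)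
    (hKL : ∀ s, ∀ i < d, L s i = K s i) : IsArray r d p T L where
  start i hi := by
    rw [hKL 0 i hi]
    exact h.start i hi
  final s i hs hi := by rw [hKL s i hi, h.final s i hs hi]
  mono s i hi := by
    rw [hKL _ i hi, hKL _ i hi]
    exact h.mono s i hi
  row s i hi := by
    rw [hKL _ i (by omega), hKL _ _ hi]
    exact h.row s i hi
  diag s i hi := by
    rw [hKL _ i (by omega), hKL _ _ hi]
    exact h.diag s i hi

/-! ### Comparison of `Admissible` with `IsArray`. -/

theorem Admissible.row {r d c p : ℕ} {K : Fin p → Fin d → J r} (h : Admissible r d c p K)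
    (s : Fin p) {i : ℕ} (hi : i + 1 < d) :
    (K s ⟨i, by omega⟩).val < (K s ⟨i + 1, hi⟩).val ∨
      ((K s ⟨i, by omega⟩).val = r ∧ (K s ⟨i + 1, hi⟩).val = r) := by
  have h1 := h.row_le s ⟨i, by omega⟩ ⟨i + 1, hi⟩ rfl
  have h2 := h.row_eq s ⟨i, by omega⟩ ⟨i + 1, hi⟩ rfl
  rcases h1.lt_or_eq with h3 | h3
  · exact Or.inl h3
  · exact Or.inr (h2.1 h3)

theorem Admissible.le_apply {r d c p : ℕ} (hdr : d < r) {K : Fin p → Fin d → J r}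
    (h : Admissible r d c p K) (s : Fin p) {i : ℕ} (hi : i < d) : i ≤ (K s ⟨i, hi⟩).val := by
  induction i with
  | zero => exact Nat.zero_le _
  | succ i ih =>
    have h1 := h.row s hi
    have h2 := ih (by omega)
    omega

/-- Descending from the last column, entries drop strictly, except for repeated letters `0`, where
the bound holds because `d < r`. -/
theorem Admissible.apply_add_le {r d c p : ℕ} (hdr : d < r) {K : Fin p → Fin d → J r}
    (h : Admissible r d c p K) (s : Fin p) {i : ℕ} (hi : i < d) :
    (K s ⟨i, hi⟩).val + d ≤ 2 * r + 1 + i := by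
  obtain ⟨j, hj⟩ : ∃ j, d = i + 1 + j := ⟨d - i - 1, by omega⟩
  induction j generalizing i with
  | zero =>
    have := (K s ⟨i, hi⟩).2
    omega
  | succ j ih =>
    have h1 := h.row s (i := i) (by omega)
    have h2 := ih (i := i + 1) (by omega) (by omega)
    omega

theorem Admissible.apply_le_target {r d c p : ℕ} (hdr : d < r) {K : Fin p → Fin d → J r}
    (h : Admissible r d c p K) (s : Fin p) {i : ℕ} (hi : i < d) :
    (K s ⟨i, hi⟩).val ≤ target r c d i := by
  have h1 := h.apply_add_le hdr s hi
  have h2 := h.bound s ⟨i, hi⟩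
  simp only at h2
  rw [target]
  split_ifs <;> omega

/-- Continuing by the targets is consistent since every entry is bounded by its target: by `bound`
for unbarred targets and by room to the right for barred ones. -/
theorem Admissible.isArray {r d c p : ℕ} (hdr : d < r) (hcr : c ≤ r) {K : Fin p → Fin d → J r}
    (h : Admissible r d c p K) : IsArray r d p (target r c d) (extendArray (target r c d) K) where
  start i hi := by
    rw [extendArray]
    split_ifs with h1
    · exact h.le_apply hdr _ hi
    · exact le_target hdr
  final s i hs _ := extendArray_of_le _ K hs i
  mono s i hi := by
    rcases lt_or_ge (s + 1) p with h1 | h1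
    · rw [extendArray, dif_pos ⟨by omega, hi⟩, extendArray, dif_pos ⟨h1, hi⟩]
      exact h.col_le ⟨s, by omega⟩ ⟨s + 1, h1⟩ ⟨i, hi⟩ rfl
    · rw [extendArray_of_le _ K h1]
      rcases lt_or_ge s p with h2 | h2
      · rw [extendArray, dif_pos ⟨h2, hi⟩]
        exact h.apply_le_target hdr _ hi
      · rw [extendArray_of_le _ K h2]
  row s i hi := by
    rcases lt_or_ge s p with h1 | h1
    · rw [extendArray, dif_pos ⟨h1, by omega⟩, extendArray, dif_pos ⟨h1, hi⟩]
      exact h.row ⟨s, h1⟩ hi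
    · rw [extendArray_of_le _ K h1, extendArray_of_le _ K h1]
      exact Or.inl ((isTarget_target hdr hcr).strict hi)
  diag s i hi := by
    have hst := (isTarget_target hdr hcr).strict hi
    rcases lt_or_ge (s + 1) p with h1 | h1
    · rw [extendArray, dif_pos ⟨by omega, by omega⟩, extendArray, dif_pos ⟨h1, hi⟩]
      exact h.diag_lt ⟨s, by omega⟩ ⟨s + 1, h1⟩ ⟨i, by omega⟩ ⟨i + 1, hi⟩ rfl rfl
    · rw [extendArray_of_le _ K h1]
      rcases lt_or_ge s p with h2 | h2
      · rw [extendArray, dif_pos ⟨h2, by omega⟩]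
        exact (h.apply_le_target hdr ⟨s, h2⟩ (by omega)).trans_lt hst
      · rwa [extendArray_of_le _ K h2]

theorem IsArray.admissible {r d c m : ℕ} (hdr : d < r) (hcr : c ≤ r) {K : Fin (m - c) → Fin d → J r}
    (h : IsArray r d (m - c) (target r c d) (extendArray (target r c d) K)) :
    Admissible r d c (m - c) K := by
  have hrow : ∀ s i i', i'.val = i.val + 1 → (K s i).val < (K s i').val ∨
      ((K s i).val = r ∧ (K s i').val = r) := by
    intro s i i' hi
    have h1 := h.row s i (hi ▸ i'.2)
    rwa [← hi, extendArray_apply, extendArray_apply] at h1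
  refine ⟨fun s i i' hi => ?_, fun s i i' hi => ?_, fun s s' i hs => ?_, fun s i hi => ?_,
    fun s s' i i' hs hi => ?_⟩
  · have := hrow s i i' hi
    rw [Fin.le_def]
    omega
  · have := hrow s i i' hi
    constructor
    · intro he
      rw [he] at this
      rw [he]
      exact ⟨by omega, by omega⟩
    · rintro ⟨h1, h2⟩
      exact Fin.ext (h1.trans h2.symm)
  · have h1 := h.mono s i i.2
    rwa [← hs, extendArray_apply, extendArray_apply] at h1
  · have h1 := h.le_target (isTarget_target hdr hcr) i.2 s
    rw [extendArray_apply, target, if_pos (by omega)] at h1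
    omega
  · have h1 := h.diag s i (hi ▸ i'.2)
    rwa [← hs, ← hi, extendArray_apply, extendArray_apply] at h1

/-- The finite array of the rests of a finite family of trajectories. -/
noncomputable def finiteArray {r m d : ℕ} (p : ℕ) (P : Fin (m + 1) → Fin d → J r) :
    Fin p → Fin d → J r :=
  fun s i => letter r (arrayOf r (extendPath P) s i)

/-- The finite family of trajectories with a given finite array of rests. -/
noncomputable def finitePath {r p d : ℕ} (m : ℕ) (T : ℕ → ℕ) (K : Fin p → Fin d → J r) :
    Fin (m + 1) → Fin d → J r :=
  fun t i => letter r (pathOf r (extendArray T K) t i)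

/-! ### The bijection between finite path families and admissible arrays. -/

section

variable {r d c m : ℕ} (hdr : d < r) (hcr : c ≤ r) (hcm : c ≤ m)

include hdr hcr hcm in
theorem extendArray_finiteArray {P : Fin (m + 1) → Fin d → J r}
    (h : IsPath r d m (target r c d) (extendPath P)) (s : ℕ) {i : ℕ} (hi : i < d) :
    extendArray (target r c d) (finiteArray (m - c) P) s i = arrayOf r (extendPath P) s i := by
  have hA := h.isArray (isTarget_target hdr hcr) hcm
  rcases lt_or_ge s (m - c) with hs | hs
  · rw [extendArray, dif_pos ⟨hs, hi⟩]
    exact letter_val ((hA.le_target (isTarget_target hdr hcr) hi s).trans (target_le hi))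
  · rw [extendArray_of_le _ _ hs, hA.final s i hs hi]

include hdr hcr hcm in
theorem extendPath_finitePath {K : Fin (m - c) → Fin d → J r}
    (h : IsArray r d (m - c) (target r c d) (extendArray (target r c d) K)) (t : ℕ) {i : ℕ}
    (hi : i < d) : extendPath (finitePath m (target r c d) K) t i =
      pathOf r (extendArray (target r c d) K) t i := by
  have hP := h.isPath (isTarget_target hdr hcr) hcm
  rw [extendPath, dif_pos hi]
  refine (letter_val ((hP.le_target (isTarget_target hdr hcr) hi _).trans (target_le hi))).trans ?_
  dsimp only
  rcases le_total t m with ht | ht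
  · rw [min_eq_left ht]
  · rw [min_eq_right ht, hP.final m i le_rfl hi, hP.final t i ht hi]

include hdr hcr hcm in
theorem admissible_finiteArray {P : Fin (m + 1) → Fin d → J r}
    (h : IsPath r d m (target r c d) (extendPath P)) :
    Admissible r d c (m - c) (finiteArray (m - c) P) :=
  ((h.isArray (isTarget_target hdr hcr) hcm).congr fun s _ hi =>
    extendArray_finiteArray hdr hcr hcm h s hi).admissible hdr hcr

include hdr hcr hcm in
theorem isPath_finitePath {K : Fin (m - c) → Fin d → J r} (h : Admissible r d c (m - c) K) :
    IsPath r d m (target r c d) (extendPath (finitePath m (target r c d) K)) :=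
  ((h.isArray hdr hcr).isPath (isTarget_target hdr hcr) hcm).congr fun t _ hi =>
    extendPath_finitePath hdr hcr hcm (h.isArray hdr hcr) t hi

include hdr hcr hcm in
theorem finitePath_finiteArray {P : Fin (m + 1) → Fin d → J r}
    (h : IsPath r d m (target r c d) (extendPath P)) :
    finitePath m (target r c d) (finiteArray (m - c) P) = P := by
  ext t i : 2
  have h1 : (fun s => extendArray (target r c d) (finiteArray (m - c) P) s i.val) =
      fun s => arrayOf r (extendPath P) s i :=
    funext fun s => extendArray_finiteArray hdr hcr hcm h s i.2
  have h2 := h.pathOf_arrayOf (isTarget_target hdr hcr) i.2 t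
  rw [extendPath_apply, pathOf] at h2
  rw [finitePath, pathOf, h1, h2, letter_coe]

include hdr hcr hcm in
theorem finiteArray_finitePath {K : Fin (m - c) → Fin d → J r} (h : Admissible r d c (m - c) K) :
    finiteArray (m - c) (finitePath m (target r c d) K) = K := by
  ext s i : 2
  have h1 : (fun t => extendPath (finitePath m (target r c d) K) t i.val) =
      fun t => pathOf r (extendArray (target r c d) K) t i :=
    funext fun t => extendPath_finitePath hdr hcr hcm (h.isArray hdr hcr) t i.2
  have h2 := (h.isArray hdr hcr).arrayOf_pathOf (isTarget_target hdr hcr) i.2 s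
  rw [extendArray_apply, arrayOf] at h2
  rw [finiteArray, arrayOf, h1, h2, letter_coe]

end

/-! ### The weight of an array -/

theorem isDoubling_congr {r d p : ℕ} {K L : ℕ → ℕ → ℕ} (hKL : ∀ s, ∀ i < d, L s i = K s i) {i : ℕ}
    (hi : i + 1 < d) : IsDoubling r L p i ↔ IsDoubling r K p i := by
  simp only [IsDoubling, hKL _ (i + 1) hi, hKL _ i (by omega)]

/-- The continuation by a target different from `0` encodes the convention that the condition on row
`t + 1` is void in the last row. -/
theorem isDoubling_extendArray {r d p : ℕ} {T : ℕ → ℕ} (K : Fin p → Fin d → J r) {i : ℕ}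
    (hi : i + 1 < d) (hT : T (i + 1) ≠ r) : IsDoubling r (extendArray T K) p i ↔
      ∃ j' : Fin d, j'.val = i + 1 ∧ ∃ t : Fin p,
        IsZero r (K t j') ∧ (∀ t' : Fin p, t'.val = t.val + 1 → ¬ IsZero r (K t' j')) ∧
          ¬ IsZero r (K t ⟨i, by omega⟩) := by
  constructor
  · rintro ⟨s, hs, h1, h2, h3⟩
    rw [extendArray, dif_pos ⟨hs, hi⟩] at h1
    rw [extendArray, dif_pos ⟨hs, by omega⟩] at h3
    refine ⟨⟨i + 1, hi⟩, rfl, ⟨s, hs⟩, h1, fun t' ht' h4 => h2 ?_, h3⟩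
    have h5 := extendArray_apply T K t' ⟨i + 1, hi⟩
    rw [ht'] at h5
    exact h5.trans h4
  · rintro ⟨j', hj', t, h1, h2, h3⟩
    obtain rfl : j' = ⟨i + 1, hi⟩ := Fin.ext hj'
    refine ⟨t, t.2, (extendArray_apply T K t ⟨i + 1, hi⟩).trans h1, ?_, ?_⟩
    · rcases lt_or_ge (t.val + 1) p with ht | ht
      · have h4 := h2 ⟨t.val + 1, ht⟩ rfl
        have h5 := extendArray_apply T K ⟨t.val + 1, ht⟩ ⟨i + 1, hi⟩
        exact fun h6 => h4 (h5.symm.trans h6)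
      · rw [extendArray_of_le _ _ ht]
        exact hT
    · have h5 := extendArray_apply T K t ⟨i, by omega⟩
      exact fun h6 => h3 (h5.symm.trans h6)

open Classical in
theorem prod_isDoubling {r d c p : ℕ} (hdr : d < r) (hcr : c ≤ r) (K : Fin p → Fin d → J r) :
    (∏ i ∈ Finset.range (d - 1),
      if IsDoubling r (extendArray (target r c d) K) p i then (2 : ℂ) else 1) =
      2 ^ Cexp r d p K := by
  rw [Finset.prod_ite, Finset.prod_const_one, mul_one, Finset.prod_const, Cexp,
    ← Finset.card_map Fin.valEmbedding]
  congr 2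
  ext i
  simp only [Finset.mem_filter, Finset.mem_range, Finset.mem_map, Finset.mem_univ, true_and,
    Fin.valEmbedding_apply]
  constructor
  · rintro ⟨hi, h⟩
    have hi' : i + 1 < d := by omega
    rw [isDoubling_extendArray K hi' ((isTarget_target hdr hcr).ne hi')] at h
    exact ⟨⟨i, by omega⟩, h, rfl⟩
  · rintro ⟨j, h, rfl⟩
    obtain ⟨j', hj', -⟩ := id h
    have hi' : j.val + 1 < d := hj' ▸ j'.2
    exact ⟨by omega, (isDoubling_extendArray K hi' ((isTarget_target hdr hcr).ne hi')).2 h⟩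

theorem arrayMonomial_eq {r d m p : ℕ} {n : ℕ} (Y : Fin n → ℂˣ) (K : Fin p → Fin d → J r)
    (T : ℕ → ℕ) : arrayMonomial r d m p Y K = ∏ i ∈ Finset.range d, ∏ s ∈ Finset.range p,
      restWeight r Y (m - (min (extendArray T K s i) r + s - i)) (extendArray T K s i) := by
  rw [Finset.prod_range, arrayMonomial]
  refine Finset.prod_congr rfl fun i _ => ?_
  rw [Finset.prod_range]
  refine Finset.prod_congr rfl fun s _ => ?_
  rw [extendArray_apply, B_eq_restWeight, lIndex]
  congr 2
  split_ifs <;> omega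

open Classical in
theorem prod_weight_finite {r d c m : ℕ} (hdr : d < r) (hcr : c ≤ r) (hcm : c ≤ m) (hmr : m ≤ r)
    (hd : 1 ≤ d) {n : ℕ} (Y : Fin n → ℂˣ) {P : Fin (m + 1) → Fin d → J r}
    (h : IsPath r d m (target r c d) (extendPath P)) :
    ∏ t ∈ Finset.range m, ((∏ i ∈ Finset.range d,
        cycleEntry r Y (m - t) (extendPath P (t + 1) i) (extendPath P t i)) *
      ∏ i ∈ Finset.range (d - 1), crossing ℂ r (extendPath P (t + 1) i) (extendPath P t (i + 1))) =
    2 ^ Cexp r d (m - c) (finiteArray (m - c) P) *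
      arrayMonomial r d m (m - c) Y (finiteArray (m - c) P) := by
  have hext := fun s i hi => extendArray_finiteArray hdr hcr hcm h s (i := i) hi
  rw [h.prod_weight hdr hcr hcm hmr hd, ← prod_isDoubling hdr hcr,
    arrayMonomial_eq Y _ (target r c d)]
  congr 1
  · refine Finset.prod_congr rfl fun i hi => ?_
    have hi := Finset.mem_range.1 hi
    simp only [isDoubling_congr hext (p := m - c) (by omega : i + 1 < d)]
  · refine Finset.prod_congr rfl fun i hi => Finset.prod_congr rfl fun s _ => ?_
    rw [hext s i (Finset.mem_range.1 hi)]

/-! ### Layer minors and families with nonzero weight. -/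

theorem step_of_layerEntry_ne_zero {K : Type*} [Field K] {r : ℕ} {S V U : ℕ → K} {a b : ℕ}
    (h : layerEntry r S V U a b ≠ 0) : b ≤ a ∧ (b + 1 < r → a ≤ b + 1) := by
  refine ⟨not_lt.1 fun hab => h (layerEntry_of_lt r S V U hab), fun hb => ?_⟩
  by_contra hcon
  apply h
  rw [layerEntry, if_pos (by omega), if_neg (by omega)]
  split_ifs <;> first | rfl | (exfalso; omega)

theorem lt_or_eq_of_crossing_ne_zero {K : Type*} [Field K] {r a b : ℕ}
    (h : crossing K r a b ≠ 0) : a < b ∨ (a = b ∧ b ≤ r) := by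
  by_contra hcon
  apply h
  rw [crossing, if_neg (by omega), if_neg (by omega)]

/-- Nonzero transition entries give the monotonicity and step conditions, nonzero crossing factors
the crossing rule; after time `m` the constant continuation satisfies them trivially. -/
theorem isPath_of_prod_ne_zero {r d c m : ℕ} {n : ℕ} (Y : Fin n → ℂˣ)
    {P : Fin (m + 1) → Fin d → J r} (h0 : ∀ i, (P 0 i).val = i.val)
    (h1 : ∀ i, (P (Fin.last m) i).val = target r c d i) (h2 : ∀ t, StrictMono (P t))
    (h3 : ∏ t ∈ Finset.range m, ((∏ i ∈ Finset.range d,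
        cycleEntry r Y (m - t) (extendPath P (t + 1) i) (extendPath P t i)) *
      ∏ i ∈ Finset.range (d - 1),
        crossing ℂ r (extendPath P (t + 1) i) (extendPath P t (i + 1))) ≠ 0) :
    IsPath r d m (target r c d) (extendPath P) := by
  have hfinal : ∀ t i, m ≤ t → i < d → extendPath P t i = target r c d i := fun t i ht hi => by
    rw [← h1 ⟨i, hi⟩]
    exact extendPath_of_le P ht ⟨i, hi⟩
  have hstrict : ∀ t i, i + 1 < d → extendPath P t i < extendPath P t (i + 1) := fun t i hi => by
    rw [extendPath, extendPath, dif_pos (by omega), dif_pos hi]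
    exact h2 _ (Fin.lt_def.2 (Nat.lt_succ_self i))
  have hstep : ∀ t i, i < d → extendPath P t i ≤ extendPath P (t + 1) i ∧
      (extendPath P t i + 1 < r → extendPath P (t + 1) i ≤ extendPath P t i + 1) := by
    intro t i hi
    rcases lt_or_ge t m with ht | ht
    · have h4 := Finset.prod_ne_zero_iff.1 h3 t (Finset.mem_range.2 ht)
      exact step_of_layerEntry_ne_zero
        (Finset.prod_ne_zero_iff.1 (left_ne_zero_of_mul h4) i (Finset.mem_range.2 hi))
    · rw [hfinal t i ht hi, hfinal (t + 1) i (by omega) hi]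
      exact ⟨le_rfl, fun _ => Nat.le_succ _⟩
  refine ⟨fun i hi => ?_, hfinal, fun t i hi => (hstep t i hi).1, fun t i hi => (hstep t i hi).2,
    hstrict, fun t i hi => ?_⟩
  · exact (extendPath_apply P 0 ⟨i, hi⟩).trans (h0 ⟨i, hi⟩)
  · rcases lt_or_ge t m with ht | ht
    · have h4 := Finset.prod_ne_zero_iff.1 h3 t (Finset.mem_range.2 ht)
      exact lt_or_eq_of_crossing_ne_zero
        (Finset.prod_ne_zero_iff.1 (right_ne_zero_of_mul h4) i (Finset.mem_range.2 (by omega)))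
    · left
      have h5 := hstrict t i hi
      rwa [hfinal t i ht (by omega), ← hfinal (t + 1) i (by omega) (by omega)] at h5

theorem IsPath.strictMono {r d c m : ℕ} {P : Fin (m + 1) → Fin d → J r}
    (h : IsPath r d m (target r c d) (extendPath P)) (t : Fin (m + 1)) : StrictMono (P t) := by
  intro i j hij
  have h1 := lt_of_lt_succ_of_lt (h.strict t) (Fin.lt_def.1 hij) j.2
  rwa [extendPath_apply, extendPath_apply] at h1

theorem leaveWeight_ne_zero {r : ℕ} {y : ℕ → ℂ} (hy : ∀ l, y l ≠ 0) (b : ℕ) :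
    leaveWeight r y b ≠ 0 := by
  rw [leaveWeight]
  split_ifs
  · exact hy _
  · exact pow_ne_zero _ (hy _)
  · exact hy _

theorem cycleMatrix_apply {r : ℕ} (hr : 1 ≤ r) {n : ℕ} (Y : Fin n → ℂˣ) (s : ℕ) (a b : J r) :
    cycleMatrix r Y s a b = cycleEntry r Y (s + 1) a b :=
  prod_xMinus_apply hr (coordUnit r Y (s + 1)) (coord r Y (s + 1)) (coord_zero r Y _)
    (fun l _ => (coe_coordUnit r Y _ l).symm) a b

theorem det_cycleMatrix_submatrix {r m d : ℕ} (hr : 1 ≤ r) {n : ℕ} (Y : Fin n → ℂˣ)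
    {P : Fin (m + 1) → Fin d → J r} (hP : ∀ t, StrictMono (P t)) (t : Fin m) :
    ((cycleMatrix r Y (m - 1 - t)).submatrix (P t.succ) (P t.castSucc)).det =
      (∏ i ∈ Finset.range d,
        cycleEntry r Y (m - t) (extendPath P (t + 1) i) (extendPath P t i)) *
      ∏ i ∈ Finset.range (d - 1),
        crossing ℂ r (extendPath P (t + 1) i) (extendPath P t (i + 1)) := by
  have hmono : ∀ t i j, i < j → j < d → extendPath P t i < extendPath P t j :=
    fun t i j hij hj => by
      rw [extendPath, extendPath, dif_pos (by omega), dif_pos hj]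
      exact hP _ (Fin.lt_def.2 hij)
  have hdet := det_layerEntry (S := stayWeight r (coord r Y (m - t)))
    (U := enterWeight r (coord r Y (m - t)))
    (leaveWeight_ne_zero (r := r) fun l => coord_ne_zero r Y (m - t) l) d (hmono (t + 1)) (hmono t)
    (r := r)
  refine Eq.trans (congrArg Matrix.det (Matrix.ext fun i j => ?_)) hdet
  have h1 := extendPath_apply P t.succ i
  have h2 := extendPath_apply P t.castSucc j
  rw [Fin.val_succ] at h1
  rw [Fin.val_castSucc] at h2
  rw [Matrix.submatrix_apply, cycleMatrix_apply hr, Matrix.of_apply, h1, h2,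
    show m - 1 - t.val + 1 = m - t by omega]
  rfl

end TypeB

/-! ### Assembly of the formula. -/

open Classical in
theorem theorem5p5 (r m d k m' : ℕ) (hm : 1 ≤ m) (hmr : m ≤ r) (hd : 1 ≤ d) (hdr : d < r)
    (hk : 1 ≤ k) (hkn : k ≤ (TypeB.word r m d).length)
    (hkd : (TypeB.word r m d).getD (k - 1) 0 = d)
    (hcycle : (m' - 1) * r < k ∧ k ≤ m' * r)
    (Y : Fin (TypeB.word r m d).length → ℂˣ) :
    TypeB.DeltaL r (TypeB.word r m d) k Y =
      ∑ K : Fin (m - m') → Fin d → TypeB.J r with TypeB.Admissible r d m' (m - m') K,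
        2 ^ TypeB.Cexp r d (m - m') K * TypeB.arrayMonomial r d m (m - m') Y K := by
  have hcm : m' ≤ m := by
    obtain ⟨c, hc, -, hc'⟩ := TypeB.position_eq hdr hk hkn hkd hcycle
    omega
  have hcr := hcm.trans hmr
  let a : Fin d → TypeB.J r := fun i => TypeB.letter r (TypeB.target r m' d i)
  let b : Fin d → TypeB.J r := fun i => TypeB.letter r i
  have ha : ∀ i, (a i).val = TypeB.target r m' d i := fun i =>
    TypeB.letter_val (TypeB.target_le i.2)
  have hb : ∀ i, (b i).val = i.val := fun i => TypeB.letter_val (by omega)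
  have ha_mono : StrictMono a := fun i j hij => by
    rw [Fin.lt_def, ha, ha]
    exact TypeB.lt_of_lt_succ_of_lt (f := TypeB.target r m' d)
      (fun i hi => (TypeB.isTarget_target hdr hcr).strict hi) hij j.2
  have hb_mono : StrictMono b := fun i j hij => by
    rw [Fin.lt_def, hb, hb]
    exact hij
  rw [TypeB.DeltaL_eq_det hm hmr hdr hk hkn hkd hcycle Y a b ha hb,
    TypeB.det_submatrix_eq_sum_paths (fun n => TypeB.cycleMatrix r Y (m - 1 - n))
      (TypeB.tailProduct r m Y) rfl (fun _ => rfl) m ha_mono hb_mono]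
  let W : (Fin (m + 1) → Fin d → TypeB.J r) → ℂ := fun P =>
    ∏ t ∈ Finset.range m, ((∏ i ∈ Finset.range d, TypeB.cycleEntry r Y (m - t)
        (TypeB.extendPath P (t + 1) i) (TypeB.extendPath P t i)) *
      ∏ i ∈ Finset.range (d - 1), TypeB.crossing ℂ r
        (TypeB.extendPath P (t + 1) i) (TypeB.extendPath P t (i + 1)))
  calc _ = ∑ P : Fin (m + 1) → Fin d → TypeB.J r with
          P 0 = b ∧ P (Fin.last m) = a ∧ ∀ t, StrictMono (P t), W P := by
        refine Finset.sum_congr rfl fun P hP => ?_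
        simp only [W]
        rw [Finset.prod_range]
        exact Finset.prod_congr rfl fun t _ => TypeB.det_cycleMatrix_submatrix (by omega) Y
          (Finset.mem_filter.1 hP).2.2.2 t
    _ = ∑ P : Fin (m + 1) → Fin d → TypeB.J r with
          TypeB.IsPath r d m (TypeB.target r m' d) (TypeB.extendPath P), W P := by
        -- Families that are not paths have weight zero, so the Cauchy–Binet sum may be restricted.
        refine (Finset.sum_subset (fun P hP => ?_) fun P hP hP' => ?_).symm
        · have h := (Finset.mem_filter.1 hP).2
          refine Finset.mem_filter.2 ⟨Finset.mem_univ _, funext fun i => Fin.ext ?_,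
            funext fun i => Fin.ext ?_, h.strictMono⟩
          · rw [hb, ← h.start i i.2]
            exact (TypeB.extendPath_apply P 0 i).symm
          · rw [ha, ← h.final m i le_rfl i.2, TypeB.extendPath_of_le P le_rfl]
        · by_contra hne
          obtain ⟨-, h0, h1, h2⟩ := Finset.mem_filter.1 hP
          exact hP' (Finset.mem_filter.2 ⟨Finset.mem_univ _, TypeB.isPath_of_prod_ne_zero Y
            (fun i => by rw [h0, hb]) (fun i => by rw [h1, ha]) h2 hne⟩)
    _ = _ := by
        -- Paths and arrays of rests are in bijection, compatibly with weights.
        refine Finset.sum_nbij' (TypeB.finiteArray (m - m'))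
          (TypeB.finitePath m (TypeB.target r m' d)) (fun P hP => ?_) (fun K hK => ?_)
          (fun P hP => ?_) (fun K hK => ?_) (fun P hP => ?_)
        · exact Finset.mem_filter.2 ⟨Finset.mem_univ _, TypeB.admissible_finiteArray hdr hcr hcm
            (Finset.mem_filter.1 hP).2⟩
        · exact Finset.mem_filter.2 ⟨Finset.mem_univ _, TypeB.isPath_finitePath hdr hcr hcm
            (Finset.mem_filter.1 hK).2⟩
        · exact TypeB.finitePath_finiteArray hdr hcr hcm (Finset.mem_filter.1 hP).2
        · exact TypeB.finiteArray_finitePath hdr hcr hcm (Finset.mem_filter.1 hK).2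
        · exact TypeB.prod_weight_finite hdr hcr hcm hmr hd Y (Finset.mem_filter.1 hP).2
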